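/- **Setting.** $G=(V,E)$ is a finite simple graph, $S\subseteq V$, $k\ge 0$ an integer. A rooted tree decomposition $\mathcal T=(T,\{X_t\})$ consists of a finite rooted tree $T$ and bags $X_t\subseteq V$ whose union is $V$, such that each edge of $G$ lies in a bag and for each vertex the nodes whose bags contain it induce a subtree; its width is $\max_t|X_t|-1$. $T_t$ is the subtree rooted at $t$, $V_t$ the union of its bags, $L_t=V_t\setminus X_t$, $R_t=V\setminus V_t$. The $S$-trace of $t$ is $(L_t^S,X_t^S,R_t^S)=(L_t\cap S,X_t\cap S,R_t\cap S)$. The nodes with a given $S$-trace with nonempty first entry form a directed path; its lowest node is called an *$S$-bottom node*. A child $c$ of $t$ is an *$S$-child* of $t$ if $(L_c^S\cup X_c^S)\setminus(R_t^S\cup X_t^S)\ne\emptyset$. A bag (or node) is *full* if the bag has exactly $k+1$ vertices; the number $k$ is the same throughout the statement. **$S$-nice.** $\mathcal T$ is $S$-nice if bags of a node and its parent are nested and their sizes differ by at most one, and for each $S$-bottom node $t$ one of the following holds: $t$ has exactly one $S$-child $t_1$ and $X_t^S=X_{t_1}^S\cup\{v\}$ for some $v\in S\setminus X_{t_1}$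 (introduce); $t$ has exactly one $S$-child $t_1$ and $X_t^S=X_{t_1}^S\setminus\{v\}$ for some $v\in S\cap X_{t_1}$ ($\mathsf{forget}(v)$); $t$ has exactly two $S$-children $t_1,t_2$ and $X_{t_1}^S\cup X_{t_2}^S\subseteq X_t^S$ (join). An $S$-trace is a direct predecessor of another one in $\mathcal T$ if some $S$-bottom node with the latter $S$-trace has an $S$-child with the former; the predecessor relation is the transitive closure. Two $S$-nice tree decompositions are *siblings* if they have the same predecessor relation. **Slim.** A *full join tree* is a maximal subtree of $T$ with at least two nodes, all having the same full bag. A connected component of an induced subgraph of $G$ is an *$F$-component* if it contains no vertex of $S$. An $S$-nice $\mathcal T$ is *slim* if: 1. the root is not an $S$-bottom node; 2. each $S$-bottom node $t$ with two $S$-children lies in a full join tree, or both $S$-children and the parent of $t$ have non-full bags not larger than $X_t$; 3. for each non-full $S$-bottom node $t$ with parent $p$, $X_t=X_p$ and $t$ is the only $S$-child of $p$; 4. if an $S$-bottom node admits $\mathsf{forget}(v)$ and its $S$-child $c$ is non-full, then $c$ has at most one $S$-child $d$, and $X_c=X_d$ if $d$ exists; 5. if the parent $p$ of an $S$-bottom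 node is non-full, then $p$ is the root or the parent of $p$ is not an $S$-bottom node; 6. all nodes of a full join tree are $S$-bottom nodes with two $S$-children; 7. for each full join tree $J$ with root $r$ and bag $X$ and each $v\in X\setminus S$ there are three different $u_1,u_2,u_3\in N(v)\setminus X$, each connected to $S$ in $G-X$, and three different nodes $t_1,t_2,t_3$, each being an $S$-child outside $J$ of a node of $J$, or the parent of $r$, such that $u_i\in V_{t_i}$ if $t_i$ is such an $S$-child, and $u_i\notin V_r$ if $t_i$ is the parent of $r$. **Modifications.** (All choices are arbitrary.) *Normalize*, as long as possible: for a node $t$ with parent $p$, if $X_t,X_p$ are not nested, subdivide the edge $tp$ by a node with bag $X_t\cap X_p$; if they are nested and their sizes differ by $d\ge2$, subdivide $tp$ by $d-1$ nodes whose bags interpolate, changing one vertex at a time. *MergeFullNodes*, as long as possible: for a node $t$ with parent $p$ and $X_t=X_p$ full, if $t$ has at most one $S$-child or is the only $S$-child of $p$, delete $t$ and connect its children to $p$. *Attaching* $M'$ below a node $q$ (for $M'\neq\emptyset$): take a minimum-width tree decomposition of the graph obtained from $G[N[M']]$ by making $N(M')$ a clique, root it at a node whose bag contains $N(M')$, and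 make this root a child of $q$. - $\mathsf{MoveIntoSubtree}(t,M)$: delete $M$ from all bags outside $T_t$, attach $M\setminus V_t$ below $t$, Normalize, MergeFullNodes. - $\mathsf{RemoveFromSubtree}(t,M)$, $t$ having parent $p$: delete $M$ from all bags in $T_t$, attach $M\cap(V_t\setminus X_p)$ below $p$, Normalize, MergeFullNodes. - $\mathsf{BringNeighborUp}(t,v,u)$: replace $v$ by $u$ in all bags of nodes in $T_t$ other than $t$, add $u$ to $X_t$, Normalize. - $\mathsf{BringNeighborDown}(t,v,u)$: replace $v$ by $u$ in all bags of nodes outside $T_t$, add $u$ to $X_t$, Normalize. **Top-heavy.** Let $t$ be a parent of an $S$-bottom node with $|X_t|\le k$. A slim $S$-nice $\mathcal T$ is *top-heavy for $t$* if 1. for each $S$-bottom node $b$ in $T_t$, each $F$-component $C$ of $G-X_b$ and each $S$-child $c$ of $b$, $V(C)\cap V_c=\emptyset$; and if, for each node $q$ of $T_t$ with $|X_q|\le k$ that is a parent of an $S$-bottom node, and each node $t'$ outside $T_q$, none of the following changes $T_q$ or a bag in it: 2. $\mathsf{MoveIntoSubtree}(t',M)$ for $M\subseteq V\setminus S$ with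 $N(M)\subseteq V_{t'}$; 3. $\mathsf{RemoveFromSubtree}(t',M)$ for $M\subseteq V\setminus S$ with $N(M)\subseteq(V\setminus V_{t'})\cup X_p$, where $p$ is the parent of $t'$; 4. $\mathsf{BringNeighborUp}(t',v,u)$ if $|X_{t'}|\le k$, $v\in X_{t'}\setminus S$, $u\in V\setminus S$ and $N(v)\cap(V_{t'}\setminus X_{t'})=\{u\}$; 5. $\mathsf{BringNeighborDown}(t',v,u)$ if $|X_{t'}|\le k$, $v\in X_{t'}\setminus S$, $u\in V\setminus S$ and $N(v)\cap(V\setminus V_{t'})=\{u\}$. **Lemma.** Let $\mathcal T$ be a slim $S$-nice tree decomposition of $G$ of width $k$. Then for every node $t$ of $\mathcal T$ with $|X_t|\le k$ that is the parent of an $S$-bottom node $s$, there is a slim $S$-nice tree decomposition $\mathcal T'$ of $G$ of width at most $k$ that is a sibling of $\mathcal T$ and top-heavy for $t$; here $t$ is identified in $\mathcal T'$ as the parent of the $S$-bottom node $s$ of $\mathcal T'$ that has the same $S$-trace as the node $s$ of $\mathcal T$. -/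

import Mathlib

/-- Raw data of a rooted tree with bags: a finite set of node names, a root, a parent function (the
root is its own parent by convention, values outside `nodes` are irrelevant) and a bag for each
node. The conditions that make it a rooted tree decomposition are stated separately, because
modifications act on the raw data. -/
structure RTD (V : Type*) where
  nodes : Finset ℕ
  root : ℕ
  parent : ℕ → ℕ
  bag : ℕ → Set V

namespace RTD

variable {V : Type*}

/-! ### Rooted trees -/

/-- Every node reaches the root by following parents. -/
def IsRootedTree (T : RTD V) : Prop :=
  T.root ∈ T.nodes ∧ T.parent T.root = T.root ∧
  (∀ t ∈ T.nodes, T.parent t ∈ T.nodes) ∧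
  ∀ t ∈ T.nodes, ∃ n : ℕ, T.parent^[n] t = T.root

/-- `p` is the parent of the node `t`, that is, `t` is a child of `p`. -/
def IsParent (T : RTD V) (p t : ℕ) : Prop :=
  t ∈ T.nodes ∧ t ≠ T.root ∧ T.parent t = p

/-- `s` is a node of the subtree `T_t` rooted at `t` (this includes `s = t`). -/
def InSubtree (T : RTD V) (s t : ℕ) : Prop :=
  s ∈ T.nodes ∧ ∃ n : ℕ, T.parent^[n] s = t

/-- The underlying undirected tree. -/
def treeGraph (T : RTD V) : SimpleGraph ℕ := SimpleGraph.fromRel T.IsParent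

/-! ### Tree decompositions -/

/-- `T` is a rooted tree decomposition of the graph with vertex set `W` whose edges are the edges of
`H` between vertices of `W`. -/
def IsTreeDecompositionOn (W : Set V) (H : SimpleGraph V) (T : RTD V) : Prop :=
  T.IsRootedTree ∧
  (⋃ t ∈ T.nodes, T.bag t) = W ∧
  (∀ u ∈ W, ∀ v ∈ W, H.Adj u v → ∃ t ∈ T.nodes, u ∈ T.bag t ∧ v ∈ T.bag t) ∧
  ∀ v ∈ W, (T.treeGraph.induce {t | t ∈ T.nodes ∧ v ∈ T.bag t}).Connected

/-- `T` is a rooted tree decomposition of `G`. -/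
def IsTreeDecomposition (G : SimpleGraph V) (T : RTD V) : Prop :=
  IsTreeDecompositionOn Set.univ G T

/-- The width: maximum bag size minus one. -/
noncomputable def width (T : RTD V) : ℤ :=
  ((T.nodes.sup fun t => (T.bag t).ncard : ℕ) : ℤ) - 1

/-- A tree decomposition of minimum width of the graph `(W, H)`. -/
def IsOptimalOn (W : Set V) (H : SimpleGraph V) (T : RTD V) : Prop :=
  IsTreeDecompositionOn W H T ∧ ∀ T' : RTD V, IsTreeDecompositionOn W H T' → T.width ≤ T'.width

/-- The bag of `t` is full with respect to `k`. -/
def IsFull (T : RTD V) (k t : ℕ) : Prop := (T.bag t).ncard = k + 1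

/-! ### Traces, bottom nodes, `S`-children -/

/-- `V_t`: union of the bags in the subtree rooted at `t`. -/
def Vset (T : RTD V) (t : ℕ) : Set V := {v | ∃ s, T.InSubtree s t ∧ v ∈ T.bag s}

/-- `L_t = V_t \ X_t`. -/
def Lset (T : RTD V) (t : ℕ) : Set V := T.Vset t \ T.bag t

/-- `R_t = V \ V_t`. -/
def Rset (T : RTD V) (t : ℕ) : Set V := (T.Vset t)ᶜ

/-- The `S`-trace of `t`. -/
def trace (T : RTD V) (S : Set V) (t : ℕ) : Set V × Set V × Set V :=
  (T.Lset t ∩ S, T.bag t ∩ S, T.Rset t ∩ S)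

/-- `S`-bottom nodes. The nodes with a given `S`-trace whose first entry is nonempty form a directed
path; its bottom node is the one node on it that has no child on it. -/
def IsSBottom (T : RTD V) (S : Set V) (t : ℕ) : Prop :=
  t ∈ T.nodes ∧ (T.Lset t ∩ S).Nonempty ∧ ∀ c, T.IsParent t c → T.trace S c ≠ T.trace S t

/-- The set of `S`-children of `t`. -/
def sChildren (T : RTD V) (S : Set V) (t : ℕ) : Set ℕ :=
  {c | T.IsParent t c ∧
    (((T.Lset c ∩ S) ∪ (T.bag c ∩ S)) \ ((T.Rset t ∩ S) ∪ (T.bag t ∩ S))).Nonempty}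

/-! ### `S`-nice tree decompositions -/

def AdmitsIntroduce (T : RTD V) (S : Set V) (t : ℕ) (v : V) : Prop :=
  ∃ t₁, T.sChildren S t = {t₁} ∧ v ∈ S ∧ v ∉ T.bag t₁ ∧ T.bag t ∩ S = (T.bag t₁ ∩ S) ∪ {v}

def AdmitsForget (T : RTD V) (S : Set V) (t : ℕ) (v : V) : Prop :=
  ∃ t₁, T.sChildren S t = {t₁} ∧ v ∈ S ∧ v ∈ T.bag t₁ ∧ T.bag t ∩ S = (T.bag t₁ ∩ S) \ {v}

def AdmitsJoin (T : RTD V) (S : Set V) (t : ℕ) : Prop :=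
  ∃ t₁ t₂, t₁ ≠ t₂ ∧ T.sChildren S t = {t₁, t₂} ∧
    (T.bag t₁ ∩ S) ∪ (T.bag t₂ ∩ S) ⊆ T.bag t ∩ S

/-- `T` is an `S`-nice tree decomposition of `G`. -/
def IsSNice (G : SimpleGraph V) (S : Set V) (T : RTD V) : Prop :=
  IsTreeDecomposition G T ∧
  (∀ p t, T.IsParent p t →
    (T.bag t ⊆ T.bag p ∨ T.bag p ⊆ T.bag t) ∧
    (T.bag t).ncard ≤ (T.bag p).ncard + 1 ∧ (T.bag p).ncard ≤ (T.bag t).ncard + 1) ∧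
  ∀ t, T.IsSBottom S t →
    (∃ v, T.AdmitsIntroduce S t v) ∨ (∃ v, T.AdmitsForget S t v) ∨ T.AdmitsJoin S t

/-- `τ` is a direct predecessor of `σ` in `T`. -/
def DirectPred (T : RTD V) (S : Set V) (τ σ : Set V × Set V × Set V) : Prop :=
  ∃ t, T.IsSBottom S t ∧ T.trace S t = σ ∧ ∃ c ∈ T.sChildren S t, T.trace S c = τ

/-- The predecessor relation on `S`-traces. -/
def Pred (T : RTD V) (S : Set V) : Set V × Set V × Set V → Set V × Set V × Set V → Prop :=
  Relation.TransGen (T.DirectPred S)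

/-- Siblings: same predecessor relation on `S`-traces. -/
def Sibling (S : Set V) (T T' : RTD V) : Prop :=
  ∀ τ σ, T.Pred S τ σ ↔ T'.Pred S τ σ

/-! ### Modifications

The modifications make arbitrary choices; each is given as the relation between a tree decomposition
and its possible results. -/

/-- The open neighborhood of a vertex set. -/
def nbhd (G : SimpleGraph V) (M : Set V) : Set V := {u | u ∉ M ∧ ∃ v ∈ M, G.Adj v u}

/-- `T'` arises from `T` by performing steps until no further step applies. -/
def Exhaust (step : RTD V → RTD V → Prop) (T T' : RTD V) : Prop :=
  Relation.ReflTransGen step T T' ∧ ∀ T'', ¬ step T' T''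

/-- Subdivide the edge between `t` and its parent by a new node `n` with bag `B`. -/
def subdivide (T : RTD V) (t n : ℕ) (B : Set V) : RTD V where
  nodes := insert n T.nodes
  root := T.root
  parent := fun x => if x = n then T.parent t else if x = t then n else T.parent x
  bag := fun x => if x = n then B else T.bag x

/-- One subdivision made by `Normalize`. When the bags of a node and its parent are nested and their
sizes differ by at least two, the chain of new nodes is inserted one node at a time. -/
def NormalizeStep (T T' : RTD V) : Prop :=
  ∃ p t n, T.IsParent p t ∧ n ∉ T.nodes ∧
    ((¬ T.bag t ⊆ T.bag p ∧ ¬ T.bag p ⊆ T.bag t ∧ T' = T.subdivide t n (T.bag t ∩ T.bag p)) ∨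
     (T.bag t ⊆ T.bag p ∧ (T.bag t).ncard + 1 < (T.bag p).ncard ∧
        ∃ x ∈ T.bag p \ T.bag t, T' = T.subdivide t n (T.bag p \ {x})) ∨
     (T.bag p ⊆ T.bag t ∧ (T.bag p).ncard + 1 < (T.bag t).ncard ∧
        ∃ x ∈ T.bag t \ T.bag p, T' = T.subdivide t n (T.bag t \ {x})))

/-- Remove `t` and connect its children to its parent. -/
def mergeIntoParent (T : RTD V) (t : ℕ) : RTD V where
  nodes := T.nodes.erase t
  root := T.root
  parent := fun x => if T.parent x = t then T.parent t else T.parent x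
  bag := T.bag

/-- One step of `MergeFullNodes`. -/
def MergeStep (S : Set V) (k : ℕ) (T T' : RTD V) : Prop :=
  ∃ p t, T.IsParent p t ∧ T.bag t = T.bag p ∧ T.IsFull k t ∧
    ((T.sChildren S t).Subsingleton ∨ T.sChildren S p = {t}) ∧ T' = T.mergeIntoParent t

/-- `Normalize`, then `MergeFullNodes`. -/
def NormalizeAndMerge (S : Set V) (k : ℕ) (T T' : RTD V) : Prop :=
  ∃ T₁, Exhaust NormalizeStep T T₁ ∧ Exhaust (MergeStep S k) T₁ T'

/-- Make the root of `U` a child of the node `t` of `T`. -/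
def graft (T : RTD V) (t : ℕ) (U : RTD V) : RTD V where
  nodes := T.nodes ∪ U.nodes
  root := T.root
  parent := fun x => if x = U.root then t else if x ∈ U.nodes then U.parent x else T.parent x
  bag := fun x => if x ∈ U.nodes then U.bag x else T.bag x

/-- `G` with all edges between two vertices of `N(M)` added. -/
def fillNbhd (G : SimpleGraph V) (M : Set V) : SimpleGraph V :=
  G ⊔ SimpleGraph.fromRel fun a b => a ∈ nbhd G M ∧ b ∈ nbhd G M

/-- If `M` is nonempty, attach below `t` an optimal tree decomposition of the graph obtained from
`G[N[M]]` by making `N(M)` a clique, rooted at a node whose bag contains `N(M)`. -/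
def AttachAt (G : SimpleGraph V) (M : Set V) (t : ℕ) (T T' : RTD V) : Prop :=
  (M = ∅ ∧ T' = T) ∨
  (M.Nonempty ∧ ∃ U : RTD V, Disjoint T.nodes U.nodes ∧
    IsOptimalOn (M ∪ nbhd G M) (fillNbhd G M) U ∧
    nbhd G M ⊆ U.bag U.root ∧ T' = T.graft t U)

/-- Remove the vertices of `M` from all bags outside the subtree rooted at `t`. -/
def deleteOutside (T : RTD V) (t : ℕ) (M : Set V) : RTD V :=
  { T with bag := fun x => {y | y ∈ T.bag x ∧ (y ∈ M → T.InSubtree x t)} }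

/-- Remove the vertices of `M` from all bags of the subtree rooted at `t`. -/
def deleteInside (T : RTD V) (t : ℕ) (M : Set V) : RTD V :=
  { T with bag := fun x => {y | y ∈ T.bag x ∧ (y ∈ M → ¬ T.InSubtree x t)} }

/-- `T'` is a result of applying `MoveIntoSubtree(t, M)` to `T`. -/
def MoveIntoSubtree (G : SimpleGraph V) (S : Set V) (k : ℕ) (T : RTD V) (t : ℕ) (M : Set V)
    (T' : RTD V) : Prop :=
  ∃ T₁, AttachAt G (M \ T.Vset t) t (T.deleteOutside t M) T₁ ∧ NormalizeAndMerge S k T₁ T'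

/-- `T'` is a result of applying `RemoveFromSubtree(t, M)` to `T`, where `p` is the parent of
`t`. -/
def RemoveFromSubtree (G : SimpleGraph V) (S : Set V) (k : ℕ) (T : RTD V) (p t : ℕ) (M : Set V)
    (T' : RTD V) : Prop :=
  ∃ T₁, AttachAt G (M ∩ (T.Vset t \ T.bag p)) p (T.deleteInside t M) T₁ ∧
    NormalizeAndMerge S k T₁ T'

/-- Replace `v` with `u` in `B`, if `v` is present. -/
def replace (B : Set V) (v u : V) : Set V := {y | (y ∈ B ∧ y ≠ v) ∨ (v ∈ B ∧ y = u)}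

open Classical in
/-- `T'` is a result of applying `BringNeighborUp(t, v, u)` to `T`. -/
def BringNeighborUp (T : RTD V) (t : ℕ) (v u : V) (T' : RTD V) : Prop :=
  Exhaust NormalizeStep
    { T with bag := fun x =>
        if x = t then insert u (T.bag t)
        else if T.InSubtree x t then replace (T.bag x) v u else T.bag x } T'

open Classical in
/-- `T'` is a result of applying `BringNeighborDown(t, v, u)` to `T`. -/
def BringNeighborDown (T : RTD V) (t : ℕ) (v u : V) (T' : RTD V) : Prop :=
  Exhaust NormalizeStep
    { T with bag := fun x =>
        if x = t then insert u (T.bag t)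
        else if T.InSubtree x t then T.bag x else replace (T.bag x) v u } T'

/-- Passing from `T` to `T'` changes neither the subtree rooted at `t` nor a bag in it. -/
def SubtreeUnchanged (T T' : RTD V) (t : ℕ) : Prop :=
  (∀ x, T'.InSubtree x t ↔ T.InSubtree x t) ∧
  ∀ x, T.InSubtree x t → T'.bag x = T.bag x ∧ (x ≠ t → T'.parent x = T.parent x)

/-! ### Slim tree decompositions -/

/-- A connected set of at least two nodes that all have the same bag of size `k + 1`. -/
def IsFullTree (T : RTD V) (k : ℕ) (J : Set ℕ) : Prop :=
  J ⊆ T.nodes ∧ J.Nontrivial ∧ (T.treeGraph.induce J).Connected ∧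
  ∃ X : Set V, X.ncard = k + 1 ∧ ∀ t ∈ J, T.bag t = X

/-- `J` is the node set of a full join tree. -/
def IsFullJoinTree (T : RTD V) (k : ℕ) (J : Set ℕ) : Prop :=
  Maximal (T.IsFullTree k) J

/-- `C` is the vertex set of a connected component of `G[W]`. -/
def IsComponent (G : SimpleGraph V) (W C : Set V) : Prop :=
  ∃ c : (G.induce W).ConnectedComponent, C = Subtype.val '' c.supp

/-- `C` is the vertex set of an `F`-component of `G[W]`. -/
def IsFComponent (G : SimpleGraph V) (S W C : Set V) : Prop :=
  IsComponent G W C ∧ C ∩ S = ∅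

/-- `u` is connected to `S` in `G[W]`. -/
def ConnectedTo (G : SimpleGraph V) (S W : Set V) (u : V) : Prop :=
  ∃ C, IsComponent G W C ∧ u ∈ C ∧ (C ∩ S).Nonempty

/-- `T` is slim for `S`, fullness of bags being measured with respect to `k`. -/
structure IsSlim (G : SimpleGraph V) (S : Set V) (k : ℕ) (T : RTD V) : Prop where
  root_not_bottom : ¬ T.IsSBottom S T.root
  join : ∀ t, T.IsSBottom S t → (T.sChildren S t).ncard = 2 →
    (∃ J, T.IsFullJoinTree k J ∧ t ∈ J) ∨
    ((∀ c ∈ T.sChildren S t, ¬ T.IsFull k c ∧ (T.bag c).ncard ≤ (T.bag t).ncard) ∧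
      ∀ p, T.IsParent p t → ¬ T.IsFull k p ∧ (T.bag p).ncard ≤ (T.bag t).ncard)
  parent_same : ∀ t, T.IsSBottom S t → ¬ T.IsFull k t →
    ∀ p, T.IsParent p t → T.bag t = T.bag p ∧ T.sChildren S p = {t}
  forget : ∀ t v, T.IsSBottom S t → T.AdmitsForget S t v →
    ∀ c ∈ T.sChildren S t, ¬ T.IsFull k c →
      (T.sChildren S c).Subsingleton ∧ ∀ d ∈ T.sChildren S c, T.bag c = T.bag d
  grandparent : ∀ t p, T.IsSBottom S t → T.IsParent p t → ¬ T.IsFull k p →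
    p = T.root ∨ ¬ T.IsSBottom S (T.parent p)
  full_bottom : ∀ J, T.IsFullJoinTree k J →
    ∀ t ∈ J, T.IsSBottom S t ∧ (T.sChildren S t).ncard = 2
  /-- With `r` the root of the full join tree `J` and `X` its common bag, each vertex of `X \ S` has
  neighbors, connected to `S` outside `X`, in three different directions of `J`; a direction is an
  `S`-child of a node of `J` outside `J`, or the parent of `r`. -/
  full_nbrs : ∀ J, T.IsFullJoinTree k J → ∀ r ∈ J, (∀ t ∈ J, T.InSubtree t r) →
    ∀ v ∈ T.bag r \ S, ∃ (u : Fin 3 → V) (c : Fin 3 → ℕ),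
      Function.Injective u ∧ Function.Injective c ∧
      ∀ i, G.Adj v (u i) ∧ u i ∉ T.bag r ∧ ConnectedTo G S (T.bag r)ᶜ (u i) ∧
        ((c i ∉ J ∧ (∃ t ∈ J, c i ∈ T.sChildren S t) ∧ u i ∈ T.Vset (c i)) ∨
         (T.IsParent (c i) r ∧ u i ∉ T.Vset r))

/-! ### Top-heavy tree decompositions -/

/-- `t` is the parent of an `S`-bottom node and its bag has at most `k` vertices. -/
def IsNonfullParentOfBottom (T : RTD V) (S : Set V) (k t : ℕ) : Prop :=
  (∃ s, T.IsParent t s ∧ T.IsSBottom S s) ∧ (T.bag t).ncard ≤ k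

/-- `T` is top-heavy for `t`. -/
structure IsTopHeavy (G : SimpleGraph V) (S : Set V) (k : ℕ) (T : RTD V) (t : ℕ) : Prop where
  parent_of_bottom : T.IsNonfullParentOfBottom S k t
  components : ∀ b, T.IsSBottom S b → T.InSubtree b t →
    ∀ C, IsFComponent G S (T.bag b)ᶜ C → ∀ c ∈ T.sChildren S b, C ∩ T.Vset c = ∅
  move : ∀ q, T.InSubtree q t → T.IsNonfullParentOfBottom S k q →
    ∀ t' ∈ T.nodes, ¬ T.InSubtree t' q →
    ∀ M ⊆ Sᶜ, nbhd G M ⊆ T.Vset t' →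
    ∀ T', MoveIntoSubtree G S k T t' M T' → SubtreeUnchanged T T' q
  remove : ∀ q, T.InSubtree q t → T.IsNonfullParentOfBottom S k q →
    ∀ t' ∈ T.nodes, ¬ T.InSubtree t' q → ∀ p, T.IsParent p t' →
    ∀ M ⊆ Sᶜ, nbhd G M ⊆ (T.Vset t')ᶜ ∪ T.bag p →
    ∀ T', RemoveFromSubtree G S k T p t' M T' → SubtreeUnchanged T T' q
  bring_up : ∀ q, T.InSubtree q t → T.IsNonfullParentOfBottom S k q →
    ∀ t' ∈ T.nodes, ¬ T.InSubtree t' q → (T.bag t').ncard ≤ k →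
    ∀ v ∈ T.bag t' \ S, ∀ u ∉ S, G.neighborSet v ∩ (T.Vset t' \ T.bag t') = {u} →
    ∀ T', BringNeighborUp T t' v u T' → SubtreeUnchanged T T' q
  bring_down : ∀ q, T.InSubtree q t → T.IsNonfullParentOfBottom S k q →
    ∀ t' ∈ T.nodes, ¬ T.InSubtree t' q → (T.bag t').ncard ≤ k →
    ∀ v ∈ T.bag t' \ S, ∀ u ∉ S, G.neighborSet v ∩ (T.Vset t')ᶜ = {u} →
    ∀ T', BringNeighborDown T t' v u T' → SubtreeUnchanged T T' q

end RTD

set_option linter.unusedSectionVars false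

namespace RTD

variable {V : Type*} {T : RTD V}

/-! ### Rooted trees and subtrees -/

/-! The proof is extremal. Among all decompositions that keep the direct predecessors of `T` and the
part of slimness that subdividing edges cannot restore (`WeaklySlim`), choose one minimizing
`weight`: the sum, over the `S`-bottom nodes `b`, of `|V_b|` and of the number of vertices outside
`X_b` lying below an `S`-child of `b`. A minimizer has nothing left that could be moved upwards.
Top-heaviness asserts that certain modifications leave the subtrees below non-full parents of bottom
nodes alone, and this follows because such subtrees contain nothing movable.

Two operations lower the weight. `hang` takes an `F`-component `M` of `G - X_p` lying below a child
of `p`, deletes it everywhere, and attaches below `p` a node with bag `N(M)` carrying a trimmed copy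
of the subtree that contained `M`. `push` handles a vertex `v ∉ S` of a non-full bag `X_q` with at
most one neighbor in `V_q \ X_q`, that neighbor being outside `S`: below `q`, `v` is replaced by
that neighbor, or deleted if there is none. Room for these operations above a bottom node is made by
inserting three nodes with the same non-full bag, which costs no weight. Minimality therefore yields
`Tight` (`IsMinimal.tight`): no `F`-component of `G - X_q` meets `V_q`, and each `v ∈ X_q \ S` has a
neighbor in `S`, or two neighbors, inside `V_q \ X_q`.

The delicate point is that both operations preserve the conditions on full join trees. They are kept
in a local form: on an edge whose ends have the same full bag `X`, both ends have two `S`-children,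
and each `v ∈ X \ S` has three neighbors, connected to `S` in `G - X`, that are pairwise separated
by sets `V_z` with `z` at the nodes with bag `X` or just below them (`Sep`). `IsHang.full_edge` and
`IsPush.full_edge` show that no new edge of this kind arises and that the surviving ones keep their
bags; `WeaklySlim.full_nbrs` recovers three different directions. All operations fix the traces of
the relevant nodes, which `Skel` packages: bottom nodes, `S`-children and hence the predecessor
relation are preserved.

A minimizer need not be `S`-nice or slim, but subdividing its edges by suitable chains of bags makes
it so (`exists_isCompletion`, `IsCompletion.isSNice`, `IsCompletion.isSlim`). The non-full parents
of bottom nodes in the result are tight (`IsCompletion.tight`).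

Tightness gives top-heaviness as follows. A set `M` outside `S` whose neighbors inside `V_q` all lie
in `X_q` cannot meet `V_q` (`Tight.notMem_of_nbhd`), and a vertex with just one relevant neighbor
outside `S` cannot occur in a bag below `q`. Hence the four modifications leave all bags below `q`
untouched, and Normalize and MergeFullNodes find nothing to do there since the decomposition is
already `S`-nice and weakly slim (`Agree`). -/

theorem IsRootedTree.exists_depth (h : T.IsRootedTree) :
    ∃ d : ℕ → ℕ, ∀ t ∈ T.nodes, t ≠ T.root → d (T.parent t) < d t := by
  refine ⟨fun t => sInf {n | T.parent^[n] t = T.root}, fun t ht hne => ?_⟩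
  have hs := Nat.sInf_mem (s := {n | T.parent^[n] t = T.root}) (h.2.2.2 t ht)
  set n := sInf {n | T.parent^[n] t = T.root} with hn
  change T.parent^[n] t = T.root at hs
  show sInf {n | T.parent^[n] (T.parent t) = T.root} < n
  rcases hnn : n with _ | m
  · rw [hnn] at hs; exact absurd hs hne
  · rw [hnn, Function.iterate_succ_apply] at hs
    exact Nat.lt_succ_of_le (Nat.sInf_le hs)

theorem isRootedTree_of_depth (h1 : T.root ∈ T.nodes) (h2 : T.parent T.root = T.root)
    (h3 : ∀ t ∈ T.nodes, T.parent t ∈ T.nodes) (d : ℕ → ℕ)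
    (hd : ∀ t ∈ T.nodes, t ≠ T.root → d (T.parent t) < d t) : T.IsRootedTree := by
  refine ⟨h1, h2, h3, fun t ht => ?_⟩
  induction hn : d t using Nat.strong_induction_on generalizing t with
  | _ n ih =>
    by_cases hr : t = T.root
    · exact ⟨0, hr⟩
    · obtain ⟨m, hm⟩ := ih (d (T.parent t)) (hn ▸ hd t ht hr) _ (h3 t ht) rfl
      exact ⟨m + 1, by rwa [Function.iterate_succ_apply]⟩

theorem IsParent.parent_mem (hT : T.IsRootedTree) {p t : ℕ} (h : T.IsParent p t) :
    p ∈ T.nodes := h.2.2 ▸ hT.2.2.1 t h.1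

theorem IsParent.unique {p p' t : ℕ} (h : T.IsParent p t) (h' : T.IsParent p' t) : p = p' :=
  h.2.2.symm.trans h'.2.2

theorem InSubtree.refl {t : ℕ} (ht : t ∈ T.nodes) : T.InSubtree t t := ⟨ht, 0, rfl⟩

theorem InSubtree.trans {x y z : ℕ} (h : T.InSubtree x y) (h' : T.InSubtree y z) :
    T.InSubtree x z := by
  obtain ⟨hx, n, rfl⟩ := h
  obtain ⟨_, m, rfl⟩ := h'
  exact ⟨hx, m + n, by rw [Function.iterate_add_apply]⟩

theorem InSubtree.of_parent {x t : ℕ} (hx : x ∈ T.nodes) (h : T.InSubtree (T.parent x) t) :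
    T.InSubtree x t := by
  obtain ⟨_, n, rfl⟩ := h
  exact ⟨hx, n + 1, by rw [Function.iterate_succ_apply]⟩

theorem IsParent.inSubtree (hT : T.IsRootedTree) {p t : ℕ} (h : T.IsParent p t) :
    T.InSubtree t p :=
  InSubtree.of_parent h.1 (h.2.2 ▸ InSubtree.refl (hT.2.2.1 t h.1))

theorem iterate_mem (hT : T.IsRootedTree) {x : ℕ} (hx : x ∈ T.nodes) (n : ℕ) :
    T.parent^[n] x ∈ T.nodes := by
  induction n generalizing x with
  | zero => exact hx
  | succ n ih => rw [Function.iterate_succ_apply]; exact ih (hT.2.2.1 x hx)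

theorem InSubtree.mem_right (hT : T.IsRootedTree) {x t : ℕ} (h : T.InSubtree x t) :
    t ∈ T.nodes := by
  obtain ⟨hx, n, rfl⟩ := h
  exact iterate_mem hT hx n

theorem InSubtree.eq_root (hT : T.IsRootedTree) {t : ℕ} (h : T.InSubtree T.root t) :
    t = T.root := by
  obtain ⟨_, n, rfl⟩ := h
  exact Function.iterate_fixed hT.2.1 n

theorem InSubtree.parent_of_ne (hT : T.IsRootedTree) {x t : ℕ} (h : T.InSubtree x t)
    (hne : x ≠ t) : x ≠ T.root ∧ T.InSubtree (T.parent x) t := by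
  refine ⟨fun hx => hne ?_, ?_⟩
  · subst hx; exact (h.eq_root hT).symm
  · obtain ⟨hx, n, hn⟩ := h
    rcases n with _ | n
    · exact absurd hn hne
    · exact ⟨hT.2.2.1 x hx, n, by rwa [Function.iterate_succ_apply] at hn⟩

/-- Climbing from a node of the subtree at `t` up to `t`. -/
theorem InSubtree.climb (hT : T.IsRootedTree) {x t : ℕ} (h : T.InSubtree x t) {P : ℕ → Prop}
    (hx : P x) (step : ∀ y, T.InSubtree x y → T.InSubtree y t → y ≠ t → P y → P (T.parent y)) :
    P t := by
  have key : ∀ n y, T.InSubtree x y → T.parent^[n] y = t → P y → P t := by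
    intro n
    induction n with
    | zero => intro y _ h1 h2; exact h1 ▸ h2
    | succ n ih =>
      intro y hxy hn hy
      by_cases hyt : y = t
      · exact hyt ▸ hy
      have hyt' : T.InSubtree y t := ⟨hxy.mem_right hT, n + 1, hn⟩
      have hyr := (hyt'.parent_of_ne hT hyt).1
      exact ih (T.parent y) (hxy.trans (IsParent.inSubtree hT ⟨hyt'.1, hyr, rfl⟩))
        (by rwa [Function.iterate_succ_apply] at hn) (step y hxy hyt' hyt hy)
  obtain ⟨n, hn⟩ := h.2
  exact key n x (InSubtree.refl h.1) hn hx

theorem InSubtree.depth_lt (hT : T.IsRootedTree) {d : ℕ → ℕ}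
    (hd : ∀ t ∈ T.nodes, t ≠ T.root → d (T.parent t) < d t) {x t : ℕ} (h : T.InSubtree x t)
    (hne : x ≠ t) : d t < d x := by
  have h1 := h.parent_of_ne hT hne
  refine lt_of_le_of_lt ?_ (hd x h.1 h1.1)
  refine h1.2.climb hT (P := fun y => d y ≤ d (T.parent x)) le_rfl fun y _ hy hyt hle => ?_
  exact (hd y hy.1 (hy.parent_of_ne hT hyt).1).le.trans hle

theorem InSubtree.antisymm (hT : T.IsRootedTree) {x y : ℕ} (h : T.InSubtree x y)
    (h' : T.InSubtree y x) : x = y := by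
  obtain ⟨d, hd⟩ := hT.exists_depth
  by_contra hne
  exact lt_asymm (h.depth_lt hT hd hne) (h'.depth_lt hT hd (Ne.symm hne))

theorem InSubtree.total (hT : T.IsRootedTree) {x a b : ℕ} (ha : T.InSubtree x a)
    (hb : T.InSubtree x b) : T.InSubtree a b ∨ T.InSubtree b a := by
  have ha' := ha.mem_right hT
  have hb' := hb.mem_right hT
  obtain ⟨_, n, rfl⟩ := ha
  obtain ⟨_, m, rfl⟩ := hb
  rcases le_total n m with h | h
  · exact Or.inl ⟨ha', m - n, by rw [← Function.iterate_add_apply, Nat.sub_add_cancel h]⟩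
  · exact Or.inr ⟨hb', n - m, by rw [← Function.iterate_add_apply, Nat.sub_add_cancel h]⟩

theorem inSubtree_root (hT : T.IsRootedTree) {x : ℕ} (hx : x ∈ T.nodes) :
    T.InSubtree x T.root := ⟨hx, hT.2.2.2 x hx⟩

theorem InSubtree.exists_child (hT : T.IsRootedTree) {x t : ℕ} (h : T.InSubtree x t)
    (hne : x ≠ t) : ∃ c, T.IsParent t c ∧ T.InSubtree x c := by
  have := h.climb hT (P := fun y => y = x ∧ y ≠ t ∨ ∃ c, T.IsParent y c ∧ T.InSubtree x c)
    (Or.inl ⟨rfl, hne⟩) (fun y hxy hy hyt _ =>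
      Or.inr ⟨y, ⟨hy.1, (hy.parent_of_ne hT hyt).1, rfl⟩, hxy⟩)
  rcases this with h | h
  · exact absurd rfl h.2
  · exact h

theorem IsParent.ne (hT : T.IsRootedTree) {p t : ℕ} (h : T.IsParent p t) : t ≠ p := by
  obtain ⟨d, hd⟩ := hT.exists_depth
  rintro rfl
  have := hd t h.1 h.2.1
  rw [h.2.2] at this
  exact lt_irrefl _ this

theorem IsParent.not_inSubtree (hT : T.IsRootedTree) {p t : ℕ} (h : T.IsParent p t) :
    ¬ T.InSubtree p t := fun h' => h.ne hT ((h.inSubtree hT).antisymm hT h')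

/-- A node in the subtrees of two children of `t` forces the children to agree. -/
theorem IsParent.eq_of_inSubtree (hT : T.IsRootedTree) {t c c' x : ℕ} (h : T.IsParent t c)
    (h' : T.IsParent t c') (hx : T.InSubtree x c) (hx' : T.InSubtree x c') : c = c' := by
  by_contra hne
  rcases hx.total hT hx' with h1 | h1
  · have := (h1.parent_of_ne hT hne).2
    rw [h.2.2] at this
    exact h'.not_inSubtree hT this
  · have := (h1.parent_of_ne hT (Ne.symm hne)).2
    rw [h'.2.2] at this
    exact h.not_inSubtree hT this

/-! ### Vertices below a node -/

theorem bag_subset_Vset {t : ℕ} (ht : t ∈ T.nodes) : T.bag t ⊆ T.Vset t :=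
  fun _ hv => ⟨t, InSubtree.refl ht, hv⟩

theorem Vset_mono {x t : ℕ} (h : T.InSubtree x t) : T.Vset x ⊆ T.Vset t :=
  fun _ ⟨s, hs, hv⟩ => ⟨s, hs.trans h, hv⟩

/-! ### Tree decompositions by top nodes -/

/-- A rooted tree decomposition, connectedness being expressed by a top node for each vertex. -/
structure IsTD (G : SimpleGraph V) (T : RTD V) : Prop where
  rooted : T.IsRootedTree
  edge : ∀ u v, G.Adj u v → ∃ t ∈ T.nodes, u ∈ T.bag t ∧ v ∈ T.bag t
  top : ∀ v, ∃ r ∈ T.nodes, v ∈ T.bag r ∧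
    ∀ x ∈ T.nodes, v ∈ T.bag x → x ≠ r → x ≠ T.root ∧ v ∈ T.bag (T.parent x)

theorem treeGraph_adj {a b : ℕ} :
    T.treeGraph.Adj a b ↔ a ≠ b ∧ (T.IsParent a b ∨ T.IsParent b a) :=
  SimpleGraph.fromRel_adj ..

theorem mem_of_preconnected {α : Type*} {H : SimpleGraph α} {A : Set α}
    (hA : (H.induce A).Preconnected) {B : Set α} {x y : α} (hx : x ∈ A) (hy : y ∈ A)
    (hxB : x ∈ B) (hB : ∀ a ∈ A, ∀ b ∈ A, a ∈ B → H.Adj a b → b ∈ B) : y ∈ B := by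
  have h := (SimpleGraph.reachable_iff_reflTransGen _ _).1 (hA ⟨x, hx⟩ ⟨y, hy⟩)
  have : ∀ z : A, Relation.ReflTransGen (H.induce A).Adj ⟨x, hx⟩ z → (z : α) ∈ B := by
    intro z hz
    induction hz with
    | refl => exact hxB
    | tail _ hab ih => exact hB _ (Subtype.prop _) _ (Subtype.prop _) ih hab
  exact this _ h

/-- The only edge leaving the subtree at `x` joins `x` to its parent, so a connected set containing
`x` and a node outside that subtree must use it. -/
theorem mem_of_connected_of_minDepth (hT : T.IsRootedTree) {A : Set ℕ} (hAn : A ⊆ T.nodes)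
    (hA : (T.treeGraph.induce A).Preconnected) {x r : ℕ} (hr : r ∈ A) (hx : x ∈ A)
    (hrx : ¬ T.InSubtree r x) : x ≠ T.root ∧ T.parent x ∈ A := by
  by_contra hcon
  apply hrx
  refine mem_of_preconnected hA (B := {y | T.InSubtree y x}) hx hr (InSubtree.refl (hAn hx)) ?_
  rintro a ha b hb hax hab
  rcases (treeGraph_adj.1 hab).2 with h | h
  · exact (h.inSubtree hT).trans hax
  · by_cases hax' : a = x
    · subst hax'
      exact absurd ⟨h.2.1, h.2.2 ▸ hb⟩ hcon
    · exact h.2.2 ▸ (InSubtree.parent_of_ne hT hax hax').2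

theorem exists_top_of_connected (hT : T.IsRootedTree) {A : Set ℕ} (hAn : A ⊆ T.nodes)
    (hA : (T.treeGraph.induce A).Connected) :
    ∃ r ∈ A, ∀ x ∈ A, x ≠ r → x ≠ T.root ∧ T.parent x ∈ A := by
  obtain ⟨d, hd⟩ := hT.exists_depth
  obtain ⟨⟨a, ha⟩⟩ := hA.nonempty
  have hne : (d '' A).Nonempty := ⟨_, a, ha, rfl⟩
  obtain ⟨r, hr, hrd⟩ := Nat.sInf_mem hne
  refine ⟨r, hr, fun x hx hxr =>
    mem_of_connected_of_minDepth hT hAn hA.preconnected hr hx fun hrx => ?_⟩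
  have h1 := hrx.depth_lt hT hd (Ne.symm hxr)
  have h2 : sInf (d '' A) ≤ d x := Nat.sInf_le ⟨x, hx, rfl⟩
  omega

theorem inSubtree_of_top (hT : T.IsRootedTree) {A : Set ℕ} (hAn : A ⊆ T.nodes) {r : ℕ}
    (hr : ∀ x ∈ A, x ≠ r → x ≠ T.root ∧ T.parent x ∈ A) {x : ℕ} (hx : x ∈ A) :
    T.InSubtree x r := by
  obtain ⟨d, hd⟩ := hT.exists_depth
  induction hn : d x using Nat.strong_induction_on generalizing x with
  | _ n ih =>
    by_cases hxr : x = r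
    · subst hxr; exact InSubtree.refl (hAn hx)
    · obtain ⟨h1, h2⟩ := hr x hx hxr
      exact InSubtree.of_parent (hAn hx) (ih _ (hn ▸ hd x (hAn hx) h1) h2 rfl)

theorem connected_of_top (hT : T.IsRootedTree) {A : Set ℕ} (hAn : A ⊆ T.nodes) {r : ℕ}
    (hrA : r ∈ A) (hr : ∀ x ∈ A, x ≠ r → x ≠ T.root ∧ T.parent x ∈ A) :
    (T.treeGraph.induce A).Connected := by
  obtain ⟨d, hd⟩ := hT.exists_depth
  have key : ∀ n x (hx : x ∈ A), d x = n → (T.treeGraph.induce A).Reachable ⟨x, hx⟩ ⟨r, hrA⟩ := by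
    intro n
    induction n using Nat.strong_induction_on with
    | _ n ih =>
      intro x hx hn
      by_cases hxr : x = r
      · subst hxr; exact SimpleGraph.Reachable.refl _
      · obtain ⟨h1, h2⟩ := hr x hx hxr
        have hpar : T.IsParent (T.parent x) x := ⟨hAn hx, h1, rfl⟩
        refine SimpleGraph.Reachable.trans (SimpleGraph.Adj.reachable ?_)
          (ih _ (hn ▸ hd x (hAn hx) h1) _ h2 rfl)
        exact treeGraph_adj.2 ⟨hpar.ne hT, Or.inr hpar⟩
  have : Nonempty A := ⟨⟨r, hrA⟩⟩
  exact ⟨fun a b => (key _ a a.2 rfl).trans (key _ b b.2 rfl).symm⟩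

/-- With top nodes, connectedness becomes a condition on single nodes and their parents. This can be
checked directly for subdivided, copied and edited trees. -/
theorem isTreeDecomposition_iff {G : SimpleGraph V} :
    IsTreeDecomposition G T ↔ IsTD G T := by
  constructor
  · rintro ⟨h1, -, h3, h4⟩
    refine ⟨h1, fun u v => h3 u trivial v trivial, fun v => ?_⟩
    obtain ⟨r, hr, h⟩ := exists_top_of_connected h1 (fun x hx => hx.1) (h4 v trivial)
    exact ⟨r, hr.1, hr.2, fun x hx hvx hxr => ⟨(h x ⟨hx, hvx⟩ hxr).1, (h x ⟨hx, hvx⟩ hxr).2.2⟩⟩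
  · rintro ⟨h1, h2, h3⟩
    refine ⟨h1, Set.eq_univ_of_forall fun v => ?_, fun u _ v _ => h2 u v, fun v _ => ?_⟩
    · obtain ⟨r, hr, hv, -⟩ := h3 v
      exact Set.mem_biUnion hr hv
    · obtain ⟨r, hr, hv, h⟩ := h3 v
      refine connected_of_top h1 (fun x hx => hx.1) (r := r) ⟨hr, hv⟩ fun x hx hxr => ?_
      exact ⟨(h x hx.1 hx.2 hxr).1, h1.2.2.1 x hx.1, (h x hx.1 hx.2 hxr).2⟩

variable {G : SimpleGraph V}

/-- A vertex occurring both inside and outside the subtree at `c` is in the bags of `c` and of its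
parent. -/
theorem IsTD.crossing (hT : IsTD G T) {c x : ℕ} {v : V} (hv : v ∈ T.Vset c) (hx : x ∈ T.nodes)
    (hxc : ¬ T.InSubtree x c) (hvx : v ∈ T.bag x) :
    c ≠ T.root ∧ v ∈ T.bag c ∧ v ∈ T.bag (T.parent c) := by
  obtain ⟨y, hyc, hvy⟩ := hv
  obtain ⟨r, hr, hvr, hr'⟩ := hT.top v
  have hsub : ∀ z ∈ T.nodes, v ∈ T.bag z → T.InSubtree z r := fun z hz hvz =>
    inSubtree_of_top hT.rooted (A := {x | x ∈ T.nodes ∧ v ∈ T.bag x}) (fun x hx => hx.1)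
      (fun x hx hxr => ⟨(hr' x hx.1 hx.2 hxr).1, hT.rooted.2.2.1 x hx.1, (hr' x hx.1 hx.2 hxr).2⟩)
      ⟨hz, hvz⟩
  have hxr := hsub x hx hvx
  -- `x` lies below the top node `r` of `v` but not below `c`, so `r` is not below `c`. Hence `c` is
  -- strictly between `y` and `r`, on a path whose bags all contain `v`.
  have hrc : ¬ T.InSubtree r c := fun h => hxc (hxr.trans h)
  have hcr : T.InSubtree c r := (hyc.total hT.rooted (hsub y hyc.1 hvy)).resolve_right hrc
  have hvc : v ∈ T.bag c := hyc.climb hT.rooted (P := fun z => v ∈ T.bag z) hvy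
    fun z _ hzc hne hvz => (hr' z hzc.1 hvz (by rintro rfl; exact hrc hzc)).2
  have hcne : c ≠ r := by rintro rfl; exact hrc (InSubtree.refl hr)
  have := hr' c hcr.1 hvc hcne
  exact ⟨this.1, hvc, this.2⟩

theorem IsTD.mem_bag_of_anc (hT : IsTD G T) {x y : ℕ} {v : V} (hv : v ∈ T.Vset x)
    (hxy : T.InSubtree x y) (hvy : v ∈ T.bag y) : v ∈ T.bag x := by
  by_cases h : x = y
  · exact h ▸ hvy
  · exact (hT.crossing hv (hxy.mem_right hT.rooted)
      (fun h' => h (hxy.antisymm hT.rooted h')) hvy).2.1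

/-- A vertex below two different children of `p` is in the bag of `p`. -/
theorem IsTD.mem_bag_of_children (hT : IsTD G T) {p c c' : ℕ} {v : V} (h : T.IsParent p c)
    (h' : T.IsParent p c') (hne : c ≠ c') (hv : v ∈ T.Vset c) (hv' : v ∈ T.Vset c') :
    v ∈ T.bag p := by
  obtain ⟨y, hy, hvy⟩ := hv'
  have := hT.crossing hv hy.1 (fun hyc => hne (h.eq_of_inSubtree hT.rooted h' hyc hy)) hvy
  rw [h.2.2] at this
  exact this.2.2

theorem IsTD.exists_mem_bag (hT : IsTD G T) (v : V) : ∃ x ∈ T.nodes, v ∈ T.bag x := by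
  obtain ⟨r, hr, hv, -⟩ := hT.top v
  exact ⟨r, hr, hv⟩

/-- If the edge is covered by a bag outside the subtree at `z`, then `crossing` puts `a` into the
bags of both `z` and its parent. So `V_z` can only be left through vertices common to these two
bags. -/
theorem IsTD.mem_Vset_of_adj (hT : IsTD G T) {z : ℕ} {a b : V} (ha : a ∈ T.Vset z)
    (hab : G.Adj a b) (h : a ∉ T.bag z ∨ z ≠ T.root ∧ a ∉ T.bag (T.parent z)) :
    b ∈ T.Vset z := by
  obtain ⟨y, hy, hay, hby⟩ := hT.edge a b hab
  by_cases hyz : T.InSubtree y z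
  · exact ⟨y, hyz, hby⟩
  · have := hT.crossing ha hy hyz hay
    rcases h with h | h
    · exact absurd this.2.1 h
    · exact absurd this.2.2 h.2

end RTD
namespace RTD

variable {V : Type*} {T T₁ : RTD V} {S : Set V} {G : SimpleGraph V}

/-! ### Traces -/

theorem trace_eq_iff {x z : ℕ} : T₁.trace S z = T.trace S x ↔
    T₁.Lset z ∩ S = T.Lset x ∩ S ∧ T₁.bag z ∩ S = T.bag x ∩ S ∧ T₁.Rset z ∩ S = T.Rset x ∩ S := by
  simp [trace, Prod.ext_iff]

theorem trace_eq_of_inter {x z : ℕ} (hV : T₁.Vset z ∩ S = T.Vset x ∩ S)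
    (hX : T₁.bag z ∩ S = T.bag x ∩ S) : T₁.trace S z = T.trace S x := by
  rw [Set.ext_iff] at hV hX
  rw [trace_eq_iff]
  refine ⟨?_, Set.ext hX, ?_⟩ <;> ext v <;> have h1 := hV v <;> have h2 := hX v <;>
    simp only [Lset, Rset, Set.mem_inter_iff, Set.mem_sdiff, Set.mem_compl_iff] at * <;> tauto

theorem Vset_inter_of_trace {x z : ℕ} (h : T₁.trace S z = T.trace S x) :
    T₁.Vset z ∩ S = T.Vset x ∩ S := by
  have h1 := Set.ext_iff.1 (trace_eq_iff.1 h).2.2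
  ext v
  have h2 := h1 v
  simp only [Rset, Set.mem_inter_iff, Set.mem_compl_iff] at *
  tauto

theorem bag_inter_of_trace {x z : ℕ} (h : T₁.trace S z = T.trace S x) :
    T₁.bag z ∩ S = T.bag x ∩ S := (trace_eq_iff.1 h).2.1

theorem mem_bag_of_trace {x z : ℕ} (h : T₁.trace S z = T.trace S x) {v : V} (hv : v ∈ S) :
    v ∈ T₁.bag z ↔ v ∈ T.bag x := by
  have := Set.ext_iff.1 (bag_inter_of_trace h) v
  simpa [hv] using this

theorem mem_Vset_of_trace {x z : ℕ} (h : T₁.trace S z = T.trace S x) {v : V} (hv : v ∈ S) :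
    v ∈ T₁.Vset z ↔ v ∈ T.Vset x := by
  have := Set.ext_iff.1 (Vset_inter_of_trace h) v
  simpa [hv] using this

theorem mem_sChildren (hT : T.IsRootedTree) {t c : ℕ} :
    c ∈ T.sChildren S t ↔ T.IsParent t c ∧ ∃ s ∈ S, s ∈ T.Vset c ∧ s ∉ T.bag t := by
  constructor
  · rintro ⟨h, s, hs, hs'⟩
    refine ⟨h, s, ?_, ?_, fun hst => hs' (Or.inr ⟨hst, ?_⟩)⟩
    · rcases hs with hs | hs <;> exact hs.2
    · rcases hs with hs | hs
      · exact hs.1.1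
      · exact bag_subset_Vset h.1 hs.1
    · rcases hs with hs | hs <;> exact hs.2
  · rintro ⟨h, s, hs, hsc, hst⟩
    refine ⟨h, s, ?_, ?_⟩
    · by_cases hsb : s ∈ T.bag c
      · exact Or.inr ⟨hsb, hs⟩
      · exact Or.inl ⟨⟨hsc, hsb⟩, hs⟩
    · rintro (h' | h')
      · exact h'.1 (Vset_mono (h.inSubtree hT) hsc)
      · exact hst h'.1

theorem mem_sChildren_of_trace (hT : T.IsRootedTree) {t c : ℕ} (h : T.IsParent t c)
    (ht : (T.Lset t ∩ S).Nonempty) (htr : T.trace S c = T.trace S t) : c ∈ T.sChildren S t := by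
  obtain ⟨s, hs⟩ := ht
  have h1 : s ∈ T.Lset c ∩ S := by rw [(trace_eq_iff.1 htr).1]; exact hs
  exact (mem_sChildren hT).2 ⟨h, s, hs.2, h1.1.1, hs.1.2⟩

theorem Lset_inter_nonempty_of_sChild (hT : T.IsRootedTree) {t c : ℕ}
    (h : c ∈ T.sChildren S t) : (T.Lset t ∩ S).Nonempty := by
  obtain ⟨h1, s, hs, hsc, hst⟩ := (mem_sChildren hT).1 h
  exact ⟨s, ⟨Vset_mono (h1.inSubtree hT) hsc, hst⟩, hs⟩

/-- A node with two `S`-children is an `S`-bottom node. -/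
theorem IsTD.isSBottom_of_two (hT : IsTD G T) {t c c' : ℕ} (h : c ∈ T.sChildren S t)
    (h' : c' ∈ T.sChildren S t) (hne : c ≠ c') : T.IsSBottom S t := by
  refine ⟨h.1.parent_mem hT.rooted, Lset_inter_nonempty_of_sChild hT.rooted h, fun d hd htr => ?_⟩
  -- A child `d` with the trace of `t` has all of `L_t ∩ S` strictly below it. The witness for any
  -- other `S`-child would then lie below two children of `t`, hence in the bag of `t`.
  have key : ∀ e ∈ T.sChildren S t, e = d := by
    intro e he
    by_contra hed
    obtain ⟨h1, s, hs, hse, hst⟩ := (mem_sChildren hT.rooted).1 he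
    have h2 : s ∈ T.Lset d ∩ S := by
      rw [(trace_eq_iff.1 htr).1]
      exact ⟨⟨Vset_mono (h1.inSubtree hT.rooted) hse, hst⟩, hs⟩
    exact hst (hT.mem_bag_of_children h1 hd hed hse h2.1.1)
  exact hne ((key c h).trans (key c' h').symm)

/-! ### Trees with the same `S`-structure -/

/-- `T₁` has the same `S`-structure as `T`: the node `x` of `T` corresponds to `ι x`, and the child of
`ι x` in the direction of an `S`-child `y` of `x` is `κ y`. -/
structure Skel (S : Set V) (T T₁ : RTD V) (ι κ : ℕ → ℕ) : Prop where
  mem : ∀ x ∈ T.nodes, ι x ∈ T₁.nodes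
  inj : Set.InjOn ι T.nodes
  root : ι T.root = T₁.root
  trace : ∀ x ∈ T.nodes, T₁.trace S (ι x) = T.trace S x
  child : ∀ x, ∀ y ∈ T.sChildren S x, T₁.IsParent (ι x) (κ y) ∧ T₁.trace S (κ y) = T.trace S y
  inj_child : Set.InjOn κ T.nodes
  -- Children of `ι x` outside the image of `κ` contribute no vertex of `S` beyond the bag, so they
  -- are not `S`-children.
  junk : ∀ x ∈ T.nodes, ∀ z, T₁.IsParent (ι x) z →
    (∃ y ∈ T.sChildren S x, z = κ y) ∨ T₁.Vset z ∩ S ⊆ T₁.bag (ι x)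
  -- Each of the last two alternatives prevents a node outside the image of `ι` from being an
  -- `S`-bottom node.
  other : ∀ z ∈ T₁.nodes, (∃ x ∈ T.nodes, z = ι x) ∨
    (∃ c, T₁.IsParent z c ∧ T₁.trace S c = T₁.trace S z) ∨ T₁.Lset z ∩ S = ∅

namespace Skel

variable {ι κ : ℕ → ℕ} (h : Skel S T T₁ ι κ) (hT : T.IsRootedTree) (hT₁ : T₁.IsRootedTree)
include h hT hT₁

theorem sChildren_eq {x : ℕ} (hx : x ∈ T.nodes) :
    T₁.sChildren S (ι x) = κ '' T.sChildren S x := by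
  ext z
  constructor
  · intro hz
    obtain ⟨h1, s, hs, hsz, hsx⟩ := (mem_sChildren hT₁).1 hz
    rcases h.junk x hx z h1 with ⟨y, hy, rfl⟩ | h2
    · exact ⟨y, hy, rfl⟩
    · exact absurd (h2 ⟨hsz, hs⟩) hsx
  · rintro ⟨y, hy, rfl⟩
    obtain ⟨h1, s, hs, hsy, hsx⟩ := (mem_sChildren hT).1 hy
    obtain ⟨h2, h3⟩ := h.child x y hy
    exact (mem_sChildren hT₁).2 ⟨h2, s, hs, (mem_Vset_of_trace h3 hs).2 hsy,
      fun h' => hsx ((mem_bag_of_trace (h.trace x hx) hs).1 h')⟩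

theorem isSBottom_image {x : ℕ} (hx : T.IsSBottom S x) : T₁.IsSBottom S (ι x) := by
  have htr := h.trace x hx.1
  have hL : (T₁.Lset (ι x) ∩ S).Nonempty := by rw [(trace_eq_iff.1 htr).1]; exact hx.2.1
  refine ⟨h.mem x hx.1, hL, fun c hc hct => ?_⟩
  have hcs := mem_sChildren_of_trace hT₁ hc hL hct
  rw [h.sChildren_eq hT hT₁ hx.1] at hcs
  obtain ⟨y, hy, rfl⟩ := hcs
  exact hx.2.2 y hy.1 ((h.child x y hy).2.symm.trans (hct.trans htr))

theorem exists_of_isSBottom {z : ℕ} (hz : T₁.IsSBottom S z) : ∃ x, T.IsSBottom S x ∧ z = ι x := by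
  rcases h.other z hz.1 with ⟨x, hx, rfl⟩ | ⟨c, hc, hct⟩ | hL
  · have htr := h.trace x hx
    have hL : (T.Lset x ∩ S).Nonempty := by rw [← (trace_eq_iff.1 htr).1]; exact hz.2.1
    refine ⟨x, ⟨hx, hL, fun c hc hct => ?_⟩, rfl⟩
    have hcs := mem_sChildren_of_trace hT hc hL hct
    obtain ⟨h1, h2⟩ := h.child x c hcs
    exact hz.2.2 _ h1 (h2.trans (hct.trans htr.symm))
  · exact absurd hct (hz.2.2 c hc)
  · exact absurd hz.2.1 (by rw [hL]; exact Set.not_nonempty_empty)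

theorem root_not_isSBottom (hr : ¬ T.IsSBottom S T.root) : ¬ T₁.IsSBottom S T₁.root := by
  intro hb
  obtain ⟨x, hx, hxr⟩ := h.exists_of_isSBottom hT hT₁ hb
  rw [← h.root] at hxr
  exact hr (h.inj hT.1 hx.1 hxr ▸ hx)

theorem admitsIntroduce {x : ℕ} (hx : x ∈ T.nodes) {v : V} (hv : T.AdmitsIntroduce S x v) :
    T₁.AdmitsIntroduce S (ι x) v := by
  obtain ⟨y, hy, hvS, hvy, hxy⟩ := hv
  have hyx : y ∈ T.sChildren S x := hy ▸ rfl
  have h2 := (h.child x y hyx).2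
  refine ⟨κ y, by rw [h.sChildren_eq hT hT₁ hx, hy, Set.image_singleton], hvS,
    fun h' => hvy ((mem_bag_of_trace h2 hvS).1 h'), ?_⟩
  rw [bag_inter_of_trace (h.trace x hx), bag_inter_of_trace h2, hxy]

theorem admitsForget {x : ℕ} (hx : x ∈ T.nodes) {v : V} (hv : T.AdmitsForget S x v) :
    T₁.AdmitsForget S (ι x) v := by
  obtain ⟨y, hy, hvS, hvy, hxy⟩ := hv
  have hyx : y ∈ T.sChildren S x := hy ▸ rfl
  have h2 := (h.child x y hyx).2
  refine ⟨κ y, by rw [h.sChildren_eq hT hT₁ hx, hy, Set.image_singleton], hvS,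
    (mem_bag_of_trace h2 hvS).2 hvy, ?_⟩
  rw [bag_inter_of_trace (h.trace x hx), bag_inter_of_trace h2, hxy]

theorem admitsJoin {x : ℕ} (hx : x ∈ T.nodes) (hv : T.AdmitsJoin S x) :
    T₁.AdmitsJoin S (ι x) := by
  obtain ⟨y, y', hne, hy, hxy⟩ := hv
  have hyx : y ∈ T.sChildren S x := hy ▸ Or.inl rfl
  have hyx' : y' ∈ T.sChildren S x := hy ▸ Or.inr rfl
  refine ⟨κ y, κ y', fun h' => hne (h.inj_child hyx.1.1 hyx'.1.1 h'),
    by rw [h.sChildren_eq hT hT₁ hx, hy, Set.image_pair], ?_⟩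
  rwa [bag_inter_of_trace (h.trace x hx), bag_inter_of_trace (h.child x y hyx).2,
    bag_inter_of_trace (h.child x y' hyx').2]

theorem ncard_sChildren {x : ℕ} (hx : x ∈ T.nodes) :
    (T₁.sChildren S (ι x)).ncard = (T.sChildren S x).ncard := by
  rw [h.sChildren_eq hT hT₁ hx]
  exact Set.InjOn.ncard_image (h.inj_child.mono fun y hy => hy.1.1)

theorem directPred_iff (τ σ : Set V × Set V × Set V) :
    T₁.DirectPred S τ σ ↔ T.DirectPred S τ σ := by
  constructor
  · rintro ⟨z, hz, rfl, c, hc, rfl⟩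
    obtain ⟨x, hx, rfl⟩ := h.exists_of_isSBottom hT hT₁ hz
    rw [h.sChildren_eq hT hT₁ hx.1] at hc
    obtain ⟨y, hy, rfl⟩ := hc
    exact ⟨x, hx, (h.trace x hx.1).symm, y, hy, (h.child x y hy).2.symm⟩
  · rintro ⟨x, hx, rfl, y, hy, rfl⟩
    refine ⟨ι x, h.isSBottom_image hT hT₁ hx, h.trace x hx.1, κ y, ?_, (h.child x y hy).2⟩
    rw [h.sChildren_eq hT hT₁ hx.1]
    exact ⟨y, hy, rfl⟩

end Skel

/-! ### Components -/

theorem IsComponent.subset {W C : Set V} (h : IsComponent G W C) : C ⊆ W := by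
  obtain ⟨c, rfl⟩ := h
  rintro _ ⟨x, -, rfl⟩
  exact x.2

theorem IsComponent.mem_of_adj {W C : Set V} (h : IsComponent G W C) {a b : V} (ha : a ∈ C)
    (hb : b ∈ W) (hab : G.Adj a b) : b ∈ C := by
  obtain ⟨c, rfl⟩ := h
  obtain ⟨x, hx, rfl⟩ := ha
  refine ⟨⟨b, hb⟩, ?_, rfl⟩
  rw [SimpleGraph.ConnectedComponent.mem_supp_iff] at hx ⊢
  rw [← hx]
  exact SimpleGraph.ConnectedComponent.sound (SimpleGraph.Adj.reachable
    (show G.Adj b x from hab.symm))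

theorem IsComponent.subset_of_closed {W C B : Set V} (h : IsComponent G W C) {a : V}
    (ha : a ∈ C) (haB : a ∈ B) (hB : ∀ x ∈ B, x ∈ C → ∀ y ∈ C, G.Adj x y → y ∈ B) : C ⊆ B := by
  intro b hb
  have hC := h
  obtain ⟨c, rfl⟩ := h
  obtain ⟨x, hx, rfl⟩ := ha
  obtain ⟨y, hy, rfl⟩ := hb
  rw [SimpleGraph.ConnectedComponent.mem_supp_iff] at hx hy
  have hr := (SimpleGraph.reachable_iff_reflTransGen _ _).1
    (SimpleGraph.ConnectedComponent.exact (hx.trans hy.symm))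
  have : ∀ z : W, Relation.ReflTransGen (G.induce W).Adj x z →
      (z : V) ∈ B ∧ (z : V) ∈ Subtype.val '' c.supp := by
    intro z hz
    induction hz with
    | refl => exact ⟨haB, x, hx, rfl⟩
    | tail _ hab ih =>
      have h2 := hC.mem_of_adj ih.2 (Subtype.prop _) hab
      exact ⟨hB _ ih.1 ih.2 _ h2 hab, h2⟩
  exact (this y hr).1

theorem exists_isComponent {W : Set V} {a : V} (ha : a ∈ W) : ∃ C, IsComponent G W C ∧ a ∈ C :=
  ⟨_, ⟨(G.induce W).connectedComponentMk ⟨a, ha⟩, rfl⟩, ⟨a, ha⟩, rfl, rfl⟩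

/-- A vertex connected to `S` in `G[W]` reaches `S` inside every set closed in `G[W]`. -/
theorem ConnectedTo.exists_mem {W B : Set V} {a : V} (h : ConnectedTo G S W a) (haB : a ∈ B)
    (hB : ∀ x ∈ B, x ∈ W → ∀ y ∈ W, G.Adj x y → y ∈ B) : ∃ s ∈ S, s ∈ W ∧ s ∈ B := by
  obtain ⟨C, hC, haC, s, hsC, hsS⟩ := h
  exact ⟨s, hsS, hC.subset hsC, hC.subset_of_closed haC haB
    (fun x hx hxC y hy => hB x hx (hC.subset hxC) y (hC.subset hy)) hsC⟩

theorem nbhd_subset_of_isComponent {X C : Set V} (h : IsComponent G Xᶜ C) : nbhd G C ⊆ X := by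
  rintro u ⟨hu, v, hv, hvu⟩
  by_contra huX
  exact hu (h.mem_of_adj hv huX hvu)

/-! ### Separation by a bag -/

/-- `a` and `b` lie in different directions of the nodes with bag `X`. -/
def Sep (T : RTD V) (X : Set V) (a b : V) : Prop :=
  ∃ z ∈ T.nodes, (T.bag z = X ∨ z ≠ T.root ∧ T.bag (T.parent z) = X) ∧
    ¬ (a ∈ T.Vset z ↔ b ∈ T.Vset z)

theorem Sep.symm {X : Set V} {a b : V} (h : T.Sep X a b) : T.Sep X b a := by
  obtain ⟨z, hz, h1, h2⟩ := h
  exact ⟨z, hz, h1, fun h => h2 h.symm⟩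

theorem IsTD.mem_Vset_of_adj_of_sep (hT : IsTD G T) {X : Set V} {z : ℕ}
    (hz : T.bag z = X ∨ z ≠ T.root ∧ T.bag (T.parent z) = X) {a b : V} (ha : a ∈ T.Vset z)
    (haX : a ∉ X) (hab : G.Adj a b) : b ∈ T.Vset z := by
  refine hT.mem_Vset_of_adj ha hab ?_
  rcases hz with rfl | ⟨h, rfl⟩
  · exact Or.inl haX
  · exact Or.inr ⟨h, haX⟩

/-! ### Weakly slim tree decompositions -/

/-- The `S`-bottom node `t` admits one of the three operations. -/
def NiceAt (S : Set V) (T : RTD V) (t : ℕ) : Prop :=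
  (∃ v, T.AdmitsIntroduce S t v) ∨ (∃ v, T.AdmitsForget S t v) ∨ T.AdmitsJoin S t

/-- The part of being slim and `S`-nice that is not restored by subdividing edges. -/
structure WeaklySlim (G : SimpleGraph V) (S : Set V) (k : ℕ) (T : RTD V) : Prop extends
    IsTD G T where
  card_le : ∀ t ∈ T.nodes, (T.bag t).ncard ≤ k + 1
  nested : ∀ p t, T.IsParent p t → T.bag t ⊆ T.bag p ∨ T.bag p ⊆ T.bag t
  -- The second alternative admits the node created by attaching an `F`-component: its bag may miss
  -- many vertices of `S` from the bag of its parent, but no vertex of `S` lies strictly below it.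
  step : ∀ p t, T.IsParent p t →
    (((T.bag t \ T.bag p) ∩ S).Subsingleton ∧ ((T.bag p \ T.bag t) ∩ S).Subsingleton) ∨
    (T.Lset t ∩ S = ∅ ∧ T.bag t ⊆ T.bag p)
  nice : ∀ t, T.IsSBottom S t → NiceAt S T t
  root_not_bottom : ¬ T.IsSBottom S T.root
  full_two : ∀ p t, T.IsParent p t → T.bag t = T.bag p → T.IsFull k t →
    (T.sChildren S t).ncard = 2 ∧ (T.sChildren S p).ncard = 2
  -- Pairwise separation by sets `V_z` replaces the three different directions. It mentions neither
  -- the whole join tree nor its root, so it survives a modification as soon as membership of the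
  -- three neighbors in the relevant `V_z` does.
  full_sep : ∀ p t, T.IsParent p t → T.bag t = T.bag p → T.IsFull k t → ∀ v ∈ T.bag t \ S,
    ∃ u : Fin 3 → V, (∀ i, G.Adj v (u i) ∧ u i ∉ T.bag t ∧ ConnectedTo G S (T.bag t)ᶜ (u i)) ∧
      ∀ i j, i ≠ j → T.Sep (T.bag t) (u i) (u j)

theorem Skel.niceAt {ι κ : ℕ → ℕ} (h : Skel S T T₁ ι κ) (hT : T.IsRootedTree)
    (hT₁ : T₁.IsRootedTree) (hn : ∀ t, T.IsSBottom S t → NiceAt S T t) {z : ℕ}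
    (hz : T₁.IsSBottom S z) : NiceAt S T₁ z := by
  obtain ⟨x, hx, rfl⟩ := h.exists_of_isSBottom hT hT₁ hz
  rcases hn x hx with ⟨v, hv⟩ | ⟨v, hv⟩ | hv
  · exact Or.inl ⟨v, h.admitsIntroduce hT hT₁ hx.1 hv⟩
  · exact Or.inr (Or.inl ⟨v, h.admitsForget hT hT₁ hx.1 hv⟩)
  · exact Or.inr (Or.inr (h.admitsJoin hT hT₁ hx.1 hv))

/-- Vertices outside the bag of `b` below an `S`-child of `b`. -/
def Wset (T : RTD V) (S : Set V) (b : ℕ) : Set V :=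
  {v | v ∉ T.bag b ∧ ∃ c ∈ T.sChildren S b, v ∈ T.Vset c}

open Classical in
/-- The quantity that is minimized. -/
noncomputable def weight (S : Set V) (T : RTD V) : ℕ :=
  ∑ b ∈ T.nodes.filter (T.IsSBottom S), ((T.Vset b).ncard + (T.Wset S b).ncard)

-- The `S`-bottom nodes of `T₁` are exactly the images under `ι` of those of `T`, so the two sums
-- can be compared term by term.
open Classical in
theorem Skel.weight_le {ι κ : ℕ → ℕ} (h : Skel S T T₁ ι κ) (hT : T.IsRootedTree)
    (hT₁ : T₁.IsRootedTree)
    (hV : ∀ x, T.IsSBottom S x → (T₁.Vset (ι x)).ncard ≤ (T.Vset x).ncard)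
    (hW : ∀ x, T.IsSBottom S x → (T₁.Wset S (ι x)).ncard ≤ (T.Wset S x).ncard) :
    weight S T₁ ≤ weight S T ∧
    ((∃ x, T.IsSBottom S x ∧ ((T₁.Vset (ι x)).ncard < (T.Vset x).ncard ∨
      (T₁.Wset S (ι x)).ncard < (T.Wset S x).ncard)) → weight S T₁ < weight S T) := by
  have himg : T₁.nodes.filter (T₁.IsSBottom S) =
      (T.nodes.filter (T.IsSBottom S)).image ι := by
    ext z
    simp only [Finset.mem_filter, Finset.mem_image]
    constructor
    · rintro ⟨-, hz⟩
      obtain ⟨x, hx, rfl⟩ := h.exists_of_isSBottom hT hT₁ hz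
      exact ⟨x, ⟨hx.1, hx⟩, rfl⟩
    · rintro ⟨x, ⟨hx, hxb⟩, rfl⟩
      exact ⟨h.mem x hx, h.isSBottom_image hT hT₁ hxb⟩
  have hsum : weight S T₁ = ∑ b ∈ T.nodes.filter (T.IsSBottom S),
      ((T₁.Vset (ι b)).ncard + (T₁.Wset S (ι b)).ncard) := by
    rw [weight, himg, Finset.sum_image]
    intro x hx y hy hxy
    simp only [Finset.coe_filter, Set.mem_ofPred_eq] at hx hy
    exact h.inj hx.1 hy.1 hxy
  have hle : ∀ b ∈ T.nodes.filter (T.IsSBottom S),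
      (T₁.Vset (ι b)).ncard + (T₁.Wset S (ι b)).ncard ≤
        (T.Vset b).ncard + (T.Wset S b).ncard := fun b hb =>
    Nat.add_le_add (hV b (Finset.mem_filter.1 hb).2) (hW b (Finset.mem_filter.1 hb).2)
  rw [hsum]
  refine ⟨Finset.sum_le_sum hle, fun ⟨x, hx, hlt⟩ => Finset.sum_lt_sum hle ⟨x, ?_, ?_⟩⟩
  · exact Finset.mem_filter.2 ⟨hx.1, hx⟩
  · have h1 := hV x hx
    have h2 := hW x hx
    omega

/-- Weakly slim tree decompositions with the `S`-structure of `T₀` in which the bag of the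
`S`-bottom node with trace `σ`, or the bag of its parent, is not full. -/
structure Admissible (G : SimpleGraph V) (S : Set V) (k : ℕ) (T₀ : RTD V)
    (σ : Set V × Set V × Set V) (T : RTD V) : Prop extends WeaklySlim G S k T where
  pred : ∀ τ τ', T.DirectPred S τ τ' ↔ T₀.DirectPred S τ τ'
  -- Node names are not preserved, so the given bottom node is followed by its trace. The last
  -- clause is what later provides it with a non-full parent.
  mark : ∃ p s, T.IsParent p s ∧ T.IsSBottom S s ∧ T.trace S s = σ ∧
    ¬ (T.bag s = T.bag p ∧ T.IsFull k s)

/-- `T` has minimum weight among the admissible tree decompositions. -/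
def IsMinimal (G : SimpleGraph V) (S : Set V) (k : ℕ) (T₀ : RTD V)
    (σ : Set V × Set V × Set V) (T : RTD V) : Prop :=
  Admissible G S k T₀ σ T ∧ ∀ T', Admissible G S k T₀ σ T' → weight S T ≤ weight S T'

end RTD
namespace RTD

variable {V : Type*} {T : RTD V} {S : Set V} {G : SimpleGraph V} {k : ℕ}

/-! ### Nodes with a given full bag -/

/-- The nodes with bag `X`. -/
def level (T : RTD V) (X : Set V) : Set ℕ := {x | x ∈ T.nodes ∧ T.bag x = X}

theorem eq_of_full_subset [Finite V] (hc : ∀ t ∈ T.nodes, (T.bag t).ncard ≤ k + 1) {X : Set V}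
    (hX : X.ncard = k + 1) {x : ℕ} (hx : x ∈ T.nodes) (h : X ⊆ T.bag x) : T.bag x = X :=
  (Set.eq_of_subset_of_ncard_le h (by rw [hX]; exact hc x hx) (Set.toFinite _)).symm

/-- By `crossing`, all of `X` lies in the bags of `c` and of its parent, and these bags have no room
for further vertices. Consequently the nodes with a given full bag are connected, and full join
trees are precisely the levels with at least two nodes. -/
theorem IsTD.mem_level_of_between [Finite V] (hT : IsTD G T)
    (hc : ∀ t ∈ T.nodes, (T.bag t).ncard ≤ k + 1) {X : Set V} (hX : X.ncard = k + 1) {x y c : ℕ}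
    (hx : x ∈ T.level X) (hy : y ∈ T.level X) (hxc : T.InSubtree x c) (hyc : ¬ T.InSubtree y c) :
    c ≠ T.root ∧ c ∈ T.level X ∧ T.parent c ∈ T.level X := by
  have key : ∀ v ∈ X, c ≠ T.root ∧ v ∈ T.bag c ∧ v ∈ T.bag (T.parent c) := fun v hv =>
    hT.crossing ⟨x, hxc, hx.2.symm ▸ hv⟩ hy.1 hyc (hy.2.symm ▸ hv)
  have hne : X.Nonempty := by
    rw [← Set.ncard_pos (Set.toFinite _), hX]; omega
  obtain ⟨v, hv⟩ := hne
  have hcn := hxc.mem_right hT.rooted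
  have hpn := hT.rooted.2.2.1 c hcn
  exact ⟨(key v hv).1, ⟨hcn, eq_of_full_subset hc hX hcn fun w hw => (key w hw).2.1⟩,
    hpn, eq_of_full_subset hc hX hpn fun w hw => (key w hw).2.2⟩

theorem IsTD.exists_top_level [Finite V] (hT : IsTD G T)
    (hc : ∀ t ∈ T.nodes, (T.bag t).ncard ≤ k + 1) {X : Set V} (hX : X.ncard = k + 1)
    (hne : (T.level X).Nonempty) :
    ∃ r ∈ T.level X, ∀ x ∈ T.level X, x ≠ r → x ≠ T.root ∧ T.parent x ∈ T.level X := by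
  obtain ⟨d, hd⟩ := hT.rooted.exists_depth
  obtain ⟨r, hr, hrd⟩ := Nat.sInf_mem (hne.image d)
  refine ⟨r, hr, fun x hx hxr => ?_⟩
  have hrx : ¬ T.InSubtree r x := fun h => by
    have h1 := h.depth_lt hT.rooted hd (Ne.symm hxr)
    have h2 : sInf (d '' T.level X) ≤ d x := Nat.sInf_le ⟨x, hx, rfl⟩
    omega
  have := hT.mem_level_of_between hc hX hx hr (InSubtree.refl hx.1) hrx
  exact ⟨this.1, this.2.2⟩

theorem IsTD.isFullJoinTree_level [Finite V] (hT : IsTD G T)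
    (hc : ∀ t ∈ T.nodes, (T.bag t).ncard ≤ k + 1) {X : Set V} (hX : X.ncard = k + 1)
    (hn : (T.level X).Nontrivial) : T.IsFullJoinTree k (T.level X) := by
  obtain ⟨r, hr, hr'⟩ := hT.exists_top_level hc hX hn.nonempty
  refine ⟨⟨fun x hx => hx.1, hn, connected_of_top hT.rooted (fun x hx => hx.1) hr hr',
    X, hX, fun t ht => ht.2⟩, ?_⟩
  rintro J ⟨h1, -, -, Y, -, h4⟩ hle x hx
  obtain ⟨a, ha⟩ := hn.nonempty
  have : Y = X := (h4 a (hle ha)).symm.trans ha.2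
  exact ⟨h1 hx, this ▸ h4 x hx⟩

theorem IsTD.eq_level_of_isFullJoinTree [Finite V] (hT : IsTD G T)
    (hc : ∀ t ∈ T.nodes, (T.bag t).ncard ≤ k + 1) {J : Set ℕ} (hJ : T.IsFullJoinTree k J) :
    ∃ X : Set V, X.ncard = k + 1 ∧ J = T.level X ∧ (T.level X).Nontrivial := by
  obtain ⟨⟨h1, h2, -, X, hX, h4⟩, hmax⟩ := hJ
  have hJX : J ⊆ T.level X := fun x hx => ⟨h1 hx, h4 x hx⟩
  have hn := h2.mono hJX
  exact ⟨X, hX, hJX.antisymm (hmax (hT.isFullJoinTree_level hc hX hn).prop hJX), hn⟩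

/-- Two directions sharing a vertex outside `X` would be nested subtrees. The upper one would then
separate two nodes of the level and so belong to the level itself. -/
theorem IsTD.not_mem_Vset_of_directions [Finite V] (hT : IsTD G T)
    (hc : ∀ t ∈ T.nodes, (T.bag t).ncard ≤ k + 1) {X : Set V} (hX : X.ncard = k + 1)
    {t t' c c' : ℕ} {b : V} (ht : t ∈ T.level X) (ht' : t' ∈ T.level X) (hcp : T.IsParent t c)
    (hcp' : T.IsParent t' c') (hcX : c ∉ T.level X) (hcX' : c' ∉ T.level X) (hne : c' ≠ c)
    (hb : b ∉ X) (hbc : b ∈ T.Vset c') : b ∉ T.Vset c := by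
  intro hbc'
  obtain ⟨y, hy, hby⟩ := hbc
  have hyc : T.InSubtree y c := by
    by_contra hyc
    have := (hT.crossing hbc' hy.1 hyc hby).2.2
    rw [hcp.2.2, ht.2] at this
    exact hb this
  rcases hy.total hT.rooted hyc with h | h
  · have h' := (h.parent_of_ne hT.rooted hne).2
    rw [hcp'.2.2] at h'
    exact hcX (hT.mem_level_of_between hc hX ht' ht h' (hcp.not_inSubtree hT.rooted)).2.1
  · have h' := (h.parent_of_ne hT.rooted (Ne.symm hne)).2
    rw [hcp.2.2] at h'
    exact hcX' (hT.mem_level_of_between hc hX ht ht' h' (hcp'.not_inSubtree hT.rooted)).2.1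

theorem inter_subsingleton_of_nested [Finite V] {A B : Set V} (h : A ⊆ B ∨ B ⊆ A)
    (h1 : A.ncard ≤ B.ncard + 1) : ((A \ B) ∩ S).Subsingleton := by
  have : (A \ B).ncard ≤ 1 := by
    rcases h with h | h
    · rw [Set.sdiff_eq_empty.2 h]; simp
    · rw [Set.ncard_sdiff h (Set.toFinite _)]; omega
  exact ((Set.ncard_le_one_iff_subsingleton).1 this).anti Set.inter_subset_left

/-- Slim `S`-nice tree decompositions of width at most `k` are weakly slim. -/
theorem IsSNice.weaklySlim [Finite V] (hN : IsSNice G S T) (hw : T.width ≤ k)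
    (hs : IsSlim G S k T) : WeaklySlim G S k T := by
  have hT := isTreeDecomposition_iff.1 hN.1
  have hc : ∀ t ∈ T.nodes, (T.bag t).ncard ≤ k + 1 := by
    intro t ht
    have h1 := Finset.le_sup (f := fun t => (T.bag t).ncard) ht
    simp only [width] at hw
    have h2 : (T.nodes.sup fun t => (T.bag t).ncard) ≤ k + 1 := by omega
    exact h1.trans h2
  have hJ : ∀ p t, T.IsParent p t → T.bag t = T.bag p → T.IsFull k t →
      T.IsFullJoinTree k (T.level (T.bag t)) := fun p t hpt heq hf =>
    hT.isFullJoinTree_level hc hf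
      ⟨t, ⟨hpt.1, rfl⟩, p, ⟨hpt.parent_mem hT.rooted, heq.symm⟩, hpt.ne hT.rooted⟩
  refine { hT with
    card_le := hc, nested := fun p t h => (hN.2.1 p t h).1, step := fun p t h => ?_, nice := hN.2.2,
    root_not_bottom := hs.root_not_bottom, full_two := fun p t hpt heq hf => ?_,
    full_sep := fun p t hpt heq hf v hv => ?_ }
  · obtain ⟨h1, h2, h3⟩ := hN.2.1 p t h
    exact Or.inl ⟨inter_subsingleton_of_nested h1 h2, inter_subsingleton_of_nested h1.symm h3⟩
  · have := hs.full_bottom _ (hJ p t hpt heq hf)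
    exact ⟨(this t ⟨hpt.1, rfl⟩).2, (this p ⟨hpt.parent_mem hT.rooted, heq.symm⟩).2⟩
  · obtain ⟨r, hr, hr'⟩ := hT.exists_top_level hc hf ⟨t, hpt.1, rfl⟩
    have hsub : ∀ x ∈ T.level (T.bag t), T.InSubtree x r := fun x hx =>
      inSubtree_of_top hT.rooted (fun x hx => hx.1) hr' hx
    obtain ⟨u, c, -, hcinj, h⟩ := hs.full_nbrs _ (hJ p t hpt heq hf) r hr hsub v
      (by rw [hr.2]; exact hv)
    rw [hr.2] at h
    refine ⟨u, fun i => ⟨(h i).1, (h i).2.1, (h i).2.2.1⟩, fun i j hij => ?_⟩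
    have key : ∀ i j, i ≠ j → (c i ∉ T.level (T.bag t) ∧
        (∃ x ∈ T.level (T.bag t), c i ∈ T.sChildren S x) ∧ u i ∈ T.Vset (c i)) →
        T.Sep (T.bag t) (u i) (u j) := by
      rintro i j hij ⟨h1, ⟨x, hx, hxc⟩, h3⟩
      -- A direction that is an `S`-child serves as the separating node. Of two different directions
      -- at least one is of this kind, since `r` has only one parent.
      refine ⟨c i, hxc.1.1, Or.inr ⟨hxc.1.2.1, by rw [hxc.1.2.2, hx.2]⟩, fun hiff => ?_⟩
      have h4 := hiff.1 h3
      rcases (h j).2.2.2 with ⟨h5, ⟨y, hy, hyc⟩, h6⟩ | ⟨-, h6⟩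
      · exact hT.not_mem_Vset_of_directions hc hf hx hy hxc.1 hyc.1 h1 h5
          (fun h => hij (hcinj h.symm)) (h j).2.1 h6 h4
      · exact h6 (Vset_mono ((hxc.1.inSubtree hT.rooted).trans (hsub x hx)) h4)
    rcases (h i).2.2.2 with hi | hi
    · exact key i j hij hi
    · rcases (h j).2.2.2 with hj | hj
      · exact (key j i (Ne.symm hij) hj).symm
      · exact absurd (hcinj (hi.1.unique hj.1)) hij

/-! ### Recovering the conditions on full join trees from those on edges -/

namespace WeaklySlim

variable [Finite V] (hT : WeaklySlim G S k T)
include hT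

theorem exists_edge_of_level {X : Set V} (hX : X.ncard = k + 1) (hn : (T.level X).Nontrivial)
    {t : ℕ} (ht : t ∈ T.level X) : ∃ y ∈ T.level X, T.IsParent y t ∨ T.IsParent t y := by
  obtain ⟨r, hr, hr'⟩ := hT.exists_top_level hT.card_le hX hn.nonempty
  by_cases htr : t = r
  · subst htr
    obtain ⟨t', ht', hne⟩ := hn.exists_ne t
    have hsub : T.InSubtree t' t := inSubtree_of_top hT.rooted (fun x hx => hx.1) hr' ht'
    obtain ⟨c, hc, htc⟩ := hsub.exists_child hT.rooted hne
    exact ⟨c, (hT.mem_level_of_between hT.card_le hX ht' ht htc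
      (hc.not_inSubtree hT.rooted)).2.1, Or.inr hc⟩
  · obtain ⟨h1, h2⟩ := hr' t ht htr
    exact ⟨_, h2, Or.inl ⟨ht.1, h1, rfl⟩⟩

theorem full_bottom {J : Set ℕ} (hJ : T.IsFullJoinTree k J) {t : ℕ} (ht : t ∈ J) :
    T.IsSBottom S t ∧ (T.sChildren S t).ncard = 2 := by
  obtain ⟨X, hX, rfl, hn⟩ := hT.eq_level_of_isFullJoinTree hT.card_le hJ
  have h2 : (T.sChildren S t).ncard = 2 := by
    obtain ⟨y, hy, h | h⟩ := hT.exists_edge_of_level hX hn ht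
    · exact (hT.full_two y t h (ht.2.trans hy.2.symm) (by rw [IsFull, ht.2, hX])).1
    · exact (hT.full_two t y h (hy.2.trans ht.2.symm) (by rw [IsFull, hy.2, hX])).2
  obtain ⟨c, c', hne, hcc⟩ := Set.ncard_eq_two.1 h2
  exact ⟨hT.isSBottom_of_two (hcc ▸ Or.inl rfl) (hcc ▸ Or.inr rfl) hne, h2⟩

/-- Climb from a bag containing `a` towards `r`; the last node before the level is entered is the
direction. Outside `X` one cannot leave the subtree of this node, so the vertex of `S` reached from
`a` lies below it and makes it an `S`-child. -/
theorem exists_direction {X : Set V} {r : ℕ}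
    (hr : r ∈ T.level X) {a : V} (ha : a ∉ X) (hS : ConnectedTo G S Xᶜ a) :
    ∃ c, (c ∉ T.level X ∧ (∃ t ∈ T.level X, c ∈ T.sChildren S t) ∧ a ∈ T.Vset c) ∨
      (T.IsParent c r ∧ a ∉ T.Vset r) := by
  by_cases har : a ∈ T.Vset r
  · obtain ⟨y, hy, hay⟩ := har
    have hyX : y ∉ T.level X := fun h => ha (h.2 ▸ hay)
    have := hy.climb hT.rooted (P := fun z => z ∉ T.level X ∨
      ∃ c, c ∉ T.level X ∧ (∃ t ∈ T.level X, T.IsParent t c) ∧ a ∈ T.Vset c) (Or.inl hyX)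
      (fun z hyz hzr hne h => by
        rcases h with h | h
        · by_cases hp : T.parent z ∈ T.level X
          · exact Or.inr ⟨z, h, ⟨_, hp, hzr.1, (hzr.parent_of_ne hT.rooted hne).1, rfl⟩,
              y, hyz, hay⟩
          · exact Or.inl hp
        · exact Or.inr h)
    rcases this with h | ⟨c, hc, ⟨t, ht, htc⟩, hac⟩
    · exact absurd hr h
    · refine ⟨c, Or.inl ⟨hc, ⟨t, ht, (mem_sChildren hT.rooted).2 ⟨htc, ?_⟩⟩, hac⟩⟩
      have hpar : T.bag (T.parent c) = X := htc.2.2 ▸ ht.2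
      obtain ⟨s, hs, hsX, hsc⟩ := hS.exists_mem hac fun x hx hxX y _ hxy =>
        hT.mem_Vset_of_adj_of_sep (Or.inr ⟨htc.2.1, hpar⟩) hx hxX hxy
      exact ⟨s, hs, hsc, ht.2.symm ▸ hsX⟩
  · refine ⟨T.parent r, Or.inr ⟨⟨hr.1, ?_, rfl⟩, har⟩⟩
    rintro rfl
    obtain ⟨x, hx, hax⟩ := hT.exists_mem_bag a
    exact har ⟨x, inSubtree_root hT.rooted hx, hax⟩

theorem full_nbrs {J : Set ℕ} (hJ : T.IsFullJoinTree k J) {r : ℕ} (hr : r ∈ J)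
    (hsub : ∀ t ∈ J, T.InSubtree t r) {v : V} (hv : v ∈ T.bag r \ S) :
    ∃ (u : Fin 3 → V) (c : Fin 3 → ℕ),
      Function.Injective u ∧ Function.Injective c ∧
      ∀ i, G.Adj v (u i) ∧ u i ∉ T.bag r ∧ ConnectedTo G S (T.bag r)ᶜ (u i) ∧
        ((c i ∉ J ∧ (∃ t ∈ J, c i ∈ T.sChildren S t) ∧ u i ∈ T.Vset (c i)) ∨
         (T.IsParent (c i) r ∧ u i ∉ T.Vset r)) := by
  obtain ⟨X, hX, rfl, hn⟩ := hT.eq_level_of_isFullJoinTree hT.card_le hJ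
  have hu : ∃ u : Fin 3 → V, (∀ i, G.Adj v (u i) ∧ u i ∉ X ∧ ConnectedTo G S Xᶜ (u i)) ∧
      ∀ i j, i ≠ j → T.Sep X (u i) (u j) := by
    have hvX : v ∈ X \ S := hr.2 ▸ hv
    obtain ⟨y, hy, h | h⟩ := hT.exists_edge_of_level hX hn hr
    · have := hT.full_sep y r h (hr.2.trans hy.2.symm) (by rw [IsFull, hr.2, hX])
      rw [hr.2] at this
      exact this v hvX
    · have := hT.full_sep r y h (hy.2.trans hr.2.symm) (by rw [IsFull, hy.2, hX])
      rw [hy.2] at this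
      exact this v hvX
  obtain ⟨u, hu, hsep⟩ := hu
  choose c hc using fun i => hT.exists_direction hr (hu i).2.1 (hu i).2.2
  refine ⟨u, c, fun i j hij => ?_, fun i j hij => ?_, fun i => ?_⟩
  · by_contra hne
    obtain ⟨z, -, -, h⟩ := hsep i j hne
    exact h (by rw [hij])
  · by_contra hne
    -- The separating node `z` is in the level or directly below it. It cannot split a single
    -- direction: it would contain all of it, or put a node of the level inside it; and if the
    -- direction leads upwards, `z` lies below `r` anyway.
    have key : ∀ i j, i ≠ j → c i = c j → ∀ z ∈ T.nodes,
        (T.bag z = X ∨ z ≠ T.root ∧ T.bag (T.parent z) = X) → u i ∈ T.Vset z →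
        u j ∉ T.Vset z → False := by
      intro i j hne hij z hz hzX hiz hjz
      have hzr : T.InSubtree z r := by
        rcases hzX with h | h
        · exact hsub z ⟨hz, h⟩
        · exact InSubtree.of_parent hz (hsub _ ⟨hT.rooted.2.2.1 z hz, h.2⟩)
      rcases hc i with ⟨h1, ⟨t, ht, htc⟩, h3⟩ | ⟨h1, h2⟩
      · rcases hc j with ⟨h4, -, h5⟩ | ⟨h4, h5⟩
        · rw [hij] at h1 htc h3
          by_cases hcz : T.InSubtree (c j) z
          · exact hjz (Vset_mono hcz h5)
          · have hzc : T.InSubtree z (c j) := by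
              obtain ⟨y, hy, hiy⟩ := h3
              by_cases hyz : T.InSubtree y z
              · exact (hyz.total hT.rooted hy).resolve_right hcz
              · have := hT.crossing hiz hy.1 hyz hiy
                rcases hzX with h | h
                · exact absurd (h ▸ this.2.1) (hu i).2.1
                · exact absurd (h.2 ▸ this.2.2) (hu i).2.1
            have hne' : z ≠ c j := by rintro rfl; exact hcz (InSubtree.refl hz)
            have hmem : ∃ y ∈ T.level X, T.InSubtree y (c j) := by
              rcases hzX with h | h
              · exact ⟨z, ⟨hz, h⟩, hzc⟩
              · exact ⟨_, ⟨hT.rooted.2.2.1 z hz, h.2⟩, (hzc.parent_of_ne hT.rooted hne').2⟩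
            obtain ⟨y, hy, hyc⟩ := hmem
            exact h4 (hT.mem_level_of_between hT.card_le hX hy ht hyc
              (htc.1.not_inSubtree hT.rooted)).2.1
        · rw [hij] at htc
          exact h4.not_inSubtree hT.rooted
            ((htc.1.inSubtree hT.rooted).trans (hsub t ht))
      · exact h2 (Vset_mono hzr hiz)
    obtain ⟨z, hz, hzX, h⟩ := hsep i j hne
    by_cases hi : u i ∈ T.Vset z
    · exact key i j hne hij z hz hzX hi fun hj => h ⟨fun _ => hj, fun _ => hi⟩
    · refine key j i (Ne.symm hne) hij.symm z hz hzX ?_ hi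
      by_contra hj
      exact h ⟨fun h => absurd h hi, fun h => absurd h hj⟩
  · rw [hr.2]
    exact ⟨(hu i).1, (hu i).2.1, (hu i).2.2, hc i⟩

end WeaklySlim

end RTD
namespace RTD

variable {V : Type*} {T : RTD V} {S : Set V} {G : SimpleGraph V} {k : ℕ}

/-! ### Subdividing edges -/

/-- Subdivide the edge above each node `c` by `m c` nodes with bags `β c 1, …, β c (m c)`, from
bottom to top. The node `(c, i)` is named `e (c, i)`, and `(c, 0)` takes the role of `c`. -/
def chains (T : RTD V) (e : ℕ × ℕ ≃ ℕ) (m : ℕ → ℕ) (β : ℕ → ℕ → Set V) : RTD V where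
  nodes := T.nodes.biUnion fun c => (Finset.range (m c + 1)).image fun i => e (c, i)
  root := e (T.root, 0)
  parent := fun n => if (e.symm n).2 < m (e.symm n).1 then e ((e.symm n).1, (e.symm n).2 + 1)
    else e (T.parent (e.symm n).1, 0)
  bag := fun n => β (e.symm n).1 (e.symm n).2

/-- The conditions on the subdividing bags. -/
structure IsChains (S : Set V) (k : ℕ) (T : RTD V) (m : ℕ → ℕ) (β : ℕ → ℕ → Set V) : Prop where
  root : m T.root = 0
  zero : ∀ c, β c 0 = T.bag c
  mono : ∀ p c, T.IsParent p c →
    ((∀ i < m c, β c i ⊆ β c (i + 1)) ∧ β c (m c) ⊆ T.bag p) ∨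
    ((∀ i < m c, β c (i + 1) ⊆ β c i) ∧ T.bag p ⊆ β c (m c))
  card : ∀ c ∈ T.nodes, ∀ i, 0 < i → i ≤ m c → (β c i).ncard ≤ k
  trace : ∀ p c, T.IsParent p c →
    (∀ i ≤ m c, β c i ∩ S = T.bag c ∩ S) ∨ (T.Lset c ∩ S = ∅ ∧ T.bag c ⊆ T.bag p)

variable {e : ℕ × ℕ ≃ ℕ} {m : ℕ → ℕ} {β : ℕ → ℕ → Set V}

theorem mem_chains {c i : ℕ} : e (c, i) ∈ (T.chains e m β).nodes ↔ c ∈ T.nodes ∧ i ≤ m c := by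
  simp [chains]

theorem exists_of_mem_chains {n : ℕ} (h : n ∈ (T.chains e m β).nodes) :
    ∃ c i, n = e (c, i) ∧ c ∈ T.nodes ∧ i ≤ m c := by
  obtain ⟨⟨c, i⟩, rfl⟩ := e.surjective n
  exact ⟨c, i, rfl, mem_chains.1 h⟩

theorem bag_chains (c i : ℕ) : (T.chains e m β).bag (e (c, i)) = β c i := by simp [chains]

theorem parent_chains_of_lt {c i : ℕ} (h : i < m c) :
    (T.chains e m β).parent (e (c, i)) = e (c, i + 1) := by simp [chains, h]

theorem parent_chains_of_le {c i : ℕ} (h : m c ≤ i) :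
    (T.chains e m β).parent (e (c, i)) = e (T.parent c, 0) := by simp [chains, Nat.not_lt.2 h]

theorem monotone_upto {f : ℕ → Set V} {M : ℕ} (h : ∀ i < M, f i ⊆ f (i + 1)) {i j : ℕ}
    (hij : i ≤ j) (hj : j ≤ M) : f i ⊆ f j := by
  induction j, hij using Nat.le_induction with
  | base => exact subset_rfl
  | succ j hij ih => exact (ih (by omega)).trans (h j (by omega))

theorem antitone_upto {f : ℕ → Set V} {M : ℕ} (h : ∀ i < M, f (i + 1) ⊆ f i) {i j : ℕ}
    (hij : i ≤ j) (hj : j ≤ M) : f j ⊆ f i := by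
  induction j, hij using Nat.le_induction with
  | base => exact subset_rfl
  | succ j hij ih => exact (h j (by omega)).trans (ih (by omega))

namespace IsChains

variable (H : IsChains S k T m β)
include H

theorem pos_ne_root {c : ℕ} (h : 0 < m c) : c ≠ T.root := by
  rintro rfl; rw [H.root] at h; exact lt_irrefl _ h

theorem isParent_succ {c i : ℕ} (hc : c ∈ T.nodes) (hi : i < m c) :
    (T.chains e m β).IsParent (e (c, i + 1)) (e (c, i)) := by
  refine ⟨mem_chains.2 ⟨hc, hi.le⟩, fun h => ?_, parent_chains_of_lt hi⟩
  exact H.pos_ne_root (Nat.zero_lt_of_lt hi) (Prod.ext_iff.1 (e.injective h)).1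

theorem isParent_top {p c : ℕ} (h : T.IsParent p c) :
    (T.chains e m β).IsParent (e (p, 0)) (e (c, m c)) := by
  refine ⟨mem_chains.2 ⟨h.1, le_rfl⟩, fun h' => h.2.1 (Prod.ext_iff.1 (e.injective h')).1, ?_⟩
  rw [parent_chains_of_le le_rfl, h.2.2]

theorem isParent_cases {q n : ℕ} (h : (T.chains e m β).IsParent q n) :
    (∃ c i, c ∈ T.nodes ∧ i < m c ∧ n = e (c, i) ∧ q = e (c, i + 1)) ∨
    (∃ p c, T.IsParent p c ∧ n = e (c, m c) ∧ q = e (p, 0)) := by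
  obtain ⟨hn, hr, hq⟩ := h
  obtain ⟨c, i, rfl, hc, hi⟩ := exists_of_mem_chains hn
  rcases hi.lt_or_eq with h | rfl
  · rw [parent_chains_of_lt h] at hq
    exact Or.inl ⟨c, i, hc, h, rfl, hq.symm⟩
  · rw [parent_chains_of_le le_rfl] at hq
    refine Or.inr ⟨T.parent c, c, ⟨hc, ?_, rfl⟩, rfl, hq.symm⟩
    rintro rfl
    exact hr (by rw [H.root]; rfl)

theorem rooted (hT : T.IsRootedTree) : (T.chains e m β).IsRootedTree := by
  obtain ⟨d, hd⟩ := hT.exists_depth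
  obtain ⟨K, hK⟩ : ∃ K, ∀ c ∈ T.nodes, m c ≤ K :=
    ⟨T.nodes.sup m, fun c hc => Finset.le_sup hc⟩
  refine isRootedTree_of_depth (mem_chains.2 ⟨hT.1, Nat.zero_le _⟩) ?_ ?_
    -- `K` bounds all chain lengths, so scaling depths by `K + 1` leaves room for a whole chain. The
    -- truncated subtraction is harmless: the chain above the root is empty, and every other node
    -- has positive depth.
    (fun n => d (e.symm n).1 * (K + 1) - (e.symm n).2) ?_
  · change (T.chains e m β).parent (e (T.root, 0)) = e (T.root, 0)
    rw [parent_chains_of_le (by rw [H.root]), hT.2.1]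
  · intro n hn
    obtain ⟨c, i, rfl, hc, hi⟩ := exists_of_mem_chains hn
    rcases hi.lt_or_eq with h | rfl
    · rw [parent_chains_of_lt h]; exact mem_chains.2 ⟨hc, h⟩
    · rw [parent_chains_of_le le_rfl]; exact mem_chains.2 ⟨hT.2.2.1 c hc, Nat.zero_le _⟩
  · intro n hn hr
    rcases H.isParent_cases ⟨hn, hr, rfl⟩ with ⟨c, i, hc, hi, rfl, hq⟩ | ⟨p, c, hpc, rfl, hq⟩
    · rw [hq]
      simp only [Equiv.symm_apply_apply]
      have h1 := hd c hc (H.pos_ne_root (Nat.zero_lt_of_lt hi))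
      have h2 : 1 * (K + 1) ≤ d c * (K + 1) := Nat.mul_le_mul_right _ (by omega)
      have h3 := hK c hc
      omega
    · rw [hq]
      simp only [Equiv.symm_apply_apply]
      have h1 := hd c hpc.1 hpc.2.1
      rw [hpc.2.2] at h1
      have h2 : (d p + 1) * (K + 1) ≤ d c * (K + 1) := Nat.mul_le_mul_right _ h1
      have h3 := hK c hpc.1
      rw [Nat.add_mul] at h2
      omega

theorem inSubtree_chain (hT : T.IsRootedTree) {c i j : ℕ} (hc : c ∈ T.nodes) (hij : i ≤ j)
    (hj : j ≤ m c) : (T.chains e m β).InSubtree (e (c, i)) (e (c, j)) := by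
  induction j, hij using Nat.le_induction with
  | base => exact InSubtree.refl (mem_chains.2 ⟨hc, hj⟩)
  | succ j hij ih =>
    exact (ih (by omega)).trans ((H.isParent_succ hc (by omega)).inSubtree (H.rooted hT))

theorem inSubtree_zero (hT : T.IsRootedTree) {x c : ℕ} (h : T.InSubtree x c) :
    (T.chains e m β).InSubtree (e (x, 0)) (e (c, 0)) := by
  refine h.climb hT (P := fun y => (T.chains e m β).InSubtree (e (x, 0)) (e (y, 0)))
    (InSubtree.refl (mem_chains.2 ⟨h.1, Nat.zero_le _⟩)) fun y _ hyc hne ih => ?_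
  have hp : T.IsParent (T.parent y) y := ⟨hyc.1, (hyc.parent_of_ne hT hne).1, rfl⟩
  exact (ih.trans (H.inSubtree_chain hT hyc.1 (Nat.zero_le _) le_rfl)).trans
    ((H.isParent_top hp).inSubtree (H.rooted hT))

theorem inSubtree_cases (hT : T.IsRootedTree) {y c i : ℕ}
    (h : (T.chains e m β).InSubtree y (e (c, i))) :
    (∃ j ≤ i, y = e (c, j)) ∨
    (∃ c' j, j ≤ m c' ∧ y = e (c', j) ∧ c' ≠ c ∧ T.InSubtree c' c) := by
  obtain ⟨c', j, rfl, hc', hj⟩ := exists_of_mem_chains h.1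
  have := h.climb (H.rooted hT) (P := fun z => ∃ c₂ i₂, z = e (c₂, i₂) ∧
      (c' = c₂ ∧ j ≤ i₂ ∨ c' ≠ c₂ ∧ T.InSubtree c' c₂)) ⟨c', j, rfl, Or.inl ⟨rfl, le_rfl⟩⟩ ?_
  · obtain ⟨c₂, i₂, heq, h2⟩ := this
    have := e.injective heq
    simp only [Prod.mk.injEq] at this
    obtain ⟨rfl, rfl⟩ := this
    rcases h2 with ⟨rfl, h2⟩ | h2
    · exact Or.inl ⟨j, h2, rfl⟩
    · exact Or.inr ⟨c', j, hj, rfl, h2⟩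
  · rintro z - hz hne ⟨c₂, i₂, rfl, h2⟩
    have hr := (hz.parent_of_ne (H.rooted hT) hne).1
    rcases H.isParent_cases ⟨hz.1, hr, rfl⟩ with ⟨c₃, i₃, hc₃, hi, heq, hq⟩ | ⟨p, c₃, hpc, heq, hq⟩
    · have := e.injective heq
      simp only [Prod.mk.injEq] at this
      obtain ⟨rfl, rfl⟩ := this
      refine ⟨c₂, i₂ + 1, hq, ?_⟩
      rcases h2 with h2 | h2
      · exact Or.inl ⟨h2.1, by omega⟩
      · exact Or.inr h2
    · have := e.injective heq
      simp only [Prod.mk.injEq] at this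
      obtain ⟨rfl, rfl⟩ := this
      have hsub : T.InSubtree c' c₂ := by
        rcases h2 with h2 | h2
        · rw [h2.1]; exact InSubtree.refl hpc.1
        · exact h2.2
      refine ⟨p, 0, hq, Or.inr ⟨?_, hsub.trans (hpc.inSubtree hT)⟩⟩
      rintro rfl
      exact hpc.not_inSubtree hT hsub

theorem subset_union {p c i : ℕ} (h : T.IsParent p c) (hi : i ≤ m c) :
    β c i ⊆ T.bag c ∪ T.bag p := by
  rcases H.mono p c h with ⟨h1, h2⟩ | ⟨h1, h2⟩
  · exact ((monotone_upto h1 hi le_rfl).trans h2).trans Set.subset_union_right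
  · exact ((antitone_upto h1 (Nat.zero_le i) hi).trans (H.zero c).subset).trans
      Set.subset_union_left

/-- Chain bags of the same edge at or below position `i` are contained in `X_c` or in `β c i`, by
monotonicity. The bags of lower chains are contained in the union of the two bags at the ends of
their edges, both of which lie below `c`. -/
theorem Vset_chains (hT : T.IsRootedTree) {c i : ℕ} (hc : c ∈ T.nodes) (hi : i ≤ m c) :
    (T.chains e m β).Vset (e (c, i)) = T.Vset c ∪ β c i := by
  apply Set.Subset.antisymm
  · rintro v ⟨y, hy, hvy⟩
    rcases H.inSubtree_cases hT hy with ⟨j, hj, rfl⟩ | ⟨c', j, hj, rfl, hne, hsub⟩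
    · rw [bag_chains] at hvy
      by_cases hcr : c = T.root
      · have := H.root; rw [← hcr] at this
        have hj0 : j = i := by omega
        exact Or.inr (hj0 ▸ hvy)
      rcases H.mono _ c ⟨hc, hcr, rfl⟩ with ⟨h1, h2⟩ | ⟨h1, h2⟩
      · exact Or.inr (monotone_upto h1 hj hi hvy)
      · have := antitone_upto h1 (Nat.zero_le j) (hj.trans hi) hvy
        rw [H.zero] at this
        exact Or.inl (bag_subset_Vset hc this)
    · rw [bag_chains] at hvy
      have hpar := hsub.parent_of_ne hT hne
      rcases H.subset_union ⟨hsub.1, hpar.1, rfl⟩ hj hvy with h | h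
      · exact Or.inl ⟨c', hsub, h⟩
      · exact Or.inl ⟨_, hpar.2, h⟩
  · rintro v (⟨y, hy, hvy⟩ | hv)
    · refine ⟨e (y, 0), (H.inSubtree_zero hT hy).trans
        (H.inSubtree_chain hT hc (Nat.zero_le _) hi), ?_⟩
      rwa [bag_chains, H.zero]
    · refine ⟨e (c, i), InSubtree.refl (mem_chains.2 ⟨hc, hi⟩), ?_⟩
      rwa [bag_chains]

theorem Vset_chains_zero (hT : T.IsRootedTree) {c : ℕ} (hc : c ∈ T.nodes) :
    (T.chains e m β).Vset (e (c, 0)) = T.Vset c := by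
  rw [H.Vset_chains hT hc (Nat.zero_le _), H.zero]
  exact Set.union_eq_left.2 (bag_subset_Vset hc)

theorem isTD (hT : IsTD G T) : IsTD G (T.chains e m β) := by
  refine ⟨H.rooted hT.rooted, fun u v huv => ?_, fun v => ?_⟩
  · obtain ⟨t, ht, h1, h2⟩ := hT.edge u v huv
    refine ⟨e (t, 0), mem_chains.2 ⟨ht, Nat.zero_le _⟩, ?_, ?_⟩ <;> rwa [bag_chains, H.zero]
  · obtain ⟨r, hr, hvr, hr'⟩ := hT.top v
    classical
    -- The top node of `v` moves from `r` up the chain above `r`, as far as the bags still contain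
    -- `v`.
    have hex : ∃ I, I ≤ m r ∧ v ∈ β r I ∧ ∀ i ≤ m r, v ∈ β r i → i ≤ I := by
      have hne : ((Finset.range (m r + 1)).filter fun i => v ∈ β r i).Nonempty :=
        ⟨0, by simp [H.zero, hvr]⟩
      refine ⟨Finset.max' _ hne, ?_, ?_, fun i hi hv => Finset.le_max' _ i ?_⟩
      · exact Nat.lt_succ_iff.1 (Finset.mem_range.1 (Finset.mem_filter.1 (Finset.max'_mem _ hne)).1)
      · exact (Finset.mem_filter.1 (Finset.max'_mem _ hne)).2
      · simp [hv, Nat.lt_succ_iff.2 hi]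
    obtain ⟨I, hI, hvI, hmax⟩ := hex
    refine ⟨e (r, I), mem_chains.2 ⟨hr, hI⟩, by rwa [bag_chains], ?_⟩
    intro n hn hvn hne
    obtain ⟨c, i, rfl, hc, hi⟩ := exists_of_mem_chains hn
    rw [bag_chains] at hvn
    by_cases hcr : c = T.root
    · exfalso
      have hm : m c = 0 := by rw [hcr]; exact H.root
      have hi0 : i = 0 := by omega
      subst hi0
      rw [H.zero] at hvn
      by_cases hcr' : c = r
      · subst hcr'
        exact hne (by rw [show I = 0 by omega])
      · exact (hr' c hc hvn hcr').1 hcr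
    refine ⟨fun h => hcr (Prod.ext_iff.1 (e.injective h)).1, ?_⟩
    have hp : T.IsParent (T.parent c) c := ⟨hc, hcr, rfl⟩
    rcases hi.lt_or_eq with h | rfl
    · rw [parent_chains_of_lt h, bag_chains]
      rcases H.mono _ c hp with ⟨h1, h2⟩ | ⟨h1, h2⟩
      · exact h1 i h hvn
      · by_cases hcr' : c = r
        · subst hcr'
          have hiI : i < I := lt_of_le_of_ne (hmax i hi hvn) (by rintro rfl; exact hne rfl)
          exact antitone_upto h1 hiI hI hvI
        · have := antitone_upto h1 (Nat.zero_le i) hi hvn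
          rw [H.zero] at this
          exact antitone_upto h1 (show i + 1 ≤ m c from h) le_rfl (h2 (hr' c hc this hcr').2)
    · rw [parent_chains_of_le le_rfl, bag_chains, H.zero]
      rcases H.mono _ c hp with ⟨h1, h2⟩ | ⟨h1, h2⟩
      · exact h2 hvn
      · by_cases hcr' : c = r
        · subst hcr'
          exact absurd (le_antisymm (hmax _ le_rfl hvn) hI) (by rintro h; exact hne (by rw [h]))
        · have := antitone_upto h1 (Nat.zero_le _) le_rfl hvn
          rw [H.zero] at this
          exact (hr' c hc this hcr').2

/-- If the chain is decreasing while `X_c ⊆ X_p`, then all its bags are squeezed to `X_c`, which is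
the first alternative. -/
theorem trace_or_mono {p c : ℕ} (h : T.IsParent p c) :
    (∀ i ≤ m c, β c i ∩ S = T.bag c ∩ S) ∨
    (T.Lset c ∩ S = ∅ ∧ (∀ i < m c, β c i ⊆ β c (i + 1)) ∧ β c (m c) ⊆ T.bag p) := by
  rcases H.trace p c h with h1 | ⟨h1, h2⟩
  · exact Or.inl h1
  · rcases H.mono p c h with h3 | ⟨h3, h4⟩
    · exact Or.inr ⟨h1, h3⟩
    · refine Or.inl fun i hi => ?_
      congr 1
      apply Set.Subset.antisymm
      · exact (antitone_upto h3 (Nat.zero_le i) hi).trans (H.zero c).subset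
      · exact (h2.trans h4).trans (antitone_upto h3 hi le_rfl)

theorem trace_chains (hT : T.IsRootedTree) {c i : ℕ} (hc : c ∈ T.nodes) (hi : i ≤ m c)
    (h : β c i ∩ S = T.bag c ∩ S) : (T.chains e m β).trace S (e (c, i)) = T.trace S c := by
  refine trace_eq_of_inter ?_ (by rwa [bag_chains])
  rw [H.Vset_chains hT hc hi, Set.union_inter_distrib_right, h,
    Set.union_eq_left.2 (Set.inter_subset_inter_left _ (bag_subset_Vset hc))]

theorem Vset_inter_subset {c : ℕ} (hL : T.Lset c ∩ S = ∅) : T.Vset c ∩ S ⊆ T.bag c := by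
  rintro s ⟨h1, h2⟩
  by_contra h3
  have : s ∈ T.Lset c ∩ S := ⟨⟨h1, h3⟩, h2⟩
  rw [hL] at this
  exact this

theorem Lset_chains (hT : T.IsRootedTree) {c i : ℕ} (hc : c ∈ T.nodes) (hi : i ≤ m c)
    (hL : T.Lset c ∩ S = ∅) (hs : T.bag c ∩ S ⊆ β c i) :
    (T.chains e m β).Lset (e (c, i)) ∩ S = ∅ := by
  rw [Set.eq_empty_iff_forall_notMem]
  rintro s ⟨⟨h1, h2⟩, h3⟩
  rw [bag_chains] at h2
  rw [H.Vset_chains hT hc hi] at h1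
  rcases h1 with h1 | h1
  · exact h2 (hs ⟨H.Vset_inter_subset hL ⟨h1, h3⟩, h3⟩)
  · exact h2 h1

theorem skel (hT : T.IsRootedTree) :
    Skel S T (T.chains e m β) (fun x => e (x, 0)) (fun y => e (y, m y)) := by
  refine ⟨fun x hx => mem_chains.2 ⟨hx, Nat.zero_le _⟩, fun x _ y _ h =>
    (Prod.ext_iff.1 (e.injective h)).1, rfl, fun x hx => H.trace_chains hT hx (Nat.zero_le _)
    (by rw [H.zero]), fun x y hy => ?_, fun x _ y _ h => (Prod.ext_iff.1 (e.injective h)).1,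
    fun x hx z hz => ?_, fun z hz => ?_⟩
  · refine ⟨H.isParent_top hy.1, H.trace_chains hT hy.1.1 le_rfl ?_⟩
    -- The second alternative is impossible for an `S`-child: it would place every vertex of `S`
    -- below `y` in the bag of `x`.
    rcases H.trace x y hy.1 with h | ⟨h1, h2⟩
    · exact h _ le_rfl
    · obtain ⟨-, s, hs, hsy, hsx⟩ := (mem_sChildren hT).1 hy
      exact absurd (h2 (H.Vset_inter_subset h1 ⟨hsy, hs⟩)) hsx
  · rcases H.isParent_cases hz with ⟨c, i, hc, hi, rfl, hq⟩ | ⟨p, c, hpc, rfl, hq⟩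
    · exact absurd (Prod.ext_iff.1 (e.injective hq)).2 (by simp)
    · obtain rfl : x = p := (Prod.ext_iff.1 (e.injective hq)).1
      by_cases hcs : c ∈ T.sChildren S x
      · exact Or.inl ⟨c, hcs, rfl⟩
      · right
        rintro s ⟨h1, h2⟩
        rw [bag_chains, H.zero]
        rw [H.Vset_chains hT hpc.1 le_rfl] at h1
        have hV : s ∈ T.Vset c → s ∈ T.bag x := fun h => by
          by_contra hsx
          exact hcs ((mem_sChildren hT).2 ⟨hpc, s, h2, h, hsx⟩)
        rcases h1 with h1 | h1
        · exact hV h1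
        · rcases H.subset_union hpc le_rfl h1 with h3 | h3
          · exact hV (bag_subset_Vset hpc.1 h3)
          · exact h3
  · obtain ⟨c, i, rfl, hc, hi⟩ := exists_of_mem_chains hz
    rcases i with _ | i
    · exact Or.inl ⟨c, hc, rfl⟩
    · have hcr := H.pos_ne_root (c := c) (by omega)
      right
      rcases H.trace_or_mono ⟨hc, hcr, rfl⟩ with h | ⟨h1, h2, -⟩
      · refine Or.inl ⟨e (c, i), H.isParent_succ hc hi, ?_⟩
        rw [H.trace_chains hT hc (by omega) (h i (by omega)), H.trace_chains hT hc hi (h _ hi)]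
      · refine Or.inr (H.Lset_chains hT hc hi h1 (Set.inter_subset_left.trans ?_))
        rw [← H.zero]
        exact monotone_upto h2 (Nat.zero_le _) hi

theorem weight_le [Finite V] (hT : T.IsRootedTree) : weight S (T.chains e m β) ≤ weight S T := by
  refine ((H.skel hT).weight_le hT (H.rooted hT) (fun x hx => ?_) fun x hx => ?_).1
  · rw [H.Vset_chains_zero hT hx.1]
  · refine Set.ncard_le_ncard ?_ (Set.toFinite _)
    rintro v ⟨h1, c, hc, h2⟩
    rw [(H.skel hT).sChildren_eq hT (H.rooted hT) hx.1] at hc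
    obtain ⟨y, hy, rfl⟩ := hc
    rw [bag_chains, H.zero] at h1
    rw [H.Vset_chains hT hy.1.1 le_rfl] at h2
    refine ⟨h1, y, hy, ?_⟩
    rcases h2 with h2 | h2
    · exact h2
    · rcases H.subset_union hy.1 le_rfl h2 with h3 | h3
      · exact bag_subset_Vset hy.1.1 h3
      · exact absurd h3 h1

/-- Inserted bags have at most `k` vertices, so an edge with equal full bags at its ends must be an
old edge that was not subdivided. -/
theorem full_edge_cases {q n : ℕ} (h : (T.chains e m β).IsParent q n)
    (heq : (T.chains e m β).bag n = (T.chains e m β).bag q) (hf : (T.chains e m β).IsFull k n) :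
    ∃ p c, T.IsParent p c ∧ n = e (c, 0) ∧ q = e (p, 0) ∧ m c = 0 ∧ T.bag c = T.bag p ∧
      T.IsFull k c := by
  rcases H.isParent_cases h with ⟨c, i, hc, hi, rfl, rfl⟩ | ⟨p, c, hpc, rfl, rfl⟩
  · rw [IsFull, heq, bag_chains] at hf
    have := H.card c hc (i + 1) (by omega) hi
    omega
  · have hm : m c = 0 := by
      by_contra hm
      rw [IsFull, bag_chains] at hf
      have := H.card c hpc.1 (m c) (by omega) le_rfl
      omega
    rw [hm, bag_chains, bag_chains, H.zero, H.zero] at heq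
    rw [hm, IsFull, bag_chains, H.zero] at hf
    exact ⟨p, c, hpc, by rw [hm], rfl, hm, heq, hf⟩

theorem weaklySlim [Finite V] (hT : WeaklySlim G S k T) : WeaklySlim G S k (T.chains e m β) := by
  have hsk := H.skel (e := e) hT.rooted
  have hr := H.rooted (e := e) hT.rooted
  refine { H.isTD hT.toIsTD with
    card_le := fun n hn => ?_, nested := fun q n h => ?_, step := fun q n h => ?_,
    nice := fun t ht => hsk.niceAt hT.rooted hr hT.nice ht,
    root_not_bottom := hsk.root_not_isSBottom hT.rooted hr hT.root_not_bottom,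
    full_two := fun q n h heq hf => ?_, full_sep := fun q n h heq hf => ?_ }
  · obtain ⟨c, i, rfl, hc, hi⟩ := exists_of_mem_chains hn
    rw [bag_chains]
    rcases Nat.eq_zero_or_pos i with rfl | h
    · rw [H.zero]; exact hT.card_le c hc
    · exact (H.card c hc i h hi).trans (Nat.le_succ k)
  · rcases H.isParent_cases h with ⟨c, i, hc, hi, rfl, rfl⟩ | ⟨p, c, hpc, rfl, rfl⟩
    · rw [bag_chains, bag_chains]
      rcases H.mono _ c ⟨hc, H.pos_ne_root (by omega), rfl⟩ with ⟨h1, -⟩ | ⟨h1, -⟩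
      · exact Or.inl (h1 i hi)
      · exact Or.inr (h1 i hi)
    · rw [bag_chains, bag_chains, H.zero]
      rcases H.mono _ c hpc with ⟨-, h1⟩ | ⟨-, h1⟩
      · exact Or.inl h1
      · exact Or.inr h1
  · rcases H.isParent_cases h with ⟨c, i, hc, hi, rfl, rfl⟩ | ⟨p, c, hpc, rfl, rfl⟩
    · rw [bag_chains, bag_chains]
      rcases H.trace_or_mono ⟨hc, H.pos_ne_root (by omega), rfl⟩ with h1 | ⟨h1, h2, h3⟩
      · left
        have key : ∀ v ∈ S, v ∈ β c i ↔ v ∈ β c (i + 1) := fun v hv => by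
          have := Set.ext_iff.1 ((h1 i (by omega)).trans (h1 (i + 1) hi).symm) v
          simpa [hv] using this
        exact ⟨fun v hv => absurd ((key v hv.2).1 hv.1.1) hv.1.2,
          fun v hv => absurd ((key v hv.2).2 hv.1.1) hv.1.2⟩
      · refine Or.inr ⟨H.Lset_chains hT.rooted hc hi.le h1 (Set.inter_subset_left.trans ?_), h2 i hi⟩
        rw [← H.zero]
        exact monotone_upto h2 (Nat.zero_le _) hi.le
    · rw [bag_chains, bag_chains, H.zero]
      rcases H.trace_or_mono hpc with h1 | ⟨h1, h2, h3⟩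
      · have key : ∀ v ∈ S, v ∈ β c (m c) ↔ v ∈ T.bag c := fun v hv => by
          have := Set.ext_iff.1 (h1 _ le_rfl) v
          simpa [hv] using this
        rcases hT.step p c hpc with ⟨h2, h3⟩ | ⟨h2, h3⟩
        · exact Or.inl ⟨h2.anti fun v hv => ⟨⟨(key v hv.2).1 hv.1.1, hv.1.2⟩, hv.2⟩,
            h3.anti fun v hv => ⟨⟨hv.1.1, fun h => hv.1.2 ((key v hv.2).2 h)⟩, hv.2⟩⟩
        · refine Or.inr ⟨H.Lset_chains hT.rooted hpc.1 le_rfl h2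
            fun v hv => (key v hv.2).2 hv.1, ?_⟩
          rcases H.mono p c hpc with ⟨-, h4⟩ | ⟨h4, -⟩
          · exact h4
          · refine (antitone_upto h4 (Nat.zero_le _) le_rfl).trans ?_
            rwa [H.zero]
      · refine Or.inr ⟨H.Lset_chains hT.rooted hpc.1 le_rfl h1
          (Set.inter_subset_left.trans ?_), h3⟩
        rw [← H.zero]
        exact monotone_upto h2 (Nat.zero_le _) le_rfl
  · obtain ⟨p, c, hpc, rfl, rfl, -, heq', hf'⟩ := H.full_edge_cases h heq hf
    rw [hsk.ncard_sChildren hT.rooted hr hpc.1,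
      hsk.ncard_sChildren hT.rooted hr (hpc.parent_mem hT.rooted)]
    exact hT.full_two p c hpc heq' hf'
  · obtain ⟨p, c, hpc, rfl, rfl, -, heq', hf'⟩ := H.full_edge_cases h heq hf
    rw [bag_chains, H.zero]
    intro v hv
    obtain ⟨u, hu, hsep⟩ := hT.full_sep p c hpc heq' hf' v hv
    refine ⟨u, hu, fun i j hij => ?_⟩
    obtain ⟨z, hz, hzX, hiff⟩ := hsep i j hij
    by_cases hzX' : T.bag z = T.bag c
    · refine ⟨e (z, 0), mem_chains.2 ⟨hz, Nat.zero_le _⟩, Or.inl ?_, ?_⟩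
      · rw [bag_chains, H.zero, hzX']
      · rwa [H.Vset_chains_zero hT.rooted hz]
    -- When only the parent of `z` has bag `X`, the node directly below the level is now the top of
    -- the chain above `z`. Its bag adds nothing outside `X` that was not already below `z`.
    · have hzp := hzX.resolve_left hzX'
      have hzpar : T.IsParent (T.parent z) z := ⟨hz, hzp.1, rfl⟩
      have h3 := H.isParent_top (e := e) hzpar
      refine ⟨e (z, m z), mem_chains.2 ⟨hz, le_rfl⟩, Or.inr ⟨h3.2.1, ?_⟩, ?_⟩
      · rw [h3.2.2, bag_chains, H.zero, hzp.2]
      · have key : ∀ a, a ∉ T.bag c →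
            (a ∈ (T.chains e m β).Vset (e (z, m z)) ↔ a ∈ T.Vset z) := fun a ha => by
          rw [H.Vset_chains hT.rooted hz le_rfl]
          refine ⟨?_, Or.inl⟩
          rintro (h | h)
          · exact h
          · rcases H.subset_union hzpar le_rfl h with h | h
            · exact bag_subset_Vset hz h
            · rw [hzp.2] at h; exact absurd h ha
        rwa [key _ (hu i).2.1, key _ (hu j).2.1]

theorem admissible [Finite V] {T₀ : RTD V} {σ : Set V × Set V × Set V}
    (hT : Admissible G S k T₀ σ T) : Admissible G S k T₀ σ (T.chains e m β) := by
  have hsk := H.skel (e := e) hT.rooted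
  have hr := H.rooted (e := e) hT.rooted
  refine { H.weaklySlim hT.toWeaklySlim with
    pred := fun τ τ' => (hsk.directPred_iff hT.rooted hr τ τ').trans (hT.pred τ τ'), mark := ?_ }
  obtain ⟨p, s, hps, hs, hσ, hnf⟩ := hT.mark
  have hp : ∃ q, (T.chains e m β).IsParent q (e (s, 0)) := by
    rcases Nat.eq_zero_or_pos (m s) with h | h
    · have := H.isParent_top (e := e) hps
      rw [h] at this
      exact ⟨_, this⟩
    · exact ⟨_, H.isParent_succ hs.1 h⟩
  obtain ⟨q, hq⟩ := hp
  refine ⟨q, e (s, 0), hq, hsk.isSBottom_image hT.rooted hr hs, (hsk.trace s hs.1).trans hσ,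
    fun ⟨h1, h2⟩ => ?_⟩
  obtain ⟨p', c, hpc, h3, rfl, -, heq', hf'⟩ := H.full_edge_cases hq h1 h2
  obtain rfl : s = c := (Prod.ext_iff.1 (e.injective h3)).1
  obtain rfl := hps.unique hpc
  exact hnf ⟨heq', hf'⟩

end IsChains

end RTD
namespace RTD

variable {V : Type*} {T : RTD V} {S : Set V} {G : SimpleGraph V} {k : ℕ}

/-! ### Moving a component below a node -/

open Classical in
/-- Delete `M` from all bags, attach a new node `N` with bag `B` below `p`, and below `N` a copy of the
subtree rooted at `r` with bags intersected with `M ∪ B`. The copy of `x` is named `x + N + 1`. -/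
noncomputable def hang (T : RTD V) (p r N : ℕ) (M B : Set V) : RTD V where
  nodes := T.nodes ∪ ({N} ∪ (T.nodes.filter fun x => T.InSubtree x r).image fun x => x + N + 1)
  root := T.root
  parent := fun n => if n < N then T.parent n else if n = N then p
    else if n = r + N + 1 then N else T.parent (n - N - 1) + N + 1
  bag := fun n => if n < N then T.bag n \ M else if n = N then B
    else T.bag (n - N - 1) ∩ (M ∪ B)

/-- `M` is an `F`-component of `G` minus the bag of `p` lying below the child `c` of `p`, and `r` is
the top node of `M`. -/
structure IsHang (G : SimpleGraph V) (S : Set V) (T : RTD V) (p c r N : ℕ) (M : Set V) : Prop where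
  td : IsTD G T
  child : T.IsParent p c
  comp : IsComponent G (T.bag p)ᶜ M
  disj : M ∩ S = ∅
  sub : T.InSubtree r c
  meets : (M ∩ T.bag r).Nonempty
  below : M ⊆ T.Vset r
  top : ∀ x ∈ T.nodes, ¬ T.InSubtree x r → ∀ v ∈ M, v ∉ T.bag x
  lt : ∀ x ∈ T.nodes, x < N

/-- Take for `r` a node of minimum depth whose bag meets `M`. The bag of its parent avoids `M`, so
connectedness of `M` confines it to the subtree at `r`. The number `N` is chosen above all node
names. -/
theorem exists_isHang (hT : IsTD G T) {p c : ℕ} (hpc : T.IsParent p c) {M : Set V}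
    (hM : IsFComponent G S (T.bag p)ᶜ M) (hne : (M ∩ T.Vset c).Nonempty) :
    ∃ r N, IsHang G S T p c r N M := by
  obtain ⟨d, hd⟩ := hT.rooted.exists_depth
  obtain ⟨m₀, hm₀, hm₀c⟩ := hne
  have hMp : ∀ v ∈ M, v ∉ T.bag p := fun v hv => hM.1.subset hv
  have hMc : M ⊆ T.Vset c := hM.1.subset_of_closed hm₀ hm₀c fun x hx hxM y _ hxy =>
    hT.mem_Vset_of_adj hx hxy (Or.inr ⟨hpc.2.1, hpc.2.2.symm ▸ hMp x hxM⟩)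
  have hA : ({x | x ∈ T.nodes ∧ (M ∩ T.bag x).Nonempty} : Set ℕ).Nonempty := by
    obtain ⟨y, hy, hmy⟩ := hm₀c
    exact ⟨y, hy.1, m₀, hm₀, hmy⟩
  obtain ⟨r, ⟨hrn, m, hm, hmr⟩, hrd⟩ := Nat.sInf_mem (hA.image d)
  have hrc : T.InSubtree r c := by
    by_contra hrc
    have := (hT.crossing (hMc hm) hrn hrc hmr).2.2
    rw [hpc.2.2] at this
    exact hMp m hm this
  have hrr : r ≠ T.root := by
    rintro rfl
    exact hpc.2.1 (hrc.eq_root hT.rooted)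
  have hpar : ∀ v ∈ M, v ∉ T.bag (T.parent r) := fun v hv hvp => by
    have h1 := hd r hrn hrr
    have h2 : sInf (d '' {x | x ∈ T.nodes ∧ (M ∩ T.bag x).Nonempty}) ≤ d (T.parent r) :=
      Nat.sInf_le ⟨_, ⟨hT.rooted.2.2.1 r hrn, v, hv, hvp⟩, rfl⟩
    omega
  have hMr : M ⊆ T.Vset r := hM.1.subset_of_closed hm (bag_subset_Vset hrn hmr)
    fun x hx hxM y _ hxy => hT.mem_Vset_of_adj hx hxy (Or.inr ⟨hrr, hpar x hxM⟩)
  exact ⟨r, T.nodes.sup id + 1, hT, hpc, hM.1, hM.2, hrc, ⟨m, hm, hmr⟩, hMr,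
    fun x hx hxr v hv hvx => hpar v hv (hT.crossing (hMr hv) hx hxr hvx).2.2,
    fun x hx => Nat.lt_succ_of_le (Finset.le_sup (f := id) hx)⟩

namespace IsHang

variable {p c r N : ℕ} {M : Set V} (H : IsHang G S T p c r N M)
include H

local notation "T⁺" => T.hang p r N M (nbhd G M)

theorem p_mem : p ∈ T.nodes := H.child.parent_mem H.td.rooted

theorem old_mem {x : ℕ} (hx : x ∈ T.nodes) : x ∈ T⁺.nodes := by simp [hang, hx]

theorem N_mem : N ∈ T⁺.nodes := by simp [hang]

theorem copy_mem {x : ℕ} (hx : T.InSubtree x r) : x + N + 1 ∈ T⁺.nodes := by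
  simp only [hang, Finset.mem_union, Finset.mem_image, Finset.mem_filter]
  exact Or.inr (Or.inr ⟨x, ⟨hx.1, hx⟩, rfl⟩)

theorem mem_cases {n : ℕ} (hn : n ∈ T⁺.nodes) :
    n ∈ T.nodes ∨ n = N ∨ ∃ x, n = x + N + 1 ∧ T.InSubtree x r := by
  simp only [hang, Finset.mem_union, Finset.mem_image, Finset.mem_filter,
    Finset.mem_singleton] at hn
  rcases hn with h | h | ⟨x, hx, rfl⟩
  · exact Or.inl h
  · exact Or.inr (Or.inl h)
  · exact Or.inr (Or.inr ⟨x, rfl, hx.2⟩)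

theorem bag_old {x : ℕ} (hx : x ∈ T.nodes) : T⁺.bag x = T.bag x \ M := by
  simp [hang, H.lt x hx]

theorem bag_N : T⁺.bag N = nbhd G M := by simp [hang]

theorem bag_copy (x : ℕ) : T⁺.bag (x + N + 1) = T.bag x ∩ (M ∪ nbhd G M) := by
  have h1 : ¬ x + N + 1 < N := by omega
  have h2 : x + N + 1 ≠ N := by omega
  have h3 : x + N + 1 - N - 1 = x := by omega
  simp [hang, h1, h2, h3]

theorem parent_old {x : ℕ} (hx : x ∈ T.nodes) : T⁺.parent x = T.parent x := by
  simp [hang, H.lt x hx]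

theorem parent_N : T⁺.parent N = p := by simp [hang]

theorem parent_copy_r : T⁺.parent (r + N + 1) = N := by
  have h1 : ¬ r + N + 1 < N := by omega
  have h2 : r + N + 1 ≠ N := by omega
  simp [hang, h1, h2]

theorem parent_copy {x : ℕ} (hx : x ≠ r) : T⁺.parent (x + N + 1) = T.parent x + N + 1 := by
  have h1 : ¬ x + N + 1 < N := by omega
  have h2 : x + N + 1 ≠ N := by omega
  have h3 : x + N + 1 - N - 1 = x := by omega
  have h4 : x + N + 1 ≠ r + N + 1 := by omega
  simp [hang, h1, h2, h3, hx]

theorem isParent_old {q x : ℕ} (h : T.IsParent q x) : T⁺.IsParent q x :=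
  ⟨H.old_mem h.1, h.2.1, (H.parent_old h.1).trans h.2.2⟩

theorem isParent_cases {q n : ℕ} (h : T⁺.IsParent q n) :
    T.IsParent q n ∨ (n = N ∧ q = p) ∨ (n = r + N + 1 ∧ q = N) ∨
    ∃ x y, n = x + N + 1 ∧ q = y + N + 1 ∧ T.IsParent y x ∧ T.InSubtree x r ∧
      T.InSubtree y r := by
  obtain ⟨hn, hr, rfl⟩ := h
  rcases H.mem_cases hn with h | rfl | ⟨x, rfl, hx⟩
  · exact Or.inl ⟨h, hr, (H.parent_old h).symm⟩
  · exact Or.inr (Or.inl ⟨rfl, H.parent_N⟩)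
  · by_cases hxr : x = r
    · subst hxr; exact Or.inr (Or.inr (Or.inl ⟨rfl, H.parent_copy_r⟩))
    · have := hx.parent_of_ne H.td.rooted hxr
      exact Or.inr (Or.inr (Or.inr ⟨x, T.parent x, rfl, H.parent_copy hxr,
        ⟨hx.1, this.1, rfl⟩, hx, this.2⟩))

theorem N_notMem : N ∉ T.nodes := fun h => lt_irrefl _ (H.lt N h)

theorem copy_notMem (x : ℕ) : x + N + 1 ∉ T.nodes := fun h => by have := H.lt _ h; omega

theorem rooted : T⁺.IsRootedTree := by
  obtain ⟨d, hd⟩ := H.td.rooted.exists_depth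
  have hT := H.td.rooted
  refine isRootedTree_of_depth (H.old_mem hT.1) ((H.parent_old hT.1).trans hT.2.1) ?_
    -- Old nodes keep their depth, `N` sits just below `p`, and the copies are shifted beyond `N`.
    (fun n => if n < N then d n else if n = N then d p + 1 else d (n - N - 1) + d p + 2) ?_
  · intro n hn
    by_cases hnr : n = T.root
    · subst hnr; rw [H.parent_old hT.1, hT.2.1]; exact hn
    rcases H.isParent_cases ⟨hn, hnr, rfl⟩ with h | ⟨-, h⟩ | ⟨-, h⟩ | ⟨x, y, -, h, -, -, hy⟩
    · exact H.old_mem (h.parent_mem hT)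
    · rw [h]; exact H.old_mem H.p_mem
    · rw [h]; exact H.N_mem
    · rw [h]; exact H.copy_mem hy
  · intro n hn hnr
    rcases H.isParent_cases ⟨hn, hnr, rfl⟩ with h | ⟨h1, h⟩ | ⟨h1, h⟩ | ⟨x, y, h1, h, hxy, -, -⟩
    · have h1 := hd n h.1 h.2.1
      rw [h.2.2] at h1
      have h2 := H.lt _ h.1
      have h3 := H.lt _ (h.parent_mem hT)
      simp only [h2, h3, if_true]
      exact h1
    · rw [h]
      have h2 := H.lt _ H.p_mem
      simp only [h1, h2, if_true, lt_irrefl, if_false]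
      omega
    · rw [h]
      have h2 : ¬ n < N := by omega
      have h3 : n ≠ N := by omega
      simp only [h2, h3, if_true, lt_irrefl, if_false]
      omega
    · rw [h]
      have h2 : ¬ n < N := by omega
      have h3 : n ≠ N := by omega
      have h4 : ¬ y + N + 1 < N := by omega
      have h5 : y + N + 1 ≠ N := by omega
      have h6 : y + N + 1 - N - 1 = y := by omega
      have h7 : n - N - 1 = x := by omega
      simp only [h2, h3, h4, h5, h6, h7, if_false]
      have h8 := hd x hxy.1 hxy.2.1
      rw [hxy.2.2] at h8
      omega

theorem inSubtree_old {y x : ℕ} (h : T.InSubtree y x) : T⁺.InSubtree y x :=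
  h.climb H.td.rooted (P := fun z => T⁺.InSubtree y z) (InSubtree.refl (H.old_mem h.1))
    fun _ _ hz hne ih => ih.trans ((H.isParent_old
      ⟨hz.1, (hz.parent_of_ne H.td.rooted hne).1, rfl⟩).inSubtree H.rooted)

theorem inSubtree_copy {x : ℕ} (hx : T.InSubtree x r) : T⁺.InSubtree (x + N + 1) p := by
  have h1 : T⁺.InSubtree (x + N + 1) (r + N + 1) :=
    hx.climb H.td.rooted (P := fun z => T⁺.InSubtree (x + N + 1) (z + N + 1))
      (InSubtree.refl (H.copy_mem hx)) fun _ _ hz hne ih => by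
        refine ih.trans (InSubtree.of_parent (H.copy_mem hz) ?_)
        rw [H.parent_copy hne]
        exact InSubtree.refl (H.copy_mem (hz.parent_of_ne H.td.rooted hne).2)
  refine h1.trans (InSubtree.of_parent (h1.mem_right H.rooted) ?_)
  rw [H.parent_copy_r]
  refine InSubtree.of_parent H.N_mem ?_
  rw [H.parent_N]
  exact InSubtree.refl (H.old_mem H.p_mem)

theorem inSubtree_cases {y x : ℕ} (h : T⁺.InSubtree y x) :
    (x ∈ T.nodes ∧ (y ∈ T.nodes ∧ T.InSubtree y x ∨ y ∉ T.nodes ∧ T.InSubtree p x)) ∨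
    (x ∉ T.nodes ∧ y ∉ T.nodes) := by
  have hT := H.td.rooted
  refine h.climb H.rooted (P := fun x => (x ∈ T.nodes ∧ (y ∈ T.nodes ∧ T.InSubtree y x ∨
    y ∉ T.nodes ∧ T.InSubtree p x)) ∨ (x ∉ T.nodes ∧ y ∉ T.nodes)) ?_ fun z _ hz hne ih => ?_
  · by_cases hy : y ∈ T.nodes
    · exact Or.inl ⟨hy, Or.inl ⟨hy, InSubtree.refl hy⟩⟩
    · exact Or.inr ⟨hy, hy⟩
  · rcases H.isParent_cases ⟨hz.1, (hz.parent_of_ne H.rooted hne).1, rfl⟩ with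
      h | ⟨h1, h⟩ | ⟨h1, h⟩ | ⟨x, y', h1, h, hxy, -, -⟩
    · rcases ih with ⟨-, ih⟩ | ⟨ih, -⟩
      · refine Or.inl ⟨h.parent_mem hT, ?_⟩
        rcases ih with ⟨ih1, ih2⟩ | ⟨ih1, ih2⟩
        · exact Or.inl ⟨ih1, ih2.trans (h.inSubtree hT)⟩
        · exact Or.inr ⟨ih1, ih2.trans (h.inSubtree hT)⟩
      · exact absurd h.1 ih
    · rw [h]
      refine Or.inl ⟨H.p_mem, Or.inr ⟨?_, InSubtree.refl H.p_mem⟩⟩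
      rcases ih with ⟨ih, -⟩ | ⟨-, ih⟩
      · exact absurd (h1 ▸ ih) H.N_notMem
      · exact ih
    · rw [h]
      refine Or.inr ⟨H.N_notMem, ?_⟩
      rcases ih with ⟨ih, -⟩ | ⟨-, ih⟩
      · exact absurd (h1 ▸ ih) (H.copy_notMem _)
      · exact ih
    · rw [h]
      refine Or.inr ⟨H.copy_notMem _, ?_⟩
      rcases ih with ⟨ih, -⟩ | ⟨-, ih⟩
      · exact absurd (h1 ▸ ih) (H.copy_notMem _)
      · exact ih

theorem inSubtree_copy_cases {y x : ℕ} (h : T⁺.InSubtree y (x + N + 1)) :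
    ∃ y', y = y' + N + 1 ∧ T.InSubtree y' x := by
  have hT := H.td.rooted
  refine h.climb H.rooted (P := fun z => ∀ x, z = x + N + 1 →
    ∃ y', y = y' + N + 1 ∧ T.InSubtree y' x) ?_ (fun z _ hz hne ih => ?_) x rfl
  · rintro x rfl
    rcases H.mem_cases h.1 with h' | h' | ⟨x', h', hx'⟩
    · exact absurd h' (H.copy_notMem _)
    · omega
    · obtain rfl : x = x' := by omega
      exact ⟨x, rfl, InSubtree.refl hx'.1⟩
  · intro x' hx'
    rcases H.isParent_cases ⟨hz.1, (hz.parent_of_ne H.rooted hne).1, rfl⟩ with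
      h | ⟨h1, h⟩ | ⟨h1, h⟩ | ⟨x, y', h1, h, hxy, -, -⟩
    · exact absurd (hx' ▸ h.parent_mem hT) (H.copy_notMem _)
    · exact absurd (hx' ▸ h ▸ H.p_mem) (H.copy_notMem _)
    · omega
    · obtain rfl : y' = x' := by omega
      obtain ⟨y₂, hy, hsub⟩ := ih x h1
      exact ⟨y₂, hy, hsub.trans (hxy.inSubtree hT)⟩

theorem not_inSubtree_p {x : ℕ} (hx : T.InSubtree x c) : ¬ T.InSubtree p x := fun h =>
  H.child.not_inSubtree H.td.rooted (h.trans hx)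

theorem nbhd_subset_p : nbhd G M ⊆ T.bag p := nbhd_subset_of_isComponent H.comp

theorem notMem_p {v : V} (hv : v ∈ M) : v ∉ T.bag p := H.comp.subset hv

/-- A neighbor of `M` lies in the bag of `p` and shares a bag with `M` below `r`, so it crosses the
edge above `r`. -/
theorem nbhd_subset_r : nbhd G M ⊆ T.bag r := by
  rintro b hb
  have hbp := H.nbhd_subset_p hb
  obtain ⟨-, m, hm, hmb⟩ := hb
  obtain ⟨z, hz, hmz, hbz⟩ := H.td.edge m b hmb
  have hzr : T.InSubtree z r := by
    by_contra h
    exact H.top z hz h m hm hmz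
  exact (H.td.crossing ⟨z, hzr, hbz⟩ H.p_mem (H.not_inSubtree_p H.sub) hbp).2.1

theorem bag_new_subset {n : ℕ} (hn : n ∈ T⁺.nodes) (h : n ∉ T.nodes) :
    T⁺.bag n ⊆ M ∪ nbhd G M := by
  rcases H.mem_cases hn with h' | rfl | ⟨x, rfl, hx⟩
  · exact absurd h' h
  · rw [H.bag_N]; exact Set.subset_union_right
  · rw [H.bag_copy]; exact Set.inter_subset_right

/-- The copy hangs at `p`, so `M` vanishes from `V_x` for `x` in the subtree at `c`, whereas `p` and
its ancestors still see it through the copy. -/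
theorem mem_Vset_old {x : ℕ} (hx : x ∈ T.nodes) {v : V} :
    v ∈ T⁺.Vset x ↔ v ∈ T.Vset x ∧ (v ∈ M → ¬ T.InSubtree x c) := by
  have hT := H.td.rooted
  constructor
  · rintro ⟨y, hy, hvy⟩
    rcases H.inSubtree_cases hy with ⟨-, ⟨hy1, hy2⟩ | ⟨hy1, hy2⟩⟩ | ⟨h, -⟩
    · rw [H.bag_old hy1] at hvy
      exact ⟨⟨y, hy2, hvy.1⟩, fun h => absurd h hvy.2⟩
    · refine ⟨?_, fun _ hxc => H.not_inSubtree_p hxc hy2⟩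
      rcases H.bag_new_subset hy.1 hy1 hvy with h | h
      · exact Vset_mono ((H.sub.trans (H.child.inSubtree hT)).trans hy2) (H.below h)
      · exact ⟨p, hy2, H.nbhd_subset_p h⟩
    · exact absurd hx h
  · rintro ⟨⟨y, hy, hvy⟩, hM⟩
    by_cases hvM : v ∈ M
    · have hyr : T.InSubtree y r := by
        by_contra h
        exact H.top y hy.1 h v hvM hvy
      have hxc := hM hvM
      have hcx : T.InSubtree c x := ((hyr.trans H.sub).total hT hy).resolve_right hxc
      have hne : c ≠ x := by rintro rfl; exact hxc hcx
      have hpx := (hcx.parent_of_ne hT hne).2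
      rw [H.child.2.2] at hpx
      refine ⟨y + N + 1, (H.inSubtree_copy hyr).trans (H.inSubtree_old hpx), ?_⟩
      rw [H.bag_copy]
      exact ⟨hvy, Or.inl hvM⟩
    · refine ⟨y, H.inSubtree_old hy, ?_⟩
      rw [H.bag_old hy.1]
      exact ⟨hvy, hvM⟩

theorem notMem_S {v : V} (hv : v ∈ M) : v ∉ S := fun h => by
  have : v ∈ M ∩ S := ⟨hv, h⟩
  rw [H.disj] at this
  exact this

theorem trace_old {x : ℕ} (hx : x ∈ T.nodes) : T⁺.trace S x = T.trace S x := by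
  refine trace_eq_of_inter ?_ ?_
  · ext v
    simp only [Set.mem_inter_iff, H.mem_Vset_old hx]
    exact ⟨fun h => ⟨h.1.1, h.2⟩, fun h => ⟨⟨h.1, fun hM => absurd h.2 (H.notMem_S hM)⟩, h.2⟩⟩
  · ext v
    simp only [Set.mem_inter_iff, H.bag_old hx, Set.mem_sdiff]
    exact ⟨fun h => ⟨h.1.1, h.2⟩, fun h => ⟨⟨h.1, fun hM => absurd h.2 (H.notMem_S hM)⟩, h.2⟩⟩

theorem Vset_new_inter {n : ℕ} (hn : n ∈ T⁺.nodes) (h : n ∉ T.nodes) :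
    T⁺.Vset n ∩ S ⊆ T⁺.bag n := by
  rintro s ⟨⟨y, hy, hsy⟩, hs⟩
  rcases H.mem_cases hn with h' | rfl | ⟨x, rfl, hx⟩
  · exact absurd h' h
  · have hyn : y ∉ T.nodes := by
      rcases H.inSubtree_cases hy with ⟨h1, -⟩ | ⟨-, h1⟩
      · exact absurd h1 h
      · exact h1
    rcases H.bag_new_subset hy.1 hyn hsy with h1 | h1
    · exact absurd hs (H.notMem_S h1)
    · rwa [H.bag_N]
  · obtain ⟨y', rfl, hy'⟩ := H.inSubtree_copy_cases hy
    rw [H.bag_copy] at hsy ⊢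
    refine ⟨?_, hsy.2⟩
    rcases hsy.2 with h1 | h1
    · exact absurd hs (H.notMem_S h1)
    · exact (H.td.crossing ⟨y', hy', hsy.1⟩ H.p_mem (H.not_inSubtree_p (hx.trans H.sub))
        (H.nbhd_subset_p h1)).2.1

theorem Lset_new {n : ℕ} (hn : n ∈ T⁺.nodes) (h : n ∉ T.nodes) : T⁺.Lset n ∩ S = ∅ :=
  Set.eq_empty_iff_forall_notMem.2 fun _ hs => hs.1.2 (H.Vset_new_inter hn h ⟨hs.1.1, hs.2⟩)

theorem isTD : IsTD G T⁺ := by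
  have hT := H.td.rooted
  refine ⟨H.rooted, fun u v huv => ?_, fun v => ?_⟩
  · obtain ⟨t, ht, h1, h2⟩ := H.td.edge u v huv
    have key : ∀ a b, G.Adj a b → a ∈ T.bag t → b ∈ T.bag t → a ∈ M →
        ∃ n ∈ T⁺.nodes, a ∈ T⁺.bag n ∧ b ∈ T⁺.bag n := by
      intro a b hab ha hb haM
      have htr : T.InSubtree t r := by
        by_contra h
        exact H.top t ht h a haM ha
      refine ⟨t + N + 1, H.copy_mem htr, ?_, ?_⟩
      · rw [H.bag_copy]; exact ⟨ha, Or.inl haM⟩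
      · rw [H.bag_copy]
        refine ⟨hb, ?_⟩
        by_cases hbM : b ∈ M
        · exact Or.inl hbM
        · exact Or.inr ⟨hbM, a, haM, hab⟩
    by_cases hu : u ∈ M
    · exact key u v huv h1 h2 hu
    by_cases hv : v ∈ M
    · obtain ⟨n, hn, h3, h4⟩ := key v u huv.symm h2 h1 hv
      exact ⟨n, hn, h4, h3⟩
    · refine ⟨t, H.old_mem ht, ?_, ?_⟩ <;> rw [H.bag_old ht]
      · exact ⟨h1, hu⟩
      · exact ⟨h2, hv⟩
  · obtain ⟨q, hq, hvq, htop⟩ := H.td.top v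
    by_cases hvM : v ∈ M
    · have hin : ∀ x ∈ T.nodes, v ∈ T.bag x → T.InSubtree x r := fun x hx hvx => by
        by_contra h
        exact H.top x hx h v hvM hvx
      refine ⟨q + N + 1, H.copy_mem (hin q hq hvq), ?_, fun n hn hvn hne => ?_⟩
      · rw [H.bag_copy]; exact ⟨hvq, Or.inl hvM⟩
      rcases H.mem_cases hn with h' | rfl | ⟨x, rfl, hx⟩
      · rw [H.bag_old h'] at hvn; exact absurd hvM hvn.2
      · rw [H.bag_N] at hvn; exact absurd hvM hvn.1
      · refine ⟨fun h => H.copy_notMem x (h ▸ hT.1), ?_⟩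
        rw [H.bag_copy] at hvn
        obtain ⟨h1, h2⟩ := htop x hx.1 hvn.1 (by rintro rfl; exact hne rfl)
        have hxr : x ≠ r := by
          rintro rfl
          exact IsParent.not_inSubtree hT ⟨hx.1, h1, rfl⟩ (hin _ (hT.2.2.1 x hx.1) h2)
        rw [H.parent_copy hxr, H.bag_copy]
        exact ⟨h2, Or.inl hvM⟩
    · refine ⟨q, H.old_mem hq, by rw [H.bag_old hq]; exact ⟨hvq, hvM⟩, fun n hn hvn hne => ?_⟩
      rcases H.mem_cases hn with h' | rfl | ⟨x, rfl, hx⟩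
      · rw [H.bag_old h'] at hvn
        obtain ⟨h1, h2⟩ := htop n h' hvn.1 hne
        refine ⟨h1, ?_⟩
        rw [H.parent_old h', H.bag_old (hT.2.2.1 n h')]
        exact ⟨h2, hvM⟩
      · refine ⟨fun h => H.N_notMem (h ▸ hT.1), ?_⟩
        rw [H.bag_N] at hvn
        rw [H.parent_N, H.bag_old H.p_mem]
        exact ⟨H.nbhd_subset_p hvn, hvM⟩
      · refine ⟨fun h => H.copy_notMem x (h ▸ hT.1), ?_⟩
        rw [H.bag_copy] at hvn
        have hvB := hvn.2.resolve_left hvM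
        by_cases hxr : x = r
        · subst hxr
          rwa [H.parent_copy_r, H.bag_N]
        · rw [H.parent_copy hxr, H.bag_copy]
          exact ⟨(H.td.crossing (bag_subset_Vset hx.1 hvn.1) H.p_mem
            (H.not_inSubtree_p (hx.trans H.sub)) (H.nbhd_subset_p hvB)).2.2, hvn.2⟩

theorem skel : Skel S T T⁺ id id := by
  have hT := H.td.rooted
  refine ⟨fun x hx => H.old_mem hx, Function.injective_id.injOn, rfl, fun x hx => H.trace_old hx,
    fun x y hy => ⟨H.isParent_old hy.1, H.trace_old hy.1.1⟩, Function.injective_id.injOn,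
    fun x hx z hz => ?_, fun z hz => ?_⟩
  · have hSV : T⁺.Vset z ∩ S ⊆ T.bag x → T⁺.Vset z ∩ S ⊆ T⁺.bag x := fun h s hs => by
      rw [H.bag_old hx]
      exact ⟨h hs, fun hM => H.notMem_S hM hs.2⟩
    rcases H.isParent_cases hz with h | ⟨h1, h⟩ | ⟨h1, h⟩ | ⟨x', y', h1, h, hxy, -, -⟩
    · by_cases hzs : z ∈ T.sChildren S x
      · exact Or.inl ⟨z, hzs, rfl⟩
      · refine Or.inr (hSV fun s hs => ?_)
        by_contra hsx
        exact hzs ((mem_sChildren hT).2 ⟨h, s, hs.2, ((H.mem_Vset_old h.1).1 hs.1).1, hsx⟩)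
    · refine Or.inr (hSV ?_)
      change x = p at h
      rw [h, h1]
      refine (H.Vset_new_inter H.N_mem H.N_notMem).trans ?_
      rw [H.bag_N]
      exact H.nbhd_subset_p
    · exact absurd ((show x = N from h) ▸ hx) H.N_notMem
    · exact absurd ((show x = _ from h) ▸ hx) (H.copy_notMem _)
  · by_cases h : z ∈ T.nodes
    · exact Or.inl ⟨z, h, rfl⟩
    · exact Or.inr (Or.inr (H.Lset_new hz h))

theorem Vset_old_subset {x : ℕ} (hx : x ∈ T.nodes) : T⁺.Vset x ⊆ T.Vset x :=
  fun _ hv => ((H.mem_Vset_old hx).1 hv).1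

theorem Wset_subset {b : ℕ} (hb : b ∈ T.nodes) : T⁺.Wset S b ⊆ T.Wset S b := by
  have hT := H.td.rooted
  rintro v ⟨h1, y, hy, h2⟩
  have hsc := H.skel.sChildren_eq hT H.rooted hb
  simp only [id, Set.image_id'] at hsc
  rw [hsc] at hy
  rw [H.mem_Vset_old hy.1.1] at h2
  refine ⟨fun hvb => h1 ?_, y, hy, h2.1⟩
  rw [H.bag_old hb]
  refine ⟨hvb, fun hvM => h2.2 hvM ((hy.1.inSubtree hT).trans ?_)⟩
  by_contra hbc
  exact H.top b hb (fun h => hbc (h.trans H.sub)) v hvM hvb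

/-- In the first case `V_b` loses a vertex of `M`. In the second, `M` stays in `V_p` but no longer
lies below an `S`-child of `p`; this is why the weight also counts `Wset`. -/
theorem weight_lt [Finite V] (h : (∃ b, T.IsSBottom S b ∧ T.InSubtree b c ∧
    (M ∩ T.Vset b).Nonempty) ∨ (T.IsSBottom S p ∧ c ∈ T.sChildren S p)) :
    weight S T⁺ < weight S T := by
  have hT := H.td.rooted
  refine (H.skel.weight_le hT H.rooted
    (fun x hx => Set.ncard_le_ncard (H.Vset_old_subset hx.1) (Set.toFinite _))
    (fun x hx => Set.ncard_le_ncard (H.Wset_subset hx.1) (Set.toFinite _))).2 ?_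
  rcases h with ⟨b, hb, hbc, m, hm, hmb⟩ | ⟨hp, hc⟩
  · refine ⟨b, hb, Or.inl (Set.ncard_lt_ncard ⟨H.Vset_old_subset hb.1, fun h => ?_⟩
      (Set.toFinite _))⟩
    exact ((H.mem_Vset_old hb.1).1 (h hmb)).2 hm hbc
  · refine ⟨p, hp, Or.inr (Set.ncard_lt_ncard ⟨H.Wset_subset hp.1, fun h => ?_⟩
      (Set.toFinite _))⟩
    obtain ⟨m, hm, -⟩ := H.meets
    have hmc : m ∈ T.Vset c := Vset_mono H.sub (H.below hm)
    obtain ⟨-, y, hy, hmy⟩ := h ⟨H.notMem_p hm, c, hc, hmc⟩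
    have hsc := H.skel.sChildren_eq hT H.rooted hp.1
    simp only [id, Set.image_id'] at hsc
    rw [id_eq, hsc] at hy
    rw [H.mem_Vset_old hy.1.1] at hmy
    by_cases hyc : y = c
    · exact hmy.2 hm (by rw [hyc]; exact InSubtree.refl H.child.1)
    · exact H.notMem_p hm (H.td.mem_bag_of_children hy.1 H.child hyc hmy.1 hmc)

/-- A vertex of `M` connected to `S` outside `X` reaches a vertex of the bag of `p` outside `X`,
inside every set closed outside `X`. -/
theorem exists_mem_bag_p {X B : Set V} {a : V} (ha : ConnectedTo G S Xᶜ a) (haM : a ∈ M)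
    (haB : a ∈ B) (hB : ∀ x ∈ B, x ∉ X → ∀ y, y ∉ X → G.Adj x y → y ∈ B) :
    ∃ w, w ∈ B ∧ w ∉ X ∧ w ∈ T.bag p := by
  by_contra hcon
  push Not at hcon
  obtain ⟨s, hs, -, hsM, -⟩ := ha.exists_mem (B := M ∩ B) ⟨haM, haB⟩ fun x hx hxX y hyX hxy => by
    have hyB := hB x hx.2 hxX y hyX hxy
    refine ⟨H.comp.mem_of_adj hx.1 (fun hyp => ?_) hxy, hyB⟩
    exact hcon y hyB hyX hyp
  exact H.notMem_S hsM hs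

/-- Since `M` avoids `S`, a path from `a ∈ M` to `S` in `G - X` meets the bag of `p`; if `a ∈ N(M)`,
already `a` lies in that bag. If `a` were in `V_z`, the path could not leave `V_z` outside `X`, so
some vertex of `X_p \ X` would lie below `z`. It would occur both inside and outside the subtree at
`z` and thus in `X`. -/
theorem notMem_of_sep_below {X : Set V} {a : V} (ha : ConnectedTo G S Xᶜ a) (haX : a ∉ X)
    (haM : a ∈ M ∪ nbhd G M) {z : ℕ} (hz : T.InSubtree z c)
    (hzX : T.bag z = X ∨ z ≠ T.root ∧ T.bag (T.parent z) = X) : a ∉ T.Vset z := by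
  intro haz
  obtain ⟨w, hwz, hwX, hwp⟩ : ∃ w, w ∈ T.Vset z ∧ w ∉ X ∧ w ∈ T.bag p := by
    rcases haM with haM | haM
    · exact H.exists_mem_bag_p ha haM haz fun x hx hxX y _ hxy =>
        H.td.mem_Vset_of_adj_of_sep hzX hx hxX hxy
    · exact ⟨a, haz, haX, H.nbhd_subset_p haM⟩
  have := H.td.crossing hwz H.p_mem (H.not_inSubtree_p hz) hwp
  rcases hzX with h | h
  · exact hwX (h ▸ this.2.1)
  · exact hwX (h.2 ▸ this.2.2)

theorem ncard_nbhd [Finite V] (hc : ∀ t ∈ T.nodes, (T.bag t).ncard ≤ k + 1) :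
    (nbhd G M).ncard ≤ k := by
  obtain ⟨m, hm, hmr⟩ := H.meets
  have h1 : (nbhd G M).ncard < (T.bag r).ncard :=
    Set.ncard_lt_ncard ⟨H.nbhd_subset_r, fun h => (h hmr).1 hm⟩ (Set.toFinite _)
  have h2 := hc r H.sub.1
  omega

/-- The bag `N(M)` is not full, so only an edge between copies could be a new edge with equal full
bags. Such a bag would be an old one inside `M ∪ N(M)`, and would contain some `v ∈ M` because
`|N(M)| ≤ k`. The three neighbors of `v` given by `full_sep` also lie in `M ∪ N(M)`, and by
`notMem_of_sep_below` none of them is in `V_z` for a separating `z`, which lies below `r` as its bag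
or that of its parent contains `v`. -/
theorem full_edge [Finite V] (hW : WeaklySlim G S k T) {q n : ℕ} (h : T⁺.IsParent q n)
    (heq : T⁺.bag n = T⁺.bag q) (hf : T⁺.IsFull k n) :
    T.IsParent q n ∧ T.bag n = T.bag q ∧ T.IsFull k n ∧ T⁺.bag n = T.bag n := by
  have hT := H.td.rooted
  have hB := H.ncard_nbhd hW.card_le
  have hold : ∀ x ∈ T.nodes, ∀ A : Set V, A.ncard = k + 1 → A ⊆ T.bag x → T.bag x = A :=
    fun x hx A hA hsub => eq_of_full_subset hW.card_le hA hx hsub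
  rw [IsFull] at hf
  rcases H.isParent_cases h with h | ⟨rfl, rfl⟩ | ⟨rfl, rfl⟩ | ⟨x, y, rfl, rfl, hxy, hxr, hyr⟩
  · have hq := h.parent_mem hT
    have h1 := hold n h.1 _ hf (by rw [H.bag_old h.1]; exact Set.sdiff_subset)
    have h2 := hold q hq _ hf (by rw [heq, H.bag_old hq]; exact Set.sdiff_subset)
    exact ⟨h, h1.trans h2.symm, by rw [IsFull, h1, hf], h1.symm⟩
  · rw [H.bag_N] at hf; omega
  · rw [heq, H.bag_N] at hf; omega
  · exfalso
    have h1 := hold x hxy.1 _ hf (by rw [H.bag_copy]; exact Set.inter_subset_left)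
    have h2 := hold y hyr.1 _ hf (by rw [heq, H.bag_copy]; exact Set.inter_subset_left)
    have hsub : T.bag x ⊆ M ∪ nbhd G M := by
      rw [h1, H.bag_copy]; exact Set.inter_subset_right
    have hm : ∃ v ∈ T.bag x, v ∈ M := by
      by_contra hcon
      push Not at hcon
      have : T.bag x ⊆ nbhd G M := fun v hv => (hsub hv).resolve_left (hcon v hv)
      have := Set.ncard_le_ncard this (Set.toFinite _)
      rw [h1, hf] at this
      omega
    obtain ⟨v, hvx, hvM⟩ := hm
    obtain ⟨u, hu, hsep⟩ := hW.full_sep y x hxy (h1.trans h2.symm) (by rw [IsFull, h1, hf]) v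
      ⟨hvx, H.notMem_S hvM⟩
    obtain ⟨z, hz, hzX, hiff⟩ := hsep 0 1 (by decide)
    have hzr : T.InSubtree z r := by
      by_contra hzr
      rcases hzX with hzX | hzX
      · exact H.top z hz hzr v hvM (hzX ▸ hvx)
      · refine H.top _ (hT.2.2.1 z hz) (fun h => hzr (InSubtree.of_parent hz h)) v hvM ?_
        rw [hzX.2]; exact hvx
    have key : ∀ i, u i ∉ T.Vset z := fun i => by
      refine H.notMem_of_sep_below (hu i).2.2 (hu i).2.1 ?_ (hzr.trans H.sub) hzX
      by_cases hui : u i ∈ M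
      · exact Or.inl hui
      · exact Or.inr ⟨hui, v, hvM, (hu i).1⟩
    exact hiff ⟨fun h => absurd h (key 0), fun h => absurd h (key 1)⟩

theorem weaklySlim [Finite V] (hW : WeaklySlim G S k T) : WeaklySlim G S k T⁺ := by
  have hT := H.td.rooted
  have hB := H.ncard_nbhd hW.card_le
  refine { H.isTD with
    card_le := fun n hn => ?_, nested := fun q n h => ?_, step := fun q n h => ?_,
    nice := fun t ht => H.skel.niceAt hT H.rooted hW.nice ht,
    root_not_bottom := H.skel.root_not_isSBottom hT H.rooted hW.root_not_bottom,
    full_two := fun q n h heq hf => ?_, full_sep := fun q n h heq hf => ?_ }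
  · rcases H.mem_cases hn with h' | rfl | ⟨x, rfl, hx⟩
    · rw [H.bag_old h']
      exact (Set.ncard_le_ncard Set.sdiff_subset (Set.toFinite _)).trans (hW.card_le n h')
    · rw [H.bag_N]; omega
    · rw [H.bag_copy]
      exact (Set.ncard_le_ncard Set.inter_subset_left (Set.toFinite _)).trans (hW.card_le x hx.1)
  · rcases H.isParent_cases h with h | ⟨rfl, rfl⟩ | ⟨rfl, rfl⟩ | ⟨x, y, rfl, rfl, hxy, hxr, hyr⟩
    · rw [H.bag_old h.1, H.bag_old (h.parent_mem hT)]
      exact (hW.nested q n h).imp (fun h => Set.sdiff_subset_sdiff_left h)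
        (fun h => Set.sdiff_subset_sdiff_left h)
    · rw [H.bag_N, H.bag_old H.p_mem]
      exact Or.inl fun v hv => ⟨H.nbhd_subset_p hv, hv.1⟩
    · rw [H.bag_N, H.bag_copy]
      exact Or.inr fun v hv => ⟨H.nbhd_subset_r hv, Or.inr hv⟩
    · rw [H.bag_copy, H.bag_copy]
      exact (hW.nested y x hxy).imp (fun h => Set.inter_subset_inter_left _ h)
        (fun h => Set.inter_subset_inter_left _ h)
  · rcases H.isParent_cases h with h | ⟨rfl, rfl⟩ | ⟨rfl, rfl⟩ | ⟨x, y, rfl, rfl, hxy, hxr, hyr⟩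
    · rw [H.bag_old h.1, H.bag_old (h.parent_mem hT), (trace_eq_iff.1 (H.trace_old h.1)).1]
      refine (hW.step q n h).imp (fun h => ⟨h.1.anti ?_, h.2.anti ?_⟩)
        (fun h => ⟨h.1, Set.sdiff_subset_sdiff_left h.2⟩)
      · exact fun v hv => ⟨⟨hv.1.1.1, fun h => hv.1.2 ⟨h, hv.1.1.2⟩⟩, hv.2⟩
      · exact fun v hv => ⟨⟨hv.1.1.1, fun h => hv.1.2 ⟨h, hv.1.1.2⟩⟩, hv.2⟩
    · refine Or.inr ⟨H.Lset_new H.N_mem H.N_notMem, ?_⟩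
      rw [H.bag_N, H.bag_old H.p_mem]
      exact fun v hv => ⟨H.nbhd_subset_p hv, hv.1⟩
    · left
      rw [H.bag_N, H.bag_copy]
      refine ⟨fun v hv => ?_, fun v hv => ?_⟩
      · exact absurd (hv.1.1.2.resolve_left fun h => H.notMem_S h hv.2) hv.1.2
      · exact absurd ⟨H.nbhd_subset_r hv.1.1, Or.inr hv.1.1⟩ hv.1.2
    · refine (hW.step y x hxy).imp (fun h => ?_) fun h =>
        ⟨H.Lset_new (H.copy_mem hxr) (H.copy_notMem x), ?_⟩
      · rw [H.bag_copy, H.bag_copy]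
        exact ⟨h.1.anti fun v hv => ⟨⟨hv.1.1.1, fun h => hv.1.2 ⟨h, hv.1.1.2⟩⟩, hv.2⟩,
          h.2.anti fun v hv => ⟨⟨hv.1.1.1, fun h => hv.1.2 ⟨h, hv.1.1.2⟩⟩, hv.2⟩⟩
      · rw [H.bag_copy, H.bag_copy]
        exact Set.inter_subset_inter_left _ h.2
  · obtain ⟨h1, h2, h3, -⟩ := H.full_edge hW h heq hf
    have h4 := hW.full_two q n h1 h2 h3
    have h5 := H.skel.ncard_sChildren hT H.rooted h1.1
    have h6 := H.skel.ncard_sChildren hT H.rooted (h1.parent_mem hT)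
    simp only [id] at h5 h6
    rw [h5, h6]
    exact h4
  · obtain ⟨h1, h2, h3, h4⟩ := H.full_edge hW h heq hf
    rw [h4]
    intro v hv
    obtain ⟨u, hu, hsep⟩ := hW.full_sep q n h1 h2 h3 v hv
    refine ⟨u, hu, fun i j hij => ?_⟩
    obtain ⟨z, hz, hzX, hiff⟩ := hsep i j hij
    have hXM : ∀ w ∈ M, w ∉ T.bag n := fun w hw hwn => by
      rw [← h4, H.bag_old h1.1] at hwn
      exact hwn.2 hw
    have hbag : ∀ x ∈ T.nodes, T.bag x = T.bag n → T⁺.bag x = T.bag n := fun x hx h => by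
      rw [H.bag_old hx, h, ← H.bag_old h1.1, h4]
    refine ⟨z, H.old_mem hz, ?_, ?_⟩
    · refine hzX.imp (hbag z hz) fun h => ⟨h.1, ?_⟩
      rw [H.parent_old hz]
      exact hbag _ (hT.2.2.1 z hz) h.2
    -- Only a `u i` in `M` with `z` below `c` could be lost from `V_z`, but such a `u i` was not in
    -- `V_z` to begin with.
    · have key : ∀ i, u i ∈ T⁺.Vset z ↔ u i ∈ T.Vset z := fun i => by
        rw [H.mem_Vset_old hz]
        refine ⟨fun h => h.1, fun h => ⟨h, fun hM hzc => ?_⟩⟩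
        exact H.notMem_of_sep_below (hu i).2.2 (hu i).2.1 (Or.inl hM) hzc hzX h
      rwa [key, key]

theorem admissible [Finite V] {T₀ : RTD V} {σ : Set V × Set V × Set V}
    (hW : Admissible G S k T₀ σ T) : Admissible G S k T₀ σ T⁺ := by
  have hT := H.td.rooted
  refine { H.weaklySlim hW.toWeaklySlim with
    pred := fun τ τ' => (H.skel.directPred_iff hT H.rooted τ τ').trans (hW.pred τ τ'), mark := ?_ }
  obtain ⟨p', s, hps, hs, hσ, hnf⟩ := hW.mark
  refine ⟨p', s, H.isParent_old hps, H.skel.isSBottom_image hT H.rooted hs,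
    (H.trace_old hs.1).trans hσ, fun ⟨h1, h2⟩ => ?_⟩
  obtain ⟨-, h3, h4, -⟩ := H.full_edge hW.toWeaklySlim (H.isParent_old hps) h1 h2
  exact hnf ⟨h3, h4⟩

end IsHang

end RTD
namespace RTD

variable {V : Type*} {T : RTD V} {S : Set V} {G : SimpleGraph V} {k : ℕ}

/-! ### Replacing a vertex below a node -/

/-- Replace `v` by `D` in `A`. -/
def exchange (v : V) (D A : Set V) : Set V := {y | (y ∈ A ∧ y ≠ v) ∨ (v ∈ A ∧ y ∈ D)}

theorem exchange_mono {v : V} {D A B : Set V} (h : A ⊆ B) : exchange v D A ⊆ exchange v D B :=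
  fun _ hy => hy.imp (fun h' => ⟨h h'.1, h'.2⟩) (fun h' => ⟨h h'.1, h'.2⟩)

theorem exchange_of_notMem {v : V} {D A : Set V} (h : v ∉ A) : exchange v D A = A := by
  ext y
  refine ⟨fun hy => ?_, fun hy => Or.inl ⟨hy, by rintro rfl; exact h hy⟩⟩
  rcases hy with hy | hy
  · exact hy.1
  · exact absurd hy.1 h

theorem ncard_exchange_le [Finite V] {v : V} {D A : Set V} (hD : D.Subsingleton) :
    (exchange v D A).ncard ≤ A.ncard := by
  by_cases h : v ∈ A
  · have h1 : exchange v D A ⊆ (A \ {v}) ∪ D := fun y hy =>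
      hy.imp (fun h => ⟨h.1, h.2⟩) (fun h => h.2)
    have h2 := Set.ncard_le_ncard h1 (Set.toFinite _)
    have h3 := Set.ncard_union_le (A \ {v}) D
    have h4 := Set.ncard_sdiff_singleton_add_one h (Set.toFinite _)
    have h5 := Set.ncard_le_one_iff_subsingleton.2 hD
    omega
  · rw [exchange_of_notMem h]

open Classical in
/-- Replace `v` by `D` in all bags below `q`, and add `D` to the bag of `p`. -/
noncomputable def push (T : RTD V) (q p : ℕ) (v : V) (D : Set V) : RTD V :=
  { T with bag := fun x => if T.InSubtree x q then exchange v D (T.bag x)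
      else if x = p then T.bag x ∪ D else T.bag x }

/-- The nodes `q`, its parent `p` and the parent of `p` have the same bag, which is not full, `q` is
the only child of `p`, and `D` are the at most one neighbors of `v` strictly below `q`. -/
structure IsPush (G : SimpleGraph V) (S : Set V) (k : ℕ) (T : RTD V) (q p : ℕ) (v : V)
    (D : Set V) : Prop where
  td : IsTD G T
  child : T.IsParent p q
  only : ∀ c, T.IsParent p c → c = q
  bag_p : T.bag p = T.bag q
  bag_pp : T.bag (T.parent p) = T.bag q
  card : (T.bag q).ncard ≤ k
  mem : v ∈ T.bag q
  notMem_S : v ∉ S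
  D_eq : D = G.neighborSet v ∩ (T.Vset q \ T.bag q)
  D_sub : D.Subsingleton
  D_disj : D ⊆ Sᶜ

namespace IsPush

variable {q p : ℕ} {v : V} {D : Set V} (H : IsPush G S k T q p v D)
include H

local notation "T⁺" => T.push q p v D

theorem rooted : (T⁺).IsRootedTree := H.td.rooted

theorem bag_below {x : ℕ} (h : T.InSubtree x q) : (T⁺).bag x = exchange v D (T.bag x) := by
  simp [push, h]

theorem p_not_below : ¬ T.InSubtree p q := H.child.not_inSubtree H.td.rooted

theorem bag_p' : (T⁺).bag p = T.bag q ∪ D := by simp [push, H.p_not_below, H.bag_p]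

theorem bag_other {x : ℕ} (h : ¬ T.InSubtree x q) (hp : x ≠ p) : (T⁺).bag x = T.bag x := by
  simp [push, h, hp]

theorem bag_subset {x : ℕ} (h : ¬ T.InSubtree x q) : T.bag x ⊆ (T⁺).bag x := by
  by_cases hp : x = p
  · rw [hp, H.bag_p', H.bag_p]; exact Set.subset_union_left
  · rw [H.bag_other h hp]

theorem mem_D {u : V} (hu : u ∈ D) : G.Adj v u ∧ u ∈ T.Vset q ∧ u ∉ T.bag q := by
  rw [H.D_eq] at hu
  exact ⟨hu.1, hu.2.1, hu.2.2⟩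

theorem v_notMem_D : v ∉ D := fun h => (H.mem_D h).2.2 H.mem

theorem mem_par_of_mem_Vset {x : ℕ} (hx : T.InSubtree x q) (hne : x ≠ q) (hv : v ∈ T.Vset x) :
    v ∈ T.bag x ∧ v ∈ T.bag (T.parent x) :=
  (H.td.crossing hv H.child.1 (fun h => hne (hx.antisymm H.td.rooted h)) H.mem).2

theorem Vset_below {x : ℕ} (hx : T.InSubtree x q) :
    (T⁺).Vset x = exchange v D (T.Vset x) := by
  apply Set.Subset.antisymm
  · rintro w ⟨y, hy, hwy⟩
    have hy' : T.InSubtree y x := hy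
    rw [H.bag_below (hy'.trans hx)] at hwy
    exact exchange_mono (B := T.Vset x) (fun a (ha : a ∈ T.bag y) => ⟨y, hy', ha⟩) hwy
  · rintro w (⟨⟨y, hy, hwy⟩, hne⟩ | ⟨⟨y, hy, hvy⟩, hwD⟩)
    · exact ⟨y, hy, by rw [H.bag_below (hy.trans hx)]; exact Or.inl ⟨hwy, hne⟩⟩
    · exact ⟨y, hy, by rw [H.bag_below (hy.trans hx)]; exact Or.inr ⟨hvy, hwD⟩⟩

/-- Above `q` nothing changes as a set: `v` is still in the bag of `p`, and `D` was already below
`q`. -/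
theorem Vset_other {x : ℕ} (hx : x ∈ T.nodes) (hxq : ¬ T.InSubtree x q) :
    (T⁺).Vset x = T.Vset x := by
  have hT := H.td.rooted
  have hanc : ∀ y, T.InSubtree y x → T.InSubtree y q → T.InSubtree q x := fun y h1 h2 =>
    (h1.total hT h2).resolve_left hxq
  apply Set.Subset.antisymm
  · rintro w ⟨y, hy, hwy⟩
    have hy' : T.InSubtree y x := hy
    by_cases hyq : T.InSubtree y q
    · rw [H.bag_below hyq] at hwy
      rcases hwy with hwy | hwy
      · exact ⟨y, hy', hwy.1⟩
      · exact Vset_mono (hanc y hy' hyq) (H.mem_D hwy.2).2.1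
    · by_cases hyp : y = p
      · subst hyp
        rw [H.bag_p', ← H.bag_p] at hwy
        rcases hwy with hwy | hwy
        · exact ⟨y, hy', hwy⟩
        · exact Vset_mono ((H.child.inSubtree hT).trans hy') (H.mem_D hwy).2.1
      · rw [H.bag_other hyq hyp] at hwy
        exact ⟨y, hy', hwy⟩
  · rintro w ⟨y, hy, hwy⟩
    by_cases hyq : T.InSubtree y q
    · by_cases hwv : w = v
      · subst hwv
        have hqx := hanc y hy hyq
        have hne : q ≠ x := by rintro rfl; exact hxq hqx
        have hpx := (hqx.parent_of_ne hT hne).2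
        rw [H.child.2.2] at hpx
        exact ⟨p, hpx, by rw [H.bag_p']; exact Or.inl H.mem⟩
      · exact ⟨y, hy, by rw [H.bag_below hyq]; exact Or.inl ⟨hwy, hwv⟩⟩
    · exact ⟨y, hy, H.bag_subset hyq hwy⟩

theorem mem_exchange_S {A : Set V} {s : V} (hs : s ∈ S) : s ∈ exchange v D A ↔ s ∈ A := by
  refine ⟨fun h => ?_, fun h => Or.inl ⟨h, by rintro rfl; exact H.notMem_S hs⟩⟩
  rcases h with h | h
  · exact h.1
  · exact absurd hs (H.D_disj h.2)

theorem mem_bag_S {x : ℕ} {s : V} (hs : s ∈ S) : s ∈ (T⁺).bag x ↔ s ∈ T.bag x := by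
  by_cases hxq : T.InSubtree x q
  · rw [H.bag_below hxq, H.mem_exchange_S hs]
  · by_cases hxp : x = p
    · subst hxp
      rw [H.bag_p', H.bag_p]
      exact ⟨fun h => h.resolve_right fun h => H.D_disj h hs, Or.inl⟩
    · rw [H.bag_other hxq hxp]

theorem mem_Vset_S {x : ℕ} (hx : x ∈ T.nodes) {s : V} (hs : s ∈ S) :
    s ∈ (T⁺).Vset x ↔ s ∈ T.Vset x := by
  by_cases hxq : T.InSubtree x q
  · rw [H.Vset_below hxq, H.mem_exchange_S hs]
  · rw [H.Vset_other hx hxq]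

theorem trace_eq {x : ℕ} (hx : x ∈ T.nodes) : (T⁺).trace S x = T.trace S x := by
  refine trace_eq_of_inter ?_ ?_ <;> ext s
  · exact and_congr_left fun hs => H.mem_Vset_S hx hs
  · exact and_congr_left fun hs => H.mem_bag_S hs

theorem isTD : IsTD G (T⁺) := by
  have hT := H.td.rooted
  refine ⟨H.rooted, fun a b hab => ?_, fun w => ?_⟩
  · obtain ⟨t, ht, ha, hb⟩ := H.td.edge a b hab
    by_cases htq : T.InSubtree t q
    -- Every neighbor of `v` occurring below `q` is in `X_q` or in `D`, so the new bag of `p` covers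
    -- the edges that lose `v` below `q`.
    · have key : ∀ b, b ∈ T.bag t → G.Adj v b → ∃ n ∈ (T⁺).nodes,
          v ∈ (T⁺).bag n ∧ b ∈ (T⁺).bag n := fun b hb hvb => by
        refine ⟨p, H.child.parent_mem hT, ?_⟩
        rw [H.bag_p']
        refine ⟨Or.inl H.mem, ?_⟩
        by_cases hbq : b ∈ T.bag q
        · exact Or.inl hbq
        · exact Or.inr (by rw [H.D_eq]; exact ⟨hvb, ⟨t, htq, hb⟩, hbq⟩)
      by_cases hav : a = v
      · subst hav; exact key b hb hab
      by_cases hbv : b = v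
      · subst hbv
        obtain ⟨n, hn, h1, h2⟩ := key a ha hab.symm
        exact ⟨n, hn, h2, h1⟩
      · refine ⟨t, ht, ?_⟩
        rw [H.bag_below htq]
        exact ⟨Or.inl ⟨ha, hav⟩, Or.inl ⟨hb, hbv⟩⟩
    · exact ⟨t, ht, H.bag_subset htq ha, H.bag_subset htq hb⟩
  · obtain ⟨r, hr, hwr, htop⟩ := H.td.top w
    by_cases hwD : w ∈ D
    -- The vertex of `D` now has top node `p`. Below `q`, either `v` occurs below `x` and the parent
    -- of `x` contained `v`, hence now contains `D`, or the bag covering the edge from `v` to `w`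
    -- lies outside the subtree at `x`, so `w` crosses to the parent.
    · obtain ⟨hvw, hwV, hwq⟩ := H.mem_D hwD
      refine ⟨p, H.child.parent_mem hT, by rw [H.bag_p']; exact Or.inr hwD,
        fun x hx hwx hxp => ?_⟩
      have hxq : T.InSubtree x q := by
        by_contra hxq
        rw [H.bag_other hxq hxp] at hwx
        exact hwq (H.td.crossing hwV hx hxq hwx).2.1
      by_cases hne : x = q
      · rw [hne]
        refine ⟨H.child.2.1, ?_⟩
        change w ∈ (T⁺).bag (T.parent q)
        rw [H.child.2.2, H.bag_p']
        exact Or.inr hwD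
      · obtain ⟨hxr, hpar⟩ := hxq.parent_of_ne hT hne
        refine ⟨hxr, ?_⟩
        change w ∈ (T⁺).bag (T.parent x)
        rw [H.bag_below hpar]
        by_cases hvx : v ∈ T.Vset x
        · exact Or.inr ⟨(H.mem_par_of_mem_Vset hxq hne hvx).2, hwD⟩
        · left
          refine ⟨?_, by rintro rfl; exact H.v_notMem_D hwD⟩
          rw [H.bag_below hxq] at hwx
          have hwx' : w ∈ T.bag x := by
            rcases hwx with h | h
            · exact h.1
            · exact absurd (bag_subset_Vset (T := T) hx h.1) hvx
          obtain ⟨z, hz, hvz, hwz⟩ := H.td.edge v w hvw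
          have hzx : ¬ T.InSubtree z x := fun h => hvx ⟨z, h, hvz⟩
          exact (H.td.crossing (bag_subset_Vset (T := T) hx hwx') hz hzx hwz).2.2
    · by_cases hwv : w = v
      · subst hwv
        have hrq : ¬ T.InSubtree r q := fun hrq => by
          have hpr : T.InSubtree p r := inSubtree_of_top hT
            (A := {x | x ∈ T.nodes ∧ w ∈ T.bag x}) (fun x hx => hx.1)
            (fun x hx hxr => ⟨(htop x hx.1 hx.2 hxr).1, hT.2.2.1 x hx.1,
              (htop x hx.1 hx.2 hxr).2⟩)
            ⟨H.child.parent_mem hT, by rw [H.bag_p]; exact H.mem⟩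
          exact H.p_not_below (hpr.trans hrq)
        refine ⟨r, hr, H.bag_subset hrq hwr, fun x hx hwx hxr => ?_⟩
        have hxq : ¬ T.InSubtree x q := fun hxq => by
          rw [H.bag_below hxq] at hwx
          rcases hwx with h | h
          · exact h.2 rfl
          · exact hwD h.2
        have hwx' : w ∈ T.bag x := by
          by_cases hxp : x = p
          · rw [hxp, H.bag_p]; exact H.mem
          · rwa [H.bag_other hxq hxp] at hwx
        obtain ⟨h1, h2⟩ := htop x hx hwx' hxr
        exact ⟨h1, H.bag_subset (fun h => hxq (InSubtree.of_parent hx h)) h2⟩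
      · have key : ∀ x, w ∈ (T⁺).bag x ↔ w ∈ T.bag x := fun x => by
          by_cases hxq : T.InSubtree x q
          · rw [H.bag_below hxq]
            refine ⟨fun h => ?_, fun h => Or.inl ⟨h, hwv⟩⟩
            rcases h with h | h
            · exact h.1
            · exact absurd h.2 hwD
          · by_cases hxp : x = p
            · subst hxp
              rw [H.bag_p', H.bag_p]
              exact ⟨fun h => h.resolve_right hwD, Or.inl⟩
            · rw [H.bag_other hxq hxp]
        refine ⟨r, hr, (key r).2 hwr, fun x hx hwx hxr => ?_⟩
        obtain ⟨h1, h2⟩ := htop x hx ((key x).1 hwx) hxr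
        exact ⟨h1, (key _).2 h2⟩

theorem skel : Skel S T (T⁺) id id := by
  refine ⟨fun x hx => hx, Function.injective_id.injOn, rfl, fun x hx => H.trace_eq hx,
    fun x y hy => ⟨hy.1, H.trace_eq hy.1.1⟩, Function.injective_id.injOn,
    fun x hx z hz => ?_, fun z hz => Or.inl ⟨z, hz, rfl⟩⟩
  have hz' : T.IsParent x z := hz
  by_cases hzs : z ∈ T.sChildren S x
  · exact Or.inl ⟨z, hzs, rfl⟩
  · refine Or.inr fun s hs => (H.mem_bag_S hs.2).2 ?_
    by_contra hsx
    exact hzs ((mem_sChildren H.td.rooted).2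
      ⟨hz', s, hs.2, (H.mem_Vset_S hz'.1 hs.2).1 hs.1, hsx⟩)

theorem sChildren_eq {x : ℕ} (hx : x ∈ T.nodes) : (T⁺).sChildren S x = T.sChildren S x := by
  have := H.skel.sChildren_eq H.td.rooted H.rooted hx
  simpa using this

theorem Wset_subset {b : ℕ} (hb : b ∈ T.nodes) : (T⁺).Wset S b ⊆ T.Wset S b := by
  have hT := H.td.rooted
  rintro w ⟨h1, c, hc, h2⟩
  rw [H.sChildren_eq hb] at hc
  by_cases hbq : T.InSubtree b q
  · have hcq := (hc.1.inSubtree hT).trans hbq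
    rw [H.bag_below hbq] at h1
    rw [H.Vset_below hcq] at h2
    rcases h2 with h2 | h2
    · exact ⟨fun h => h1 (Or.inl ⟨h, h2.2⟩), c, hc, h2.1⟩
    · exact absurd (Or.inr ⟨H.td.mem_bag_of_anc (Vset_mono (hc.1.inSubtree hT) h2.1) hbq H.mem,
        h2.2⟩) h1
  · refine ⟨fun h => h1 (H.bag_subset hbq h), c, hc, ?_⟩
    by_cases hcq : T.InSubtree c q
    · rw [H.Vset_below hcq] at h2
      rcases h2 with h2 | h2
      · exact h2.1
      · have hcq' : c = q := by
          by_contra hne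
          have := (hcq.parent_of_ne hT hne).2
          rw [hc.1.2.2] at this
          exact hbq this
        rw [hcq']
        exact (H.mem_D h2.2).2.1
    · rwa [H.Vset_other hc.1.1 hcq] at h2

/-- The set `V_b = V_q` loses `v` and gains nothing, since `D` was already contained in it. -/
theorem weight_lt [Finite V] {b : ℕ} (hb : T.IsSBottom S b) (hbq : T.InSubtree b q)
    (hV : T.Vset b = T.Vset q) : weight S (T⁺) < weight S T := by
  have hle : ∀ x ∈ T.nodes, ((T⁺).Vset x).ncard ≤ (T.Vset x).ncard := fun x hx => by
    by_cases hxq : T.InSubtree x q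
    · rw [H.Vset_below hxq]
      exact ncard_exchange_le H.D_sub
    · rw [H.Vset_other hx hxq]
  refine (H.skel.weight_le H.td.rooted H.rooted (fun x hx => hle x hx.1)
    (fun x hx => Set.ncard_le_ncard (H.Wset_subset hx.1) (Set.toFinite _))).2 ⟨b, hb, Or.inl ?_⟩
  rw [id_eq, H.Vset_below hbq, hV]
  have hvV : v ∈ T.Vset q := bag_subset_Vset H.child.1 H.mem
  refine Set.ncard_lt_ncard ⟨?_, fun h => ?_⟩ (Set.toFinite _)
  · rintro w (hw | hw)
    · exact hw.1
    · exact (H.mem_D hw.2).2.1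
  · rcases h hvV with h | h
    · exact h.2 rfl
    · exact H.v_notMem_D h.2

theorem mem_level_below [Finite V] (hc : ∀ t ∈ T.nodes, (T.bag t).ncard ≤ k + 1) {X : Set V}
    (hX : X.ncard = k + 1) {x y : ℕ} (hx : x ∈ T.level X) (hy : y ∈ T.level X)
    (hxq : T.InSubtree x q) : T.InSubtree y q := by
  by_contra hyq
  have := (H.td.mem_level_of_between hc hX hx hy hxq hyq).2.1.2
  have h2 := H.card
  rw [this, hX] at h2
  omega

/-- Otherwise `v` would have three pairwise separated neighbors. Since `q` is not full, all nodes
with this full bag lie below `q`, and so do the separating nodes. At most one of the three neighbors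
can avoid `V_q \ X_q`, so at least two would belong to `D`. -/
theorem notMem_full_edge [Finite V] (hW : WeaklySlim G S k T) {y x : ℕ} (h : T.IsParent y x)
    (heq : T.bag x = T.bag y) (hf : T.IsFull k x) (hx : T.InSubtree x q) : v ∉ T.bag x := by
  intro hvx
  have hT := H.td.rooted
  obtain ⟨u, hu, hsep⟩ := hW.full_sep y x h heq hf v ⟨hvx, H.notMem_S⟩
  -- A separating `z` lies strictly below `q`. A vertex of `V_z` outside `V_q \ X_q` would be in
  -- `X_q`, hence cross the edge above `z` and lie in the full bag. So two neighbors outside `V_q \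
  -- X_q` are both outside `V_z`.
  have hout : ∀ i j, i ≠ j → u i ∉ T.Vset q \ T.bag q → u j ∈ T.Vset q \ T.bag q := by
    intro i j hij hi
    by_contra hj
    obtain ⟨z, hz, hzX, hiff⟩ := hsep i j hij
    have hzq : T.InSubtree z q ∧ z ≠ q := by
      rcases hzX with hzX | hzX
      · refine ⟨H.mem_level_below hW.card_le hf ⟨h.1, rfl⟩ ⟨hz, hzX⟩ hx, ?_⟩
        rintro rfl
        have := H.card
        rw [hzX, hf] at this
        omega
      · have hpq := H.mem_level_below hW.card_le hf ⟨h.1, rfl⟩ ⟨hT.2.2.1 z hz, hzX.2⟩ hx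
        refine ⟨InSubtree.of_parent hz hpq, ?_⟩
        rintro rfl
        rw [H.child.2.2] at hpq
        exact H.p_not_below hpq
    have key : ∀ i, u i ∉ T.Vset q \ T.bag q → u i ∉ T.Vset z := fun i hi hiz => by
      have hiq : u i ∈ T.bag q := by
        by_contra h
        exact hi ⟨Vset_mono hzq.1 hiz, h⟩
      have := H.td.crossing hiz H.child.1 (fun h => hzq.2 (hzq.1.antisymm hT h)) hiq
      rcases hzX with hzX | hzX
      · exact (hu i).2.1 (hzX ▸ this.2.1)
      · exact (hu i).2.1 (hzX.2 ▸ this.2.2)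
    exact hiff ⟨fun h => absurd h (key i hi), fun h => absurd h (key j hj)⟩
  have hin : ∀ i j, i ≠ j → u i ∈ T.Vset q \ T.bag q → u j ∈ T.Vset q \ T.bag q → False := by
    intro i j hij hi hj
    have h1 : u i ∈ D := by rw [H.D_eq]; exact ⟨(hu i).1, hi⟩
    have h2 : u j ∈ D := by rw [H.D_eq]; exact ⟨(hu j).1, hj⟩
    obtain ⟨z, -, -, hiff⟩ := hsep i j hij
    exact hiff (by rw [H.D_sub h1 h2])
  by_cases h0 : u 0 ∈ T.Vset q \ T.bag q
  · by_cases h1 : u 1 ∈ T.Vset q \ T.bag q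
    · exact hin 0 1 (by decide) h0 h1
    · exact hin 0 2 (by decide) h0 (hout 1 2 (by decide) h1)
  · exact hin 1 2 (by decide) (hout 0 1 (by decide) h0) (hout 0 2 (by decide) h0)

/-- Replacing `v` by at most one vertex enlarges no bag, so equal full bags below `q` were equal and
full before, and they avoid `v`. The bag of `p` may become full, but its neighbors in the tree, `q`
and the parent of `p`, remain non-full. -/
theorem full_edge [Finite V] (hW : WeaklySlim G S k T) {y x : ℕ} (h : T.IsParent y x)
    (heq : (T⁺).bag x = (T⁺).bag y) (hf : (T⁺).IsFull k x) :
    T.bag x = T.bag y ∧ T.IsFull k x ∧ (T⁺).bag x = T.bag x := by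
  have hT := H.td.rooted
  have hy := h.parent_mem hT
  rw [IsFull] at hf
  by_cases hxq : T.InSubtree x q
  · by_cases hne : x = q
    · subst hne
      rw [H.bag_below hxq] at hf
      have h1 := ncard_exchange_le (v := v) (A := T.bag x) H.D_sub
      have h2 := H.card
      omega
    · have hyq := (hxq.parent_of_ne hT hne).2
      rw [h.2.2] at hyq
      have h1 : (T.bag x).ncard = k + 1 := by
        refine le_antisymm (hW.card_le x h.1) ?_
        rw [← hf, H.bag_below hxq]
        exact ncard_exchange_le H.D_sub
      have h2 : (T.bag y).ncard = k + 1 := by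
        refine le_antisymm (hW.card_le y hy) ?_
        rw [← hf, heq, H.bag_below hyq]
        exact ncard_exchange_le H.D_sub
      have h3 : T.bag x = T.bag y := by
        rcases hW.nested y x h with h3 | h3
        · exact (eq_of_full_subset hW.card_le h1 hy h3).symm
        · exact eq_of_full_subset hW.card_le h2 h.1 h3
      refine ⟨h3, h1, ?_⟩
      rw [H.bag_below hxq, exchange_of_notMem (H.notMem_full_edge hW h h3 h1 hxq)]
  · have hyq : ¬ T.InSubtree y q := fun hyq => hxq ((h.inSubtree hT).trans hyq)
    have hyp : y ≠ p := by
      rintro rfl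
      exact hxq (by rw [H.only x h]; exact InSubtree.refl H.child.1)
    rw [heq, H.bag_other hyq hyp] at hf
    have hxp : x ≠ p := by
      rintro rfl
      have h1 := H.card
      rw [← H.bag_pp, h.2.2, hf] at h1
      omega
    rw [H.bag_other hxq hxp, H.bag_other hyq hyp] at heq
    exact ⟨heq, by rw [IsFull, heq, hf], H.bag_other hxq hxp⟩

theorem weaklySlim [Finite V] (hW : WeaklySlim G S k T) : WeaklySlim G S k (T⁺) := by
  have hT := H.td.rooted
  have hD := Set.ncard_le_one_iff_subsingleton.2 H.D_sub
  refine { H.isTD with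
    card_le := fun n hn => ?_, nested := fun y x h => ?_, step := fun y x h => ?_,
    nice := fun t ht => H.skel.niceAt hT H.rooted hW.nice ht,
    root_not_bottom := H.skel.root_not_isSBottom hT H.rooted hW.root_not_bottom,
    full_two := fun y x h heq hf => ?_, full_sep := fun y x h heq hf => ?_ }
  · by_cases hnq : T.InSubtree n q
    · rw [H.bag_below hnq]
      exact (ncard_exchange_le H.D_sub).trans (hW.card_le n hn)
    · by_cases hnp : n = p
      · rw [hnp, H.bag_p']
        have h1 := Set.ncard_union_le (T.bag q) D
        have h2 := H.card
        omega
      · rw [H.bag_other hnq hnp]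
        exact hW.card_le n hn
  · have h' : T.IsParent y x := h
    by_cases hxq : T.InSubtree x q
    · by_cases hne : x = q
      · subst hne
        obtain rfl := h'.unique H.child
        left
        rw [H.bag_below hxq, H.bag_p']
        exact fun w hw => hw.imp (fun h => h.1) (fun h => h.2)
      · have hyq := (hxq.parent_of_ne hT hne).2
        rw [h'.2.2] at hyq
        rw [H.bag_below hxq, H.bag_below hyq]
        exact (hW.nested y x h').imp exchange_mono exchange_mono
    · have hyq : ¬ T.InSubtree y q := fun hyq => hxq ((h'.inSubtree hT).trans hyq)
      have hyp : y ≠ p := by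
        rintro rfl
        exact hxq (by rw [H.only x h']; exact InSubtree.refl H.child.1)
      by_cases hxp : x = p
      · subst hxp
        right
        rw [H.bag_p', H.bag_other hyq hyp, ← h'.2.2, H.bag_pp]
        exact Set.subset_union_left
      · rw [H.bag_other hxq hxp, H.bag_other hyq hyp]
        exact hW.nested y x h'
  · have h' : T.IsParent y x := h
    have hsub : ∀ a b, ((T⁺).bag a \ (T⁺).bag b) ∩ S ⊆ (T.bag a \ T.bag b) ∩ S :=
      fun a b s hs => ⟨⟨(H.mem_bag_S hs.2).1 hs.1.1, fun h => hs.1.2 ((H.mem_bag_S hs.2).2 h)⟩,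
        hs.2⟩
    rcases hW.step y x h' with h1 | ⟨h1, h2⟩
    · exact Or.inl ⟨h1.1.anti (hsub x y), h1.2.anti (hsub y x)⟩
    · by_cases hxp : x = p
      · have heq : T.bag x = T.bag y := by rw [← h'.2.2, hxp, H.bag_p, H.bag_pp]
        left
        refine ⟨Set.Subsingleton.anti ?_ (hsub x y), Set.Subsingleton.anti ?_ (hsub y x)⟩ <;>
          simp [heq]
      · right
        rw [(trace_eq_iff.1 (H.trace_eq h'.1)).1]
        refine ⟨h1, ?_⟩
        by_cases hxq : T.InSubtree x q
        · by_cases hne : x = q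
          · subst hne
            obtain rfl := h'.unique H.child
            rw [H.bag_below hxq, H.bag_p']
            exact fun w hw => hw.imp (fun h => h.1) (fun h => h.2)
          · have hyq := (hxq.parent_of_ne hT hne).2
            rw [h'.2.2] at hyq
            rw [H.bag_below hxq, H.bag_below hyq]
            exact exchange_mono h2
        · have hyq : ¬ T.InSubtree y q := fun hyq => hxq ((h'.inSubtree hT).trans hyq)
          rw [H.bag_other hxq hxp]
          exact h2.trans (H.bag_subset hyq)
  · have h' : T.IsParent y x := h
    obtain ⟨h2, h3, -⟩ := H.full_edge hW h' heq hf
    rw [H.sChildren_eq h'.1, H.sChildren_eq (h'.parent_mem hT)]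
    exact hW.full_two y x h' h2 h3
  · have h' : T.IsParent y x := h
    obtain ⟨h2, h3, h4⟩ := H.full_edge hW h' heq hf
    rw [h4]
    intro w hw
    obtain ⟨u, hu, hsep⟩ := hW.full_sep y x h' h2 h3 w hw
    refine ⟨u, hu, fun i j hij => ?_⟩
    obtain ⟨z, hz, hzX, hiff⟩ := hsep i j hij
    have hvX : ∀ n ∈ T.level (T.bag x), T.InSubtree n q → v ∉ T.bag x := fun n hn hnq =>
      H.notMem_full_edge hW h' h2 h3 (H.mem_level_below hW.card_le h3 hn ⟨h'.1, rfl⟩ hnq)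
    have hnotk : ∀ n, (T.bag n).ncard ≤ k → T.bag n ≠ T.bag x := fun n hn h => by
      rw [h, h3] at hn; omega
    have hlev : ∀ n ∈ T.nodes, T.bag n = T.bag x → (T⁺).bag n = T.bag x := fun n hn hnx => by
      by_cases hnq : T.InSubtree n q
      · rw [H.bag_below hnq, hnx, exchange_of_notMem (hvX n ⟨hn, hnx⟩ hnq)]
      · rw [H.bag_other hnq, hnx]
        rintro rfl
        exact hnotk n (H.bag_p ▸ H.card) hnx
    have hV : (T⁺).Vset z = T.Vset z := by
      by_cases hzq : T.InSubtree z q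
      · have hne : z ≠ q := by
          rintro rfl
          rcases hzX with hzX | hzX
          · exact hnotk _ H.card hzX
          · rw [H.child.2.2] at hzX
            exact hnotk p (H.bag_p ▸ H.card) hzX.2
        rw [H.Vset_below hzq, exchange_of_notMem]
        intro hvz
        have h5 := H.mem_par_of_mem_Vset hzq hne hvz
        rcases hzX with hzX | hzX
        · exact hvX z ⟨hz, hzX⟩ hzq (hzX ▸ h5.1)
        · exact hvX _ ⟨hT.2.2.1 z hz, hzX.2⟩ (hzq.parent_of_ne hT hne).2 (hzX.2 ▸ h5.2)
      · exact H.Vset_other hz hzq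
    refine ⟨z, hz, hzX.imp (hlev z hz) fun h => ⟨h.1, hlev _ (hT.2.2.1 z hz) h.2⟩, ?_⟩
    rwa [hV]

theorem admissible [Finite V] {T₀ : RTD V} {σ : Set V × Set V × Set V}
    (hW : Admissible G S k T₀ σ T) : Admissible G S k T₀ σ (T⁺) := by
  have hT := H.td.rooted
  refine { H.weaklySlim hW.toWeaklySlim with
    pred := fun τ τ' => (H.skel.directPred_iff hT H.rooted τ τ').trans (hW.pred τ τ'), mark := ?_ }
  obtain ⟨p', s, hps, hs, hσ, hnf⟩ := hW.mark
  refine ⟨p', s, hps, H.skel.isSBottom_image hT H.rooted hs,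
    (H.trace_eq hs.1).trans hσ, fun ⟨h1, h2⟩ => ?_⟩
  obtain ⟨h3, h4, -⟩ := H.full_edge hW.toWeaklySlim hps h1 h2
  exact hnf ⟨h3, h4⟩

end IsPush

end RTD
namespace RTD

variable {V : Type*} {T : RTD V} {S : Set V} {G : SimpleGraph V} {k : ℕ}

/-! ### Consequences of minimality -/

/-- No `F`-component outside `X` meets `W`, and every vertex of `X \ S` has a neighbor in `S` or two
neighbors in `W \ X`. -/
def Tight (G : SimpleGraph V) (S W X : Set V) : Prop :=
  (∀ C, IsFComponent G S Xᶜ C → C ∩ W = ∅) ∧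
  ∀ v ∈ X \ S, (G.neighborSet v ∩ (W \ X)).Subsingleton → ¬ G.neighborSet v ∩ (W \ X) ⊆ Sᶜ

/-- A vertex of `M ∩ W` outside `X` has its entire component of `G - X` inside `M ∩ W`, giving an
`F`-component that meets `W`. So `M ∩ W ⊆ X`, and then a vertex of `M ∩ W` has no neighbor at all in
`W \ X`, against the second half of tightness. -/
theorem Tight.notMem_of_nbhd {W X M : Set V} (h : Tight G S W X) (hM : M ⊆ Sᶜ)
    (hN : nbhd G M ∩ W ⊆ X) (hW : ∀ a ∈ W, ∀ b, G.Adj a b → a ∉ X → b ∈ W) {v : V} (hv : v ∈ M) :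
    v ∉ W := by
  have key : ∀ m ∈ M, m ∈ W → m ∈ X := by
    intro m hm hmW
    by_contra hmX
    obtain ⟨C, hC, hmC⟩ := exists_isComponent (G := G) (W := Xᶜ) hmX
    have hCM : C ⊆ M ∩ W := hC.subset_of_closed hmC ⟨hm, hmW⟩ fun x hx hxC y hyC hxy => by
      have hyW := hW x hx.2 y hxy (hC.subset hxC)
      refine ⟨?_, hyW⟩
      by_contra hyM
      exact hC.subset hyC (hN ⟨⟨hyM, x, hx.1, hxy⟩, hyW⟩)
    have hF : IsFComponent G S Xᶜ C := ⟨hC, Set.eq_empty_iff_forall_notMem.2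
      fun x hx => hM (hCM hx.1).1 hx.2⟩
    have : m ∈ C ∩ W := ⟨hmC, hmW⟩
    rw [h.1 C hF] at this
    exact this
  intro hvW
  have hvX := key v hv hvW
  have hem : G.neighborSet v ∩ (W \ X) = ∅ := Set.eq_empty_iff_forall_notMem.2 fun u hu => by
    by_cases huM : u ∈ M
    · exact hu.2.2 (key u huM hu.2.1)
    · exact hu.2.2 (hN ⟨⟨huM, v, hv, hu.1⟩, hu.2.1⟩)
  exact h.2 v ⟨hvX, hM hv⟩ (by rw [hem]; exact Set.subsingleton_empty)
    (by rw [hem]; exact Set.empty_subset _)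

variable {T₀ : RTD V} {σ : Set V × Set V × Set V}

/-- Otherwise hanging the component at `b` itself would decrease `Wset` at `b`. -/
theorem IsMinimal.disjoint_sChild [Finite V] (h : IsMinimal G S k T₀ σ T) {b c : ℕ}
    (hb : T.IsSBottom S b) (hc : c ∈ T.sChildren S b) {C : Set V}
    (hC : IsFComponent G S (T.bag b)ᶜ C) : C ∩ T.Vset c = ∅ := by
  by_contra hne
  obtain ⟨r, N, H⟩ := exists_isHang h.1.toIsTD hc.1 hC (Set.nonempty_iff_ne_empty.2 hne)
  exact absurd (H.weight_lt (Or.inr ⟨hb, hc⟩)) (Nat.not_lt.2 (h.2 _ (H.admissible h.1)))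

/-- Three copies of `Y` are what `IsPush` needs: the lowest is the node below which `v` is replaced,
the middle one receives the neighbor of `v` and may become full, and the highest shields `p` from
it. -/
theorem isChains_single {s p : ℕ} (hps : T.IsParent p s) {Y : Set V}
    (hn : ∀ p t, T.IsParent p t → T.bag t ⊆ T.bag p ∨ T.bag p ⊆ T.bag t)
    (hYk : Y.ncard ≤ k) (hYs : Y ⊆ T.bag s) (hYS : Y ∩ S = T.bag s ∩ S)
    (hY : Y = T.bag s ∨ T.bag p ⊆ Y) :
    IsChains S k T (fun x => if x = s then 3 else 0)
      (fun x i => if x = s ∧ 0 < i then Y else T.bag x) := by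
  refine ⟨by simp [Ne.symm hps.2.1], fun c => by simp, fun p' c h => ?_, fun c hc i h0 hi => ?_,
    fun p' c h => Or.inl fun i hi => ?_⟩
  · by_cases hcs : c = s
    · subst hcs
      obtain rfl := h.unique hps
      simp only [if_true, true_and]
      rcases hY with rfl | hY
      · rcases hn _ _ h with hn | hn
        · left; simpa using hn
        · right; simpa using hn
      · right
        refine ⟨fun i hi => ?_, by simpa using hY⟩
        rcases Nat.eq_zero_or_pos i with rfl | h0
        · simpa using hYs
        · simp [h0]
    · simp only [hcs, if_false, false_and]
      exact (hn p' c h).imp (fun h' => ⟨fun i hi => absurd hi (Nat.not_lt_zero i), h'⟩)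
        (fun h' => ⟨fun i hi => absurd hi (Nat.not_lt_zero i), h'⟩)
  · by_cases hcs : c = s
    · simp [hcs, h0, hYk]
    · simp only [hcs, if_false] at hi
      omega
  · by_cases hcs : c = s ∧ 0 < i
    · simp only [hcs, and_self, if_true, hYS]
    · simp [hcs]

/-- Insert copies of `Y` above `s` without increasing the weight. An `F`-component meeting `V_s`
could be hung at the second copy, and a vertex violating the other condition could be pushed out;
both would remove a vertex from the set below the bottom node and contradict minimality. -/
theorem IsMinimal.tight [Finite V] (h : IsMinimal G S k T₀ σ T) {s p : ℕ} (hs : T.IsSBottom S s)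
    (hps : T.IsParent p s) {Y : Set V} (hYk : Y.ncard ≤ k) (hYs : Y ⊆ T.bag s)
    (hYS : Y ∩ S = T.bag s ∩ S) (hY : Y = T.bag s ∨ T.bag p ⊆ Y) : Tight G S (T.Vset s) Y := by
  have hT := h.1.rooted
  have H := isChains_single (k := k) hps h.1.nested hYk hYs hYS hY
  set m : ℕ → ℕ := fun x => if x = s then 3 else 0 with hm
  set β : ℕ → ℕ → Set V := fun x i => if x = s ∧ 0 < i then Y else T.bag x with hβ
  have hms : m s = 3 := by simp [hm]
  have hβs : ∀ i, β s (i + 1) = Y := fun i => by simp [hβ]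
  set e := Nat.pairEquiv
  have hA := H.admissible (e := e) h.1
  have hw := H.weight_le (e := e) hT
  have hsk := H.skel (e := e) hT
  have hchild : (T.chains e m β).IsParent (e (s, 2)) (e (s, 1)) :=
    H.isParent_succ hs.1 (by omega)
  have hbot : (T.chains e m β).IsSBottom S (e (s, 0)) := hsk.isSBottom_image hT hA.rooted hs
  have hV0 : (T.chains e m β).Vset (e (s, 0)) = T.Vset s := H.Vset_chains_zero hT hs.1
  have hV1 : (T.chains e m β).Vset (e (s, 1)) = T.Vset s := by
    rw [H.Vset_chains hT hs.1 (by omega), hβs 0]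
    exact Set.union_eq_left.2 (hYs.trans (bag_subset_Vset hs.1))
  have hsub : (T.chains e m β).InSubtree (e (s, 0)) (e (s, 1)) :=
    H.inSubtree_chain hT hs.1 (by omega) (by omega)
  have hB1 : (T.chains e m β).bag (e (s, 1)) = Y := (bag_chains _ _).trans (hβs 0)
  have hB2 : (T.chains e m β).bag (e (s, 2)) = Y := (bag_chains _ _).trans (hβs 1)
  refine ⟨fun C hC => ?_, fun v hv hD hDS => ?_⟩
  · by_contra hne
    have hne' := Set.nonempty_iff_ne_empty.2 hne
    obtain ⟨r, N, H'⟩ := exists_isHang (S := S) hA.toIsTD hchild (M := C) (by rwa [hB2])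
      (by rwa [hV1])
    have h1 := H'.weight_lt (Or.inl ⟨_, hbot, hsub, by rwa [hV0]⟩)
    have h2 := h.2 _ (H'.admissible hA)
    omega
  · have H' : IsPush G S k (T.chains e m β) (e (s, 1)) (e (s, 2)) v
        (G.neighborSet v ∩ (T.Vset s \ Y)) := by
      refine ⟨hA.toIsTD, hchild, fun c hc => ?_, hB2.trans hB1.symm, ?_, ?_, ?_,
        hv.2, ?_, hD, hDS⟩
      · rcases H.isParent_cases hc with ⟨c', i, -, -, rfl, h2⟩ | ⟨p', c', -, -, h2⟩
        · have h3 := Prod.ext_iff.1 (e.injective h2)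
          simp only at h3
          rw [← h3.1, show i = 1 by omega]
        · exact absurd (Prod.ext_iff.1 (e.injective h2)).2 (by simp)
      · rw [parent_chains_of_lt (by omega), bag_chains, hB1]
        exact hβs 2
      · rwa [hB1]
      · rw [hB1]; exact hv.1
      · rw [hV1, hB1]
    have h1 := H'.weight_lt hbot hsub (by rw [hV0, hV1])
    have h2 := h.2 _ (H'.admissible hA)
    omega

/-! ### Chains of bags -/

/-- Two nested sets are joined by a chain of sets changing one element at a time. -/
theorem exists_interpolation [Finite V] {Y Z : Set V} :
    ∃ (N : ℕ) (γ : ℕ → Set V), γ 0 = Y ∧ γ N = Z ∧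
      (∀ i, γ i ⊆ Y ∪ Z ∧ Y ∩ Z ⊆ γ i) ∧
      (Y ⊆ Z → ∀ i, γ i ⊆ γ (i + 1)) ∧ (Z ⊆ Y → ∀ i, γ (i + 1) ⊆ γ i) ∧
      ∀ i, (γ i).ncard ≤ (γ (i + 1)).ncard + 1 ∧ (γ (i + 1)).ncard ≤ (γ i).ncard + 1 := by
  obtain ⟨N, ⟨f⟩⟩ := Finite.exists_equiv_fin V
  -- Number the vertices; the set with index `i` agrees with `Z` on the vertices numbered below `i`
  -- and with `Y` on the others. Consecutive sets may coincide, which is harmless.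
  refine ⟨N, fun i => {x | (i ≤ (f x : ℕ) ∧ x ∈ Y) ∨ ((f x : ℕ) < i ∧ x ∈ Z)}, ?_, ?_,
    fun i => ⟨?_, ?_⟩, fun h i => ?_, fun h i => ?_, fun i => ?_⟩
  · ext x; simp
  · ext x; simp [(f x).2]
  · rintro x (hx | hx)
    · exact Or.inl hx.2
    · exact Or.inr hx.2
  · rintro x ⟨h1, h2⟩
    rcases le_or_gt i (f x : ℕ) with h | h
    · exact Or.inl ⟨h, h1⟩
    · exact Or.inr ⟨h, h2⟩
  · rintro x (hx | hx)
    · by_cases h' : i + 1 ≤ (f x : ℕ)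
      · exact Or.inl ⟨h', hx.2⟩
      · exact Or.inr ⟨by omega, h hx.2⟩
    · exact Or.inr ⟨by omega, hx.2⟩
  · rintro x (hx | hx)
    · exact Or.inl ⟨by omega, hx.2⟩
    · by_cases h' : (f x : ℕ) < i
      · exact Or.inr ⟨h', hx.2⟩
      · exact Or.inl ⟨by omega, h hx.2⟩
  · have key : ∀ A B : Set V, (∀ x, (f x : ℕ) ≠ i → x ∈ A → x ∈ B) → A.ncard ≤ B.ncard + 1 := by
      intro A B hAB
      have h1 : A ⊆ B ∪ {x | (f x : ℕ) = i} := fun x hx => by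
        by_cases h : (f x : ℕ) = i
        · exact Or.inr h
        · exact Or.inl (hAB x h hx)
      have h2 : ({x | (f x : ℕ) = i} : Set V).ncard ≤ 1 :=
        Set.ncard_le_one_iff_subsingleton.2 fun x hx y hy =>
          f.injective (Fin.ext (hx.trans hy.symm))
      have h3 := Set.ncard_le_ncard h1 (Set.toFinite _)
      have h4 := Set.ncard_union_le B {x | (f x : ℕ) = i}
      omega
    constructor <;> refine key _ _ fun x hx hxA => ?_ <;>
      rcases hxA with ⟨h1, h2⟩ | ⟨h1, h2⟩ <;>
      first
      | exact Or.inl ⟨by omega, h2⟩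
      | exact Or.inr ⟨by omega, h2⟩

/-- The properties of the chain of bags inserted between the bag `A` of a node and the bag `P` of its
parent when completing a weakly slim tree decomposition. -/
structure IsChain (S : Set V) (k : ℕ) (L : Prop) (A P : Set V) (m : ℕ) (β : ℕ → Set V) :
    Prop where
  zero : β 0 = A
  mono : ((∀ i < m, β i ⊆ β (i + 1)) ∧ β m ⊆ P) ∨ ((∀ i < m, β (i + 1) ⊆ β i) ∧ P ⊆ β m)
  card : ∀ i, 0 < i → i ≤ m → (β i).ncard ≤ k
  step : ∀ i < m, (β i).ncard ≤ (β (i + 1)).ncard + 1 ∧ (β (i + 1)).ncard ≤ (β i).ncard + 1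
  last : (β m).ncard ≤ P.ncard + 1 ∧ P.ncard ≤ (β m).ncard + 1
  trace : (∀ i ≤ m, β i ∩ S = A ∩ S) ∨ (L ∧ A ⊆ P)
  of_zero : m = 0 → A.ncard = k + 1 ∧ (P = A ∨ ∃ v ∈ S, v ∉ P ∧ A = insert v P)
  -- These clauses serve different ends: `2 ≤ m` puts a non-bottom node above the parent
  -- (`grandparent`), `β 1 = A` for non-full `A` gives `parent_same`, the repeated last bag gives
  -- `forget`, and the remaining information on `β 1` is what `IsMinimal.tight` requires of `Y`.
  of_pos : m ≠ 0 → 2 ≤ m ∧ β 1 = β 2 ∧ β 1 ⊆ A ∧ β 1 ∩ S = A ∩ S ∧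
    (A.ncard ≤ k → β 1 = A) ∧ (β 1 = A ∨ P ⊆ β 1) ∧ β (m - 1) = β m
  join : A ∩ S ⊆ P → P.ncard ≤ k → m ≠ 0 ∧ (β m).ncard ≤ P.ncard

theorem exists_chain_of [Finite V] {A Y Z P : Set V}
    (h : (Y = A ∧ Y ⊆ Z ∧ Z ⊆ P) ∨ (P ⊆ Z ∧ Z ⊆ Y ∧ Y ⊆ A)) :
    ∃ m, ∃ β : ℕ → Set V, 2 ≤ m ∧ β 0 = A ∧ β 1 = Y ∧ β 2 = Y ∧ β (m - 1) = Z ∧ β m = Z ∧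
      (((∀ i < m, β i ⊆ β (i + 1)) ∧ β m ⊆ P) ∨ ((∀ i < m, β (i + 1) ⊆ β i) ∧ P ⊆ β m)) ∧
      (∀ i, 0 < i → β i ⊆ Y ∪ Z ∧ Y ∩ Z ⊆ β i) ∧
      (A.ncard ≤ Y.ncard + 1 → ∀ i < m,
        (β i).ncard ≤ (β (i + 1)).ncard + 1 ∧ (β (i + 1)).ncard ≤ (β i).ncard + 1) := by
  obtain ⟨N, γ, h0, hN, hb, hup, hdown, hstep⟩ := exists_interpolation (Y := Y) (Z := Z)
  -- The truncated `i - 2` makes positions 1 and 2 both equal to `Y`; positions `N + 2` and `N + 3`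
  -- are both `Z`.
  refine ⟨N + 3, fun i => if i = 0 then A else if i = N + 3 then Z else γ (i - 2), by omega,
    by simp, by simp [h0], by simp [h0], by simp [hN], by simp, ?_, fun i hi => ?_,
    fun hAY i hi => ?_⟩
  · simp only
    rcases h with ⟨rfl, h1, h2⟩ | ⟨h1, h2, h3⟩
    · refine Or.inl ⟨fun i hi => ?_, h2⟩
      rcases i with _ | _ | i
      · simp [h0]
      · have e1 : 0 + 1 ≠ N + 3 := by omega
        have e2 : 0 + 1 + 1 ≠ N + 3 := by omega
        simp only [e1, e2, if_false, Nat.succ_ne_zero]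
        exact subset_rfl
      · have e1 : i + 1 + 1 ≠ N + 3 := by omega
        by_cases e2 : i + 1 + 1 + 1 = N + 3
        · have : i = N := by omega
          subst this
          simp [hN]
        · simp only [e1, e2, if_false, Nat.succ_ne_zero]
          exact hup h1 i
    · refine Or.inr ⟨fun i hi => ?_, h1⟩
      rcases i with _ | _ | i
      · simpa [h0] using h3
      · have e1 : 0 + 1 ≠ N + 3 := by omega
        have e2 : 0 + 1 + 1 ≠ N + 3 := by omega
        simp only [e1, e2, if_false, Nat.succ_ne_zero]
        exact subset_rfl
      · have e1 : i + 1 + 1 ≠ N + 3 := by omega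
        by_cases e2 : i + 1 + 1 + 1 = N + 3
        · have : i = N := by omega
          subst this
          simp [hN]
        · simp only [e1, e2, if_false, Nat.succ_ne_zero]
          exact hdown h2 i
  · have e0 : i ≠ 0 := by omega
    by_cases e1 : i = N + 3
    · simp only [e1, if_true]
      exact ⟨Set.subset_union_right, Set.inter_subset_right⟩
    · simp only [e0, e1, if_false]
      exact hb _
  · have hYA : Y.ncard ≤ A.ncard := Set.ncard_le_ncard
      (h.elim (fun h => h.1.subset) (fun h => h.2.2)) (Set.toFinite _)
    rcases i with _ | _ | i
    · simp only [zero_add, if_true, one_ne_zero, if_false]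
      have e1 : 1 ≠ N + 3 := by omega
      simp only [e1, if_false, show 1 - 2 = 0 from rfl, h0]
      omega
    · have e1 : 0 + 1 ≠ N + 3 := by omega
      have e2 : 0 + 1 + 1 ≠ N + 3 := by omega
      simp only [e1, e2, if_false, Nat.succ_ne_zero]
      exact ⟨Nat.le_succ _, Nat.le_succ _⟩
    · have e1 : i + 1 + 1 ≠ N + 3 := by omega
      by_cases e2 : i + 1 + 1 + 1 = N + 3
      · have : i = N := by omega
        subst this
        simp [hN]
      · simp only [e1, e2, if_false, Nat.succ_ne_zero]
        exact hstep i

theorem exists_isChain_of [Finite V] {L : Prop} {A Y Z P : Set V}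
    (h : (Y = A ∧ Y ⊆ Z ∧ Z ⊆ P) ∨ (P ⊆ Z ∧ Z ⊆ Y ∧ Y ⊆ A)) (hYk : Y.ncard ≤ k)
    (hZk : Z.ncard ≤ k) (hAY : A.ncard ≤ Y.ncard + 1) (hYS : Y ∩ S = A ∩ S)
    (hZ : Z ∩ S = A ∩ S ∨ (L ∧ A ⊆ P)) (hA : A.ncard ≤ k → Y = A)
    (h1 : Z.ncard ≤ P.ncard + 1) (h2 : P.ncard ≤ Z.ncard + 1)
    (hj : A ∩ S ⊆ P → Z.ncard ≤ P.ncard) : ∃ m β, IsChain S k L A P m β := by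
  obtain ⟨m, β, hm, h0, hb1, hb2, hbm, hbm', hmono, hbet, hstep⟩ := exists_chain_of h
  have hYZ : Y ⊆ Z ∨ Z ⊆ Y := h.imp (fun h => h.2.1) (fun h => h.2.1)
  refine ⟨m, β, h0, hmono, fun i hi _ => ?_, hstep hAY, by rw [hbm']; exact ⟨h1, h2⟩, ?_,
    fun h => by omega, fun _ => ⟨hm, hb1.trans hb2.symm, ?_, ?_, ?_, ?_, hbm.trans hbm'.symm⟩,
    fun hj' _ => ⟨by omega, by rw [hbm']; exact hj hj'⟩⟩
  · rcases hYZ with h' | h'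
    · exact (Set.ncard_le_ncard ((hbet i hi).1.trans (Set.union_subset h' subset_rfl))
        (Set.toFinite _)).trans hZk
    · exact (Set.ncard_le_ncard ((hbet i hi).1.trans (Set.union_subset subset_rfl h'))
        (Set.toFinite _)).trans hYk
  · refine hZ.imp_left fun hZ i hi => ?_
    rcases Nat.eq_zero_or_pos i with rfl | hi
    · rw [h0]
    · apply Set.Subset.antisymm
      · rintro x ⟨hx, hxS⟩
        rcases (hbet i hi).1 hx with h | h
        · rw [← hYS]; exact ⟨h, hxS⟩
        · rw [← hZ]; exact ⟨h, hxS⟩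
      · intro x hx
        have h3 : x ∈ Y ∩ S := by rw [hYS]; exact hx
        have h4 : x ∈ Z ∩ S := by rw [hZ]; exact hx
        exact ⟨(hbet i hi).2 ⟨h3.1, h4.1⟩, hx.2⟩
  · rw [hb1]; exact h.elim (fun h => h.1.subset) (fun h => h.2.2)
  · rw [hb1, hYS]
  · rw [hb1]; exact hA
  · rw [hb1]; exact h.imp (fun h => h.1) (fun h => h.1.trans h.2.1)

/-- The chain runs from `A` through `Y` to `Z` and ends below `P`. If `A` is a non-full proper
subset of `P`, it climbs to `P` minus one vertex. If `P` is a proper subset of `A`, it descends to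
`P ∪ (A ∩ S)`, so that the change in `S` happens only at the last edge. Nothing is inserted between
equal full bags, nor when a full `A` just loses one vertex of `S`. -/
theorem exists_isChain [Finite V] {L : Prop} {A P : Set V} (hA : A.ncard ≤ k + 1)
    (hP : P.ncard ≤ k + 1) (hn : A ⊆ P ∨ P ⊆ A)
    (hs : (((A \ P) ∩ S).Subsingleton ∧ ((P \ A) ∩ S).Subsingleton) ∨ (L ∧ A ⊆ P)) :
    ∃ m β, IsChain S k L A P m β := by
  by_cases hAP : A ⊆ P
  · by_cases hAk : A.ncard ≤ k
    · by_cases hPA : P ⊆ A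
      · obtain rfl := hAP.antisymm hPA
        exact exists_isChain_of (Or.inl ⟨rfl, subset_rfl, subset_rfl⟩) hAk hAk (by omega) rfl
          (Or.inl rfl) (fun _ => rfl) (by omega) (by omega) (fun _ => le_rfl)
      -- The vertex left for the last step is taken from `S` whenever `P \ A` meets `S`, so the
      -- chain keeps the `S`-part of `A`; under the alternative `L` this is not needed.
      · have hx : ∃ x ∈ P, x ∉ A ∧ ((P \ {x}) ∩ S = A ∩ S ∨ (L ∧ A ⊆ P)) := by
          rcases hs with ⟨-, hs⟩ | hs
          · by_cases hne : ((P \ A) ∩ S).Nonempty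
            · obtain ⟨x, ⟨hxP, hxA⟩, hxS⟩ := hne
              refine ⟨x, hxP, hxA, Or.inl ?_⟩
              ext y
              refine ⟨fun ⟨⟨h1, h2⟩, h3⟩ => ⟨?_, h3⟩, fun ⟨h1, h2⟩ =>
                ⟨⟨hAP h1, by rintro rfl; exact hxA h1⟩, h2⟩⟩
              by_contra hyA
              exact h2 (hs ⟨⟨h1, hyA⟩, h3⟩ ⟨⟨hxP, hxA⟩, hxS⟩)
            · obtain ⟨x, hxP, hxA⟩ := Set.not_subset.1 hPA
              refine ⟨x, hxP, hxA, Or.inl ?_⟩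
              ext y
              refine ⟨fun ⟨⟨h1, h2⟩, h3⟩ => ⟨?_, h3⟩, fun ⟨h1, h2⟩ =>
                ⟨⟨hAP h1, by rintro rfl; exact hxA h1⟩, h2⟩⟩
              by_contra hyA
              exact hne ⟨y, ⟨h1, hyA⟩, h3⟩
          · obtain ⟨x, hxP, hxA⟩ := Set.not_subset.1 hPA
            exact ⟨x, hxP, hxA, Or.inr hs⟩
        obtain ⟨x, hxP, hxA, hx⟩ := hx
        have hc := Set.ncard_sdiff_singleton_add_one hxP (Set.toFinite _)
        exact exists_isChain_of (Z := P \ {x})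
          (Or.inl ⟨rfl, fun y hy => ⟨hAP hy, by rintro rfl; exact hxA hy⟩, Set.sdiff_subset⟩)
          hAk (by omega) (by omega) rfl hx (fun _ => rfl) (by omega) (by omega) (fun _ => by omega)
    · have hAP' : A = P := Set.eq_of_subset_of_ncard_le hAP (by omega) (Set.toFinite _)
      subst hAP'
      refine ⟨0, fun _ => A, rfl, Or.inl ⟨fun _ _ => subset_rfl, subset_rfl⟩, fun i h1 h2 => ?_,
        fun _ _ => ⟨by omega, by omega⟩, ⟨by omega, by omega⟩, Or.inl fun _ _ => rfl,
        fun _ => ⟨by omega, Or.inl rfl⟩, fun h => absurd rfl h, fun _ h => by omega⟩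
      omega
  · have hPA := hn.resolve_left hAP
    have hs' := (hs.resolve_right fun h => hAP h.2).1
    by_cases hv : ∃ v ∈ S, v ∉ P ∧ A = insert v P ∧ A.ncard = k + 1
    · obtain ⟨v, hvS, hvP, rfl, hAk⟩ := hv
      have hc := Set.ncard_insert_of_notMem hvP (Set.toFinite _)
      refine ⟨0, fun _ => insert v P, rfl, Or.inr ⟨fun _ _ => subset_rfl, hPA⟩,
        fun i h1 h2 => ?_, fun _ _ => ⟨by omega, by omega⟩, ⟨by omega, by omega⟩,
        Or.inl fun _ _ => rfl, fun _ => ⟨hAk, Or.inr ⟨v, hvS, hvP, rfl⟩⟩, fun h => absurd rfl h,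
        fun h _ => ?_⟩
      · omega
      · exact absurd (h ⟨Set.mem_insert v P, hvS⟩) hvP
    · have hY : ∃ Y, P ∪ (A ∩ S) ⊆ Y ∧ Y ⊆ A ∧ Y.ncard ≤ k ∧ A.ncard ≤ Y.ncard + 1 ∧
          (A.ncard ≤ k → Y = A) := by
        by_cases hAk : A.ncard ≤ k
        · exact ⟨A, Set.union_subset hPA Set.inter_subset_left, subset_rfl, hAk, by omega,
            fun _ => rfl⟩
        -- If `A \ P` were contained in `S`, it would be a single vertex, which is the case already
        -- excluded. A full `A` therefore has a vertex outside `P ∪ S` that can be dropped at once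
        -- to make `Y` non-full.
        · have hw : ∃ w ∈ A, w ∉ P ∧ w ∉ S := by
            by_contra hcon
            push Not at hcon
            obtain ⟨v, hvA, hvP⟩ := Set.not_subset.1 hAP
            refine hv ⟨v, hcon v hvA hvP, hvP, ?_, by omega⟩
            ext y
            refine ⟨fun hy => ?_, ?_⟩
            · by_cases hyP : y ∈ P
              · exact Or.inr hyP
              · exact Or.inl (hs' ⟨⟨hy, hyP⟩, hcon y hy hyP⟩ ⟨⟨hvA, hvP⟩, hcon v hvA hvP⟩)
            · rintro (rfl | hy)
              · exact hvA
              · exact hPA hy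
          obtain ⟨w, hwA, hwP, hwS⟩ := hw
          have hc := Set.ncard_sdiff_singleton_add_one hwA (Set.toFinite _)
          refine ⟨A \ {w}, ?_, Set.sdiff_subset, by omega, by omega, fun h => absurd h hAk⟩
          rintro y (hy | hy)
          · exact ⟨hPA hy, by rintro rfl; exact hwP hy⟩
          · exact ⟨hy.1, by rintro rfl; exact hwS hy.2⟩
      obtain ⟨Y, hZY, hYA, hYk, hAY, hYA'⟩ := hY
      have hZS : (P ∪ (A ∩ S)) ∩ S = A ∩ S := by
        ext y
        refine ⟨fun ⟨h1, h2⟩ => ⟨h1.elim (fun h => hPA h) (fun h => h.1), h2⟩,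
          fun h => ⟨Or.inr h, h.2⟩⟩
      have hZP : (P ∪ (A ∩ S)).ncard ≤ P.ncard + 1 := by
        have h1 : P ∪ (A ∩ S) ⊆ P ∪ ((A \ P) ∩ S) := fun y hy => by
          by_cases hyP : y ∈ P
          · exact Or.inl hyP
          · exact Or.inr ⟨⟨(hy.resolve_left hyP).1, hyP⟩, (hy.resolve_left hyP).2⟩
        have h2 := Set.ncard_le_ncard h1 (Set.toFinite _)
        have h3 := Set.ncard_union_le P ((A \ P) ∩ S)
        have h4 := Set.ncard_le_one_iff_subsingleton.2 hs'
        omega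
      have hPZ := Set.ncard_le_ncard (Set.subset_union_left : P ⊆ P ∪ (A ∩ S)) (Set.toFinite _)
      have hZk := Set.ncard_le_ncard hZY (Set.toFinite _)
      refine exists_isChain_of (Or.inr ⟨Set.subset_union_left, hZY, hYA⟩) hYk (by omega) hAY ?_
        (Or.inl hZS) hYA' hZP (by omega) fun h => ?_
      · exact (Set.inter_subset_inter_left _ hYA).antisymm fun y hy => ⟨hZY (Or.inr hy), hy.2⟩
      · rw [Set.union_eq_left.2 h]

end RTD
namespace RTD

variable {V : Type*} {T : RTD V} {S : Set V} {G : SimpleGraph V} {k : ℕ}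

/-! ### Completing weakly slim tree decompositions -/

/-- The chains `β` turn `T` into an `S`-nice tree decomposition. -/
structure IsCompletion (S : Set V) (k : ℕ) (T : RTD V) (m : ℕ → ℕ) (β : ℕ → ℕ → Set V) :
    Prop where
  root : m T.root = 0
  zero : ∀ c, β c 0 = T.bag c
  chain : ∀ p c, T.IsParent p c →
    IsChain S k (T.Lset c ∩ S = ∅) (T.bag c) (T.bag p) (m c) (β c)

theorem exists_isCompletion [Finite V] (hT : WeaklySlim G S k T) :
    ∃ m β, IsCompletion S k T m β := by
  have : ∀ c, ∃ (m : ℕ) (β : ℕ → Set V), (c = T.root → m = 0) ∧ β 0 = T.bag c ∧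
      ∀ p, T.IsParent p c → IsChain S k (T.Lset c ∩ S = ∅) (T.bag c) (T.bag p) m β := by
    intro c
    by_cases hc : ∃ p, T.IsParent p c
    · obtain ⟨p, hp⟩ := hc
      obtain ⟨m, β, h⟩ := exists_isChain (hT.card_le c hp.1)
        (hT.card_le p (hp.parent_mem hT.rooted)) (hT.nested p c hp) (hT.step p c hp)
      exact ⟨m, β, fun h' => absurd h' hp.2.1, h.zero, fun q hq => (hp.unique hq) ▸ h⟩
    · exact ⟨0, fun _ => T.bag c, fun _ => rfl, rfl, fun p hp => absurd ⟨p, hp⟩ hc⟩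
  choose m β h1 h2 h3 using this
  exact ⟨m, β, h1 _ rfl, h2, fun p c h => h3 c p h⟩

namespace IsCompletion

variable {e : ℕ × ℕ ≃ ℕ} {m : ℕ → ℕ} {β : ℕ → ℕ → Set V}

theorem isChains (H : IsCompletion S k T m β) : IsChains S k T m β := by
  refine ⟨H.root, H.zero, fun p c h => (H.chain p c h).mono, fun c hc i h0 hi => ?_,
    fun p c h => (H.chain p c h).trace⟩
  by_cases hcr : c = T.root
  · rw [hcr, H.root] at hi
    omega
  · exact (H.chain _ c ⟨hc, hcr, rfl⟩).card i h0 hi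

variable [Finite V] (H : IsCompletion S k T m β) (hT : WeaklySlim G S k T)
include H hT

theorem exists_bottom {z : ℕ} (hz : (T.chains e m β).IsSBottom S z) :
    ∃ b p, T.IsSBottom S b ∧ T.IsParent p b ∧ z = e (b, 0) := by
  obtain ⟨b, hb, rfl⟩ := (H.isChains.skel hT.rooted).exists_of_isSBottom hT.rooted
    (H.isChains.rooted hT.rooted) hz
  exact ⟨b, _, hb, ⟨hb.1, fun h => hT.root_not_bottom (h ▸ hb), rfl⟩, rfl⟩

theorem not_isSBottom_pos {c i : ℕ} (hi : 0 < i) : ¬ (T.chains e m β).IsSBottom S (e (c, i)) := by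
  intro h
  obtain ⟨b, p, -, -, h⟩ := H.exists_bottom hT h
  have := (Prod.ext_iff.1 (e.injective h)).2
  simp only at this
  omega

theorem exists_sChild {b z : ℕ} (hb : b ∈ T.nodes)
    (hz : z ∈ (T.chains e m β).sChildren S (e (b, 0))) :
    ∃ c ∈ T.sChildren S b, z = e (c, m c) := by
  rw [(H.isChains.skel hT.rooted).sChildren_eq hT.rooted (H.isChains.rooted hT.rooted) hb] at hz
  obtain ⟨c, hc, rfl⟩ := hz
  exact ⟨c, hc, rfl⟩

theorem parent_cases {b p q : ℕ} (hp : T.IsParent p b)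
    (hq : (T.chains e m β).IsParent q (e (b, 0))) :
    (2 ≤ m b ∧ q = e (b, 1)) ∨ (m b = 0 ∧ q = e (p, 0)) := by
  by_cases h0 : m b = 0
  · right
    rw [← hq.2.2, parent_chains_of_le (by omega), hp.2.2]
    exact ⟨h0, rfl⟩
  · left
    rw [← hq.2.2, parent_chains_of_lt (by omega)]
    exact ⟨((H.chain p b hp).of_pos h0).1, rfl⟩

theorem eq_of_isParent_pos {c i n : ℕ} (h : (T.chains e m β).IsParent (e (c, i + 1)) n) :
    n = e (c, i) := by
  rcases H.isChains.isParent_cases h with ⟨c', i', -, -, rfl, h2⟩ | ⟨p', c', -, -, h2⟩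
  · have h3 := Prod.ext_iff.1 (e.injective h2)
    simp only at h3
    rw [h3.1, show i = i' by omega]
  · exact absurd (Prod.ext_iff.1 (e.injective h2)).2 (by simp)

/-- The parent of an `S`-bottom node is an `S`-bottom node if no node is inserted between them and
its bag is smaller. -/
theorem isSBottom_parent {b p : ℕ} (hp : T.IsParent p b) (h0 : m b = 0)
    (hk : (T.bag p).ncard ≤ k) : T.IsSBottom S p := by
  obtain ⟨h1, h2⟩ := (H.chain p b hp).of_zero h0
  rcases h2 with h2 | ⟨v, hvS, hvp, h2⟩
  · rw [← h2] at h1; omega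
  · have hvb : v ∈ T.bag b := h2 ▸ Set.mem_insert v _
    have hvV : v ∈ T.Vset b := bag_subset_Vset hp.1 hvb
    refine ⟨hp.parent_mem hT.rooted, ⟨v, ⟨Vset_mono (hp.inSubtree hT.rooted) hvV, hvp⟩, hvS⟩,
      fun d hd htr => ?_⟩
    by_cases hdb : d = b
    · subst hdb
      exact hvp ((mem_bag_of_trace htr hvS).1 hvb)
    · refine hvp (hT.mem_bag_of_children hp hd (Ne.symm hdb) hvV ?_)
      exact (mem_Vset_of_trace htr hvS).2 (Vset_mono (hp.inSubtree hT.rooted) hvV)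

theorem ncard_ne_full_of_pos {c p : ℕ} (hp : T.IsParent p c)
    (h : (β c (m c)).ncard ≠ k + 1) : m c ≠ 0 := by
  intro h0
  rw [h0, H.zero] at h
  exact h ((H.chain p c hp).of_zero h0).1

theorem isSNice : IsSNice G S (T.chains e m β) := by
  have hw := H.isChains.weaklySlim (e := e) hT
  refine ⟨isTreeDecomposition_iff.2 hw.toIsTD, fun q n h => ⟨hw.nested q n h, ?_⟩, hw.nice⟩
  rcases H.isChains.isParent_cases h with ⟨c, i, hc, hi, rfl, rfl⟩ | ⟨p, c, hpc, rfl, rfl⟩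
  · have hcr : c ≠ T.root := by
      rintro rfl
      rw [H.root] at hi
      omega
    rw [bag_chains, bag_chains]
    exact (H.chain _ c ⟨hc, hcr, rfl⟩).step i hi
  · rw [bag_chains, bag_chains, H.zero]
    exact (H.chain p c hpc).last

theorem width_le : (T.chains e m β).width ≤ k := by
  have hw := H.isChains.weaklySlim (e := e) hT
  have : (T.chains e m β).nodes.sup (fun t => ((T.chains e m β).bag t).ncard) ≤ k + 1 :=
    Finset.sup_le hw.card_le
  rw [width]
  omega

/-- For a non-full bag, the chains were built so that the adjacent bags are non-full and not larger.
For a full bag, either another node has the same bag, which gives a full join tree, or the adjacent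
bags are nested with it but different, hence non-full. -/
theorem join {t : ℕ} (ht : (T.chains e m β).IsSBottom S t)
    (h2 : ((T.chains e m β).sChildren S t).ncard = 2) :
    (∃ J, (T.chains e m β).IsFullJoinTree k J ∧ t ∈ J) ∨
    ((∀ c ∈ (T.chains e m β).sChildren S t, ¬ (T.chains e m β).IsFull k c ∧
        ((T.chains e m β).bag c).ncard ≤ ((T.chains e m β).bag t).ncard) ∧
      ∀ p, (T.chains e m β).IsParent p t → ¬ (T.chains e m β).IsFull k p ∧
        ((T.chains e m β).bag p).ncard ≤ ((T.chains e m β).bag t).ncard) := by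
  have hw := H.isChains.weaklySlim (e := e) hT
  obtain ⟨b, p, hb, hpb, rfl⟩ := H.exists_bottom hT ht
  have hcard := hw.card_le _ ht.1
  by_cases hk : ((T.chains e m β).bag (e (b, 0))).ncard ≤ k
  · have hbb : (T.chains e m β).bag (e (b, 0)) = T.bag b := by rw [bag_chains, H.zero]
    have h2' : (T.sChildren S b).ncard = 2 := by
      rw [← h2, (H.isChains.skel hT.rooted).ncard_sChildren hT.rooted
        (H.isChains.rooted hT.rooted) hb.1]
    have hj : T.AdmitsJoin S b := by
      rcases hT.nice b hb with ⟨v, y, hy, -⟩ | ⟨v, y, hy, -⟩ | hj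
      · rw [hy, Set.ncard_singleton] at h2'; omega
      · rw [hy, Set.ncard_singleton] at h2'; omega
      · exact hj
    rw [hbb] at hk ⊢
    refine Or.inr ⟨fun z hz => ?_, fun q hq => ?_⟩
    · obtain ⟨c, hc, rfl⟩ := H.exists_sChild hT hb.1 hz
      have hcS : T.bag c ∩ S ⊆ T.bag b := by
        obtain ⟨c₁, c₂, -, hcc, hsub⟩ := hj
        rw [hcc] at hc
        rcases hc with rfl | rfl
        · exact (Set.subset_union_left.trans hsub).trans Set.inter_subset_left
        · exact (Set.subset_union_right.trans hsub).trans Set.inter_subset_left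
      have := (((H.chain b c hc.1).join) hcS hk).2
      rw [IsFull, bag_chains]
      omega
    · have h0 : m b ≠ 0 := fun h0 => by
        have := ((H.chain p b hpb).of_zero h0).1
        omega
      rcases H.parent_cases hT hpb hq with ⟨-, rfl⟩ | ⟨h, -⟩
      · have := ((H.chain p b hpb).of_pos h0).2.2.2.2.1 hk
        rw [IsFull, bag_chains, this]
        omega
      · exact absurd h h0
  · have hX : ((T.chains e m β).bag (e (b, 0))).ncard = k + 1 := by omega
    by_cases hn : ∃ y ∈ (T.chains e m β).nodes, y ≠ e (b, 0) ∧
        (T.chains e m β).bag y = (T.chains e m β).bag (e (b, 0))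
    · obtain ⟨y, hy, hne, heq⟩ := hn
      exact Or.inl ⟨_, hw.isFullJoinTree_level hw.card_le hX
        ⟨y, ⟨hy, heq⟩, e (b, 0), ⟨ht.1, rfl⟩, hne⟩, ht.1, rfl⟩
    · have key : ∀ y ∈ (T.chains e m β).nodes, y ≠ e (b, 0) →
          ((T.chains e m β).bag y ⊆ (T.chains e m β).bag (e (b, 0)) ∨
            (T.chains e m β).bag (e (b, 0)) ⊆ (T.chains e m β).bag y) →
          ¬ (T.chains e m β).IsFull k y ∧
            ((T.chains e m β).bag y).ncard ≤ ((T.chains e m β).bag (e (b, 0))).ncard := by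
        intro y hy hne hsub
        refine ⟨fun hf => hn ⟨y, hy, hne, ?_⟩, by rw [hX]; exact hw.card_le y hy⟩
        rw [IsFull] at hf
        rcases hsub with h | h
        · exact Set.eq_of_subset_of_ncard_le h (by omega) (Set.toFinite _)
        · exact (Set.eq_of_subset_of_ncard_le h (by omega) (Set.toFinite _)).symm
      refine Or.inr ⟨fun c hc => key c hc.1.1 (hc.1.ne hw.rooted) (hw.nested _ _ hc.1),
        fun q hq => key q (hq.parent_mem hw.rooted) (hq.ne hw.rooted).symm
          (hw.nested _ _ hq).symm⟩

theorem isSlim : IsSlim G S k (T.chains e m β) := by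
  have hw := H.isChains.weaklySlim (e := e) hT
  refine ⟨hw.root_not_bottom, fun t ht h2 => H.join hT ht h2, fun t ht hf q hq => ?_,
    fun t v ht _ z hz hf => ?_, fun t q ht hq hf => ?_, fun J hJ t ht => hw.full_bottom hJ ht,
    fun J hJ r hr hsub v hv => hw.full_nbrs hJ hr hsub hv⟩
  · obtain ⟨b, p, hb, hpb, rfl⟩ := H.exists_bottom hT ht
    rw [IsFull, bag_chains, H.zero] at hf
    have h0 : m b ≠ 0 := fun h0 => hf ((H.chain p b hpb).of_zero h0).1
    have hcard := hT.card_le b hb.1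
    have hb1 := ((H.chain p b hpb).of_pos h0).2.2.2.2.1 (by omega)
    rcases H.parent_cases hT hpb hq with ⟨-, rfl⟩ | ⟨h, -⟩
    · refine ⟨by rw [bag_chains, bag_chains, H.zero, hb1], ?_⟩
      refine Set.Subset.antisymm (fun z hz => H.eq_of_isParent_pos hT hz.1) ?_
      rintro z rfl
      obtain ⟨s, hs⟩ := ht.2.1
      refine (mem_sChildren hw.rooted).2 ⟨hq, s, hs.2, hs.1.1, ?_⟩
      rw [bag_chains, hb1, ← H.zero, ← bag_chains (T := T) (e := e) (m := m) (β := β)]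
      exact hs.1.2
    · exact absurd h h0
  · obtain ⟨b, p, hb, hpb, rfl⟩ := H.exists_bottom hT ht
    obtain ⟨c, hc, rfl⟩ := H.exists_sChild hT hb.1 hz
    rw [IsFull, bag_chains] at hf
    have h0 := H.ncard_ne_full_of_pos hT hc.1 hf
    have h1 := (H.chain b c hc.1).of_pos h0
    have hm : m c = m c - 1 + 1 := by omega
    have key : ∀ d ∈ (T.chains e m β).sChildren S (e (c, m c)), d = e (c, m c - 1) := by
      intro d hd
      rw [hm] at hd
      exact H.eq_of_isParent_pos hT hd.1
    refine ⟨fun d hd d' hd' => (key d hd).trans (key d' hd').symm, fun d hd => ?_⟩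
    rw [key d hd, bag_chains, bag_chains, h1.2.2.2.2.2.2]
  · obtain ⟨b, p, hb, hpb, rfl⟩ := H.exists_bottom hT ht
    right
    rcases H.parent_cases hT hpb hq with ⟨h2, rfl⟩ | ⟨h0, rfl⟩
    · rw [parent_chains_of_lt (by omega)]
      exact H.not_isSBottom_pos hT (by omega)
    · have hcard := hT.card_le p (hpb.parent_mem hT.rooted)
      rw [IsFull, bag_chains, H.zero] at hf
      -- If nothing was inserted above `b`, the non-full parent `p` is itself a bottom node. Being
      -- non-full, it does have inserted nodes above it, and these are not bottom nodes.
      have hpbot := H.isSBottom_parent hT hpb h0 (by omega)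
      have hpp : T.IsParent (T.parent p) p :=
        ⟨hpbot.1, fun h => hT.root_not_bottom (h ▸ hpbot), rfl⟩
      have hmp : m p ≠ 0 := fun h => hf ((H.chain _ p hpp).of_zero h).1
      rw [parent_chains_of_lt (by omega)]
      exact H.not_isSBottom_pos hT (by omega)

-- A non-full parent of a bottom node is either the first inserted node, covered by
-- `IsMinimal.tight` with `Y = β b 1`, or an old node that is itself a bottom node, covered with `Y`
-- its own bag.
omit hT in
theorem tight {T₀ : RTD V} {σ : Set V × Set V × Set V} (hT : IsMinimal G S k T₀ σ T) {q s : ℕ}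
    (hq : (T.chains e m β).IsParent q s) (hs : (T.chains e m β).IsSBottom S s)
    (hk : ((T.chains e m β).bag q).ncard ≤ k) :
    Tight G S ((T.chains e m β).Vset q) ((T.chains e m β).bag q) := by
  have hT' := hT.1.toWeaklySlim
  obtain ⟨b, p, hb, hpb, rfl⟩ := H.exists_bottom hT' hs
  rcases H.parent_cases hT' hpb hq with ⟨h2, rfl⟩ | ⟨h0, rfl⟩
  · obtain ⟨-, -, h3, h4, -, h5, -⟩ := (H.chain p b hpb).of_pos (by omega)
    rw [H.isChains.Vset_chains hT'.rooted hb.1 (by omega), bag_chains,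
      Set.union_eq_left.2 (h3.trans (bag_subset_Vset hb.1))]
    exact hT.tight hb hpb ((H.chain p b hpb).card 1 (by omega) (by omega)) h3 h4 h5
  · rw [bag_chains, H.zero] at hk ⊢
    rw [H.isChains.Vset_chains_zero hT'.rooted (hpb.parent_mem hT'.rooted)]
    have hpbot := H.isSBottom_parent hT' hpb h0 hk
    exact hT.tight hpbot ⟨hpbot.1, fun h => hT'.root_not_bottom (h ▸ hpbot), rfl⟩ hk subset_rfl rfl
      (Or.inl rfl)

omit hT in
theorem disjoint_sChild {T₀ : RTD V} {σ : Set V × Set V × Set V} (hT : IsMinimal G S k T₀ σ T)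
    {b : ℕ} (hb : (T.chains e m β).IsSBottom S b) {C : Set V}
    (hC : IsFComponent G S ((T.chains e m β).bag b)ᶜ C) {c : ℕ}
    (hc : c ∈ (T.chains e m β).sChildren S b) : C ∩ (T.chains e m β).Vset c = ∅ := by
  have hT' := hT.1.toWeaklySlim
  obtain ⟨b, p, hb', -, rfl⟩ := H.exists_bottom hT' hb
  obtain ⟨c, hc', rfl⟩ := H.exists_sChild hT' hb'.1 hc
  rw [bag_chains, H.zero] at hC
  rw [H.isChains.Vset_chains hT'.rooted hc'.1.1 le_rfl, Set.eq_empty_iff_forall_notMem]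
  rintro v ⟨hv, hv'⟩
  have hd := Set.eq_empty_iff_forall_notMem.1 (hT.disjoint_sChild hb' hc' hC) v
  have hvb := hC.1.subset hv
  rcases hv' with h | h
  · exact hd ⟨hv, h⟩
  · rcases H.isChains.subset_union hc'.1 le_rfl h with h | h
    · exact hd ⟨hv, bag_subset_Vset hc'.1.1 h⟩
    · exact hvb h

/-- The parent of the completed node `s` has a bag with at most `k` elements, unless `s` and its
parent have the same full bag. -/
theorem exists_parent {p s : ℕ} (hps : T.IsParent p s) (hs : T.IsSBottom S s)
    (hf : ¬ (T.bag s = T.bag p ∧ T.IsFull k s)) :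
    ∃ x, x ≠ (s, 0) ∧ ∀ e : ℕ × ℕ ≃ ℕ, (T.chains e m β).IsParent (e x) (e (s, 0)) ∧
      ((T.chains e m β).bag (e x)).ncard ≤ k := by
  by_cases h0 : m s = 0
  · refine ⟨(p, 0), fun h => hps.ne hT.rooted (Prod.ext_iff.1 h).1.symm, fun e => ⟨?_, ?_⟩⟩
    · have := H.isChains.isParent_top (e := e) hps
      rwa [h0] at this
    · rw [bag_chains, H.zero]
      obtain ⟨h1, h2⟩ := (H.chain p s hps).of_zero h0
      rcases h2 with h2 | ⟨v, -, hv, h2⟩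
      · exact absurd ⟨h2.symm, h1⟩ hf
      · rw [h2, Set.ncard_insert_of_notMem hv (Set.toFinite _)] at h1
        omega
  · refine ⟨(s, 1), by simp, fun e => ⟨H.isChains.isParent_succ hs.1 (by omega), ?_⟩⟩
    rw [bag_chains]
    exact (H.chain p s hps).card 1 (by omega) (by omega)

end IsCompletion

end RTD
namespace RTD

variable {V : Type*} {T T₁ T₂ : RTD V} {S : Set V} {G : SimpleGraph V} {k q : ℕ} {B : Set ℕ}

/-! ### Modifications that do not change a subtree -/

/-- The subtree of `T` rooted at `q` is also a subtree of `T₁`; the set `B` of names contains the nodes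
of `T₁` and is closed under taking parents. -/
structure Agree (T T₁ : RTD V) (q : ℕ) (B : Set ℕ) : Prop where
  nodes_subset : ∀ x ∈ T₁.nodes, x ∈ B
  -- Closure of `B` under parents is all that is needed to follow parents in `T₁`, so the
  -- intermediate data need not be shown to form rooted trees.
  parent_mem : ∀ x ∈ B, T₁.parent x ∈ B
  root : ¬ T.InSubtree T₁.root q
  sub : ∀ x, T.InSubtree x q →
    x ∈ T₁.nodes ∧ T₁.bag x = T.bag x ∧ (x ≠ q → T₁.parent x = T.parent x)
  back : ∀ x ∈ B, T.InSubtree (T₁.parent x) q → T.InSubtree x q ∧ x ≠ q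

namespace Agree

theorem inSubtree_iff (h : Agree T T₁ q B) (hT : T.IsRootedTree) (hq : q ∈ T.nodes) (x : ℕ) :
    T₁.InSubtree x q ↔ T.InSubtree x q := by
  constructor
  · rintro ⟨hx, n, hn⟩
    have hxB := h.nodes_subset x hx
    clear hx
    induction n generalizing x with
    | zero => obtain rfl : x = q := hn; exact InSubtree.refl hq
    | succ n ih => exact (h.back x hxB (ih _ hn (h.parent_mem x hxB))).1
  · rintro ⟨hx, n, hn⟩
    have hxq : T.InSubtree x q := ⟨hx, n, hn⟩
    refine ⟨(h.sub x hxq).1, ?_⟩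
    clear hx
    induction n generalizing x with
    | zero => exact ⟨0, hn⟩
    | succ n ih =>
      by_cases hne : x = q
      · exact ⟨0, hne⟩
      · obtain ⟨j, hj⟩ := ih _ hn (hxq.parent_of_ne hT hne).2
        refine ⟨j + 1, ?_⟩
        rw [Function.iterate_succ_apply, (h.sub x hxq).2.2 hne, hj]

theorem subtreeUnchanged (h : Agree T T₁ q B) (hT : T.IsRootedTree) (hq : q ∈ T.nodes) :
    SubtreeUnchanged T T₁ q :=
  ⟨h.inSubtree_iff hT hq, fun x hx => (h.sub x hx).2⟩

theorem mono (h : Agree T T₁ q B) (hT : T.IsRootedTree) {c : ℕ} (hc : T.InSubtree c q) :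
    Agree T T₁ c B := by
  refine ⟨h.nodes_subset, h.parent_mem, fun h' => h.root (h'.trans hc), fun x hx => ?_,
    fun x hx hp => ?_⟩
  · obtain ⟨h1, h2, h3⟩ := h.sub x (hx.trans hc)
    refine ⟨h1, h2, fun hne => h3 ?_⟩
    rintro rfl
    exact hne (hx.antisymm hT hc)
  · obtain ⟨h1, h2⟩ := h.back x hx (hp.trans hc)
    rw [(h.sub x h1).2.2 h2] at hp
    refine ⟨InSubtree.of_parent h1.1 hp, ?_⟩
    rintro rfl
    exact IsParent.not_inSubtree hT ⟨h1.1, (h1.parent_of_ne hT h2).1, rfl⟩ hp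

theorem Vset_eq (h : Agree T T₁ q B) (hT : T.IsRootedTree) {c : ℕ} (hc : T.InSubtree c q) :
    T₁.Vset c = T.Vset c := by
  have h' := h.mono hT hc
  ext v
  constructor
  · rintro ⟨y, hy, hv⟩
    rw [h'.inSubtree_iff hT hc.1] at hy
    exact ⟨y, hy, (h'.sub y hy).2.1 ▸ hv⟩
  · rintro ⟨y, hy, hv⟩
    exact ⟨y, (h'.inSubtree_iff hT hc.1 y).2 hy, by rwa [(h'.sub y hy).2.1]⟩

theorem isParent (h : Agree T T₁ q B) (hT : T.IsRootedTree) {p t : ℕ} (hp : T.InSubtree p q)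
    (hpt : T₁.IsParent p t) : T.InSubtree t q ∧ t ≠ q ∧ T.IsParent p t := by
  obtain ⟨h1, h2⟩ := h.back t (h.nodes_subset t hpt.1) (by rwa [hpt.2.2])
  exact ⟨h1, h2, h1.1, (h1.parent_of_ne hT h2).1, ((h.sub t h1).2.2 h2).symm.trans hpt.2.2⟩

theorem sChildren_subset (h : Agree T T₁ q B) (hT : T.IsRootedTree) {t : ℕ}
    (ht : T.InSubtree t q) : T.sChildren S t ⊆ T₁.sChildren S t := by
  rintro c ⟨hc, hne⟩
  have hcq : T.InSubtree c q := (hc.inSubtree hT).trans ht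
  have hcq' : c ≠ q := by
    rintro rfl
    exact hc.not_inSubtree hT ht
  obtain ⟨h1, h2, h3⟩ := h.sub c hcq
  refine ⟨⟨h1, fun hr => h.root (hr ▸ hcq), (h3 hcq').trans hc.2.2⟩, ?_⟩
  rwa [Lset, Rset, h2, h.Vset_eq hT hcq, h.Vset_eq hT ht, (h.sub t ht).2.1]

/-- Only the upper end of the subdivided edge must be outside the subtree: subdividing the edge just
above `q` changes nothing in the subtree. -/
theorem subdivide (h : Agree T T₁ q B) (hT : T.IsRootedTree) {p t n : ℕ}
    (hpt : T₁.IsParent p t) (hp : ¬ T.InSubtree p q) (hn : n ∉ T₁.nodes) (X : Set V) :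
    Agree T (T₁.subdivide t n X) q (insert n B) := by
  have hnA : ¬ T.InSubtree n q := fun h' => hn (h.sub n h').1
  refine ⟨fun x hx => ?_, fun x hx => ?_, h.root, fun x hx => ?_, fun x hx hxp => ?_⟩
  · rcases Finset.mem_insert.1 hx with rfl | hx
    · exact Set.mem_insert _ _
    · exact Set.mem_insert_of_mem _ (h.nodes_subset x hx)
  · simp only [RTD.subdivide]
    split_ifs with h1 h2
    · exact Set.mem_insert_of_mem _ (h.parent_mem t (h.nodes_subset t hpt.1))
    · exact Set.mem_insert _ _
    · exact Set.mem_insert_of_mem _ (h.parent_mem x (hx.resolve_left h1))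
  · obtain ⟨h1, h2, h3⟩ := h.sub x hx
    have hxn : x ≠ n := by rintro rfl; exact hnA hx
    refine ⟨Finset.mem_insert_of_mem h1, by simp [RTD.subdivide, hxn, h2], fun hxq => ?_⟩
    have hxt : x ≠ t := by
      rintro rfl
      apply hp
      rw [← hpt.2.2, h3 hxq]
      exact (hx.parent_of_ne hT hxq).2
    simp [RTD.subdivide, hxn, hxt, h3 hxq]
  · simp only [RTD.subdivide] at hxp
    split_ifs at hxp with h1 h2
    · rw [hpt.2.2] at hxp
      exact absurd hxp hp
    · exact absurd hxp hnA
    · exact h.back x (hx.resolve_left h1) hxp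

theorem mergeIntoParent (h : Agree T T₁ q B) (hT : T.IsRootedTree) {t : ℕ} (ht : t ∈ T₁.nodes)
    (htq : ¬ T.InSubtree t q) : Agree T (T₁.mergeIntoParent t) q B := by
  refine ⟨fun x hx => h.nodes_subset x (Finset.mem_of_mem_erase hx), fun x hx => ?_, h.root,
    fun x hx => ?_, fun x hx hxp => ?_⟩
  · simp only [RTD.mergeIntoParent]
    split_ifs
    · exact h.parent_mem t (h.nodes_subset t ht)
    · exact h.parent_mem x hx
  · obtain ⟨h1, h2, h3⟩ := h.sub x hx
    have hxt : x ≠ t := by rintro rfl; exact htq hx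
    refine ⟨Finset.mem_erase.2 ⟨hxt, h1⟩, h2, fun hxq => ?_⟩
    have hpt : T₁.parent x ≠ t := by
      rintro rfl
      rw [h3 hxq] at htq
      exact htq (hx.parent_of_ne hT hxq).2
    rw [h3 hxq] at hpt
    simp [RTD.mergeIntoParent, hpt, h3 hxq]
  · simp only [RTD.mergeIntoParent] at hxp
    split_ifs at hxp with h1
    · exact absurd (h.back t (h.nodes_subset t ht) hxp).1 htq
    · exact h.back x hx hxp

/-- Inside the subtree, bags of nodes and parents are those of the `S`-nice `T`, hence nested with
sizes differing by at most one, so no subdivision applies there. -/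
theorem normalizeStep (hN : IsSNice G S T) (hT : T.IsRootedTree) (h : ∃ B, Agree T T₁ q B)
    (hs : NormalizeStep T₁ T₂) : ∃ B, Agree T T₂ q B := by
  obtain ⟨B, h⟩ := h
  obtain ⟨p, t, n, hpt, hn, hs⟩ := hs
  by_cases hp : T.InSubtree p q
  · obtain ⟨h1, -, h3⟩ := h.isParent hT hp hpt
    obtain ⟨h4, h5, h6⟩ := hN.2.1 p t h3
    rw [← (h.sub t h1).2.1, ← (h.sub p hp).2.1] at h4 h5 h6
    rcases hs with ⟨h7, h8, -⟩ | ⟨-, h7, -⟩ | ⟨-, h7, -⟩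
    · exact (h4.elim h7 h8).elim
    · omega
    · omega
  · rcases hs with ⟨-, -, rfl⟩ | ⟨-, -, x, -, rfl⟩ | ⟨-, -, x, -, rfl⟩ <;>
      exact ⟨_, h.subdivide hT hpt hp hn _⟩

/-- A merge inside the subtree would concern two adjacent nodes with the same full bag; `q` being
non-full, both lie in the subtree. Each had two `S`-children in `T`, which are still `S`-children,
so neither condition for merging holds. -/
theorem mergeStep (hT : WeaklySlim G S k T) (hq : (T.bag q).ncard ≤ k)
    (h : ∃ B, Agree T T₁ q B) (hs : MergeStep S k T₁ T₂) : ∃ B, Agree T T₂ q B := by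
  obtain ⟨B, h⟩ := h
  obtain ⟨p, t, hpt, heq, hf, hs, rfl⟩ := hs
  by_cases ht : T.InSubtree t q
  · exfalso
    obtain ⟨-, h2, h3⟩ := h.sub t ht
    rw [IsFull, h2] at hf
    have htq : t ≠ q := by rintro rfl; omega
    have h4 := ht.parent_of_ne hT.rooted htq
    have hp : T.parent t = p := (h3 htq).symm.trans hpt.2.2
    rw [hp] at h4
    rw [h2, (h.sub p h4.2).2.1] at heq
    obtain ⟨h5, h6⟩ := hT.full_two p t ⟨ht.1, h4.1, hp⟩ heq hf
    rcases hs with hs | hs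
    · obtain ⟨c, c', hne, hcc⟩ := Set.ncard_eq_two.1 h5
      have h7 := hs.anti (h.sChildren_subset (S := S) hT.rooted ht)
      rw [hcc] at h7
      exact hne (h7 (Or.inl rfl) (Or.inr rfl))
    · have h7 := h.sChildren_subset (S := S) hT.rooted h4.2
      rw [hs] at h7
      have := Set.ncard_le_ncard h7 (Set.finite_singleton t)
      rw [Set.ncard_singleton] at this
      omega
  · exact ⟨B, h.mergeIntoParent hT.rooted hpt.1 ht⟩

theorem of_reflTransGen {step : RTD V → RTD V → Prop}
    (hs : ∀ T₁ T₂, (∃ B, Agree T T₁ q B) → step T₁ T₂ → ∃ B, Agree T T₂ q B)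
    (h : ∃ B, Agree T T₁ q B) (h' : Relation.ReflTransGen step T₁ T₂) : ∃ B, Agree T T₂ q B := by
  induction h' with
  | refl => exact h
  | tail _ hab ih => exact hs _ _ ih hab

theorem normalize (hN : IsSNice G S T) (hT : T.IsRootedTree) (h : ∃ B, Agree T T₁ q B)
    (h' : Exhaust NormalizeStep T₁ T₂) : ∃ B, Agree T T₂ q B :=
  of_reflTransGen (fun _ _ h hs => normalizeStep hN hT h hs) h h'.1

theorem normalizeAndMerge (hN : IsSNice G S T) (hT : WeaklySlim G S k T)
    (hq : (T.bag q).ncard ≤ k) (h : ∃ B, Agree T T₁ q B) (h' : NormalizeAndMerge S k T₁ T₂) :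
    ∃ B, Agree T T₂ q B := by
  obtain ⟨T₃, h1, h2⟩ := h'
  exact of_reflTransGen (fun _ _ h hs => mergeStep hT hq h hs) (normalize hN hT.rooted h h1) h2.1

theorem of_bag (hT : T.IsRootedTree) (hq : q ≠ T.root) {f : ℕ → Set V}
    (hf : ∀ x, T.InSubtree x q → f x = T.bag x) : Agree T { T with bag := f } q T.nodes := by
  refine ⟨fun x hx => hx, hT.2.2.1, fun h => hq (h.eq_root hT), fun x hx =>
    ⟨hx.1, hf x hx, fun _ => rfl⟩, fun x hx hp => ⟨InSubtree.of_parent hx hp, ?_⟩⟩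
  rintro rfl
  exact IsParent.not_inSubtree hT ⟨hx, hq, rfl⟩ hp

theorem attachAt (hT : T.IsRootedTree) (hq : q ≠ T.root) {f : ℕ → Set V}
    (hf : ∀ x, T.InSubtree x q → f x = T.bag x) {M : Set V} {t : ℕ} (ht : t ∈ T.nodes)
    (htq : ¬ T.InSubtree t q) (h : AttachAt G M t { T with bag := f } T₁) :
    ∃ B, Agree T T₁ q B := by
  have h0 := of_bag hT hq hf
  rcases h with ⟨-, rfl⟩ | ⟨-, U, hdis, hU, -, rfl⟩
  · exact ⟨_, h0⟩
  · have hUT := hU.1.1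
    have hnot : ∀ x ∈ T.nodes, x ∉ U.nodes := fun x hx hx' => Finset.disjoint_left.1 hdis hx hx'
    refine ⟨↑(T.nodes ∪ U.nodes), fun x hx => hx, fun x hx => ?_, h0.root, fun x hx => ?_,
      fun x hx hp => ?_⟩
    · simp only [graft, Finset.coe_union, Set.mem_union, Finset.mem_coe] at hx ⊢
      split_ifs with h1 h2
      · exact Or.inl ht
      · exact Or.inr (hUT.2.2.1 x h2)
      · exact Or.inl (hT.2.2.1 x (hx.resolve_right h2))
    · have hxU := hnot x hx.1
      have hxr : x ≠ U.root := by rintro rfl; exact hxU hUT.1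
      refine ⟨Finset.mem_union_left _ hx.1, ?_, fun _ => ?_⟩
      · simp [graft, hxU, hf x hx]
      · simp [graft, hxU, hxr]
    · simp only [graft] at hp
      split_ifs at hp with h1 h2
      · exact absurd hp htq
      · exact absurd (hUT.2.2.1 x h2) (hnot _ hp.1)
      · refine h0.back x ?_ hp
        rcases Finset.mem_union.1 (Finset.mem_coe.1 hx) with h | h
        · exact h
        · exact absurd h h2

end Agree

/-! ### Tightness prevents modifications -/

section

variable (hN : IsSNice G S T) (hT : WeaklySlim G S k T) {t' : ℕ} (ht' : t' ∈ T.nodes)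
  (htq : ¬ T.InSubtree t' q)
include hT ht' htq

theorem ne_root_of_not_inSubtree : q ≠ T.root := by
  rintro rfl
  exact htq (inSubtree_root hT.rooted ht')

theorem Vset_inter_Vset_subset (hqt : ¬ T.InSubtree q t') : T.Vset t' ∩ T.Vset q ⊆ T.bag q := by
  rintro v ⟨⟨y, hy, hvy⟩, hv⟩
  refine (hT.crossing hv hy.1 (fun h => ?_) hvy).2.1
  rcases h.total hT.rooted hy with h' | h'
  · exact hqt h'
  · exact htq h'

theorem mem_bag_of_mem_Vset {v : V} (hv : v ∈ T.Vset q) (hvt : v ∈ T.bag t') : v ∈ T.bag q :=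
  (hT.crossing hv ht' htq hvt).2.1

omit ht' htq in
theorem Tight.disjoint (h : Tight G S (T.Vset q) (T.bag q)) {M : Set V} (hM : M ⊆ Sᶜ)
    (hN : nbhd G M ∩ T.Vset q ⊆ T.bag q) {v : V} (hv : v ∈ M) : v ∉ T.Vset q :=
  h.notMem_of_nbhd hM hN (fun _ ha _ hab haX => hT.mem_Vset_of_adj ha hab (Or.inl haX)) hv

variable (hq : q ∈ T.nodes) (hk : (T.bag q).ncard ≤ k) (h : Tight G S (T.Vset q) (T.bag q))
include hN hq h

/-- If `v` occurred in a bag below `q`, it would be in `X_q` because it also occurs at `t'` outside.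
Its neighbors in `V_q \ X_q` would be among `{u}` with `u ∉ S`, contradicting tightness. So the
replacement finds no `v` below `q`. -/
theorem Tight.bringNeighborUp {v u : V} (hv : v ∈ T.bag t' \ S) (hu : u ∉ S)
    (hNv : G.neighborSet v ∩ (T.Vset t' \ T.bag t') = {u}) (h' : BringNeighborUp T t' v u T₁) :
    SubtreeUnchanged T T₁ q := by
  refine (Agree.normalize hN hT.rooted ⟨_, Agree.of_bag hT.rooted
    (ne_root_of_not_inSubtree hT ht' htq) fun x hx => ?_⟩ h').elim fun B hB =>
    hB.subtreeUnchanged hT.rooted hq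
  have hxt : x ≠ t' := by rintro rfl; exact htq hx
  simp only [hxt, if_false]
  split_ifs with hxt'
  · have hqt : T.InSubtree q t' := (hx.total hT.rooted hxt').resolve_right htq
    have hvx : v ∉ T.bag x := by
      intro hvx
      have hvq := mem_bag_of_mem_Vset hT ht' htq ⟨x, hx, hvx⟩ hv.1
      have hsub : G.neighborSet v ∩ (T.Vset q \ T.bag q) ⊆ {u} := by
        rw [← hNv]
        exact fun w hw => ⟨hw.1, Vset_mono hqt hw.2.1,
          fun hwt => hw.2.2 (mem_bag_of_mem_Vset hT ht' htq hw.2.1 hwt)⟩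
      exact h.2 v ⟨hvq, hv.2⟩ (Set.subsingleton_singleton.anti hsub)
        (hsub.trans (Set.singleton_subset_iff.2 hu))
    ext y
    simp only [replace, Set.mem_ofPred_eq, hvx, false_and, or_false, and_iff_left_iff_imp]
    rintro hy rfl
    exact hvx hy
  · rfl

/-- As for bringing a neighbor up; now `q` and `t'` lie in disjoint subtrees in the relevant case,
so vertices of `V_q \ X_q` lie outside `V_{t'}`. -/
theorem Tight.bringNeighborDown {v u : V} (hv : v ∈ T.bag t' \ S) (hu : u ∉ S)
    (hNv : G.neighborSet v ∩ (T.Vset t')ᶜ = {u}) (h' : BringNeighborDown T t' v u T₁) :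
    SubtreeUnchanged T T₁ q := by
  refine (Agree.normalize hN hT.rooted ⟨_, Agree.of_bag hT.rooted
    (ne_root_of_not_inSubtree hT ht' htq) fun x hx => ?_⟩ h').elim fun B hB =>
    hB.subtreeUnchanged hT.rooted hq
  have hxt : x ≠ t' := by rintro rfl; exact htq hx
  simp only [hxt, if_false]
  split_ifs with hxt'
  · rfl
  · have hqt : ¬ T.InSubtree q t' := fun hqt => hxt' (hx.trans hqt)
    have hvx : v ∉ T.bag x := by
      intro hvx
      have hvq := mem_bag_of_mem_Vset hT ht' htq ⟨x, hx, hvx⟩ hv.1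
      have hsub : G.neighborSet v ∩ (T.Vset q \ T.bag q) ⊆ {u} := by
        rw [← hNv]
        exact fun w hw => ⟨hw.1, fun hwt => hw.2.2
          (Vset_inter_Vset_subset hT ht' htq hqt ⟨hwt, hw.2.1⟩)⟩
      exact h.2 v ⟨hvq, hv.2⟩ (Set.subsingleton_singleton.anti hsub)
        (hsub.trans (Set.singleton_subset_iff.2 hu))
    ext y
    simp only [replace, Set.mem_ofPred_eq, hvx, false_and, or_false, and_iff_left_iff_imp]
    rintro hy rfl
    exact hvx hy

include hk

/-- A deletion can affect the subtree at `q` only if `q` is not below `t'`. In that case `N(M) ∩ V_q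
⊆ V_{t'} ∩ V_q ⊆ X_q`, so by tightness `M` does not meet `V_q`. -/
theorem Tight.moveIntoSubtree {M : Set V} (hM : M ⊆ Sᶜ) (hNM : nbhd G M ⊆ T.Vset t')
    (h' : MoveIntoSubtree G S k T t' M T₁) : SubtreeUnchanged T T₁ q := by
  obtain ⟨T₂, h1, h2⟩ := h'
  refine (Agree.normalizeAndMerge hN hT hk (Agree.attachAt hT.rooted
    (ne_root_of_not_inSubtree hT ht' htq) (fun x hx => ?_) ht' htq h1) h2).elim fun B hB =>
    hB.subtreeUnchanged hT.rooted hq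
  ext y
  refine ⟨fun hy => hy.1, fun hy => ⟨hy, fun hyM => ?_⟩⟩
  by_contra hxt
  have hqt : ¬ T.InSubtree q t' := fun hqt => hxt (hx.trans hqt)
  exact h.disjoint hT hM ((Set.inter_subset_inter_left _ hNM).trans
    (Vset_inter_Vset_subset hT ht' htq hqt)) hyM ⟨x, hx, hy⟩

/-- A deletion can affect the subtree at `q` only if `q` is below `t'`. In that case the neighbors
of `M` in `V_q` are in `X_p`, and hence in `X_q` since `p` is outside that subtree; tightness gives
`M ∩ V_q = ∅`. -/
theorem Tight.removeFromSubtree {M : Set V} {p : ℕ} (hp : T.IsParent p t') (hM : M ⊆ Sᶜ)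
    (hNM : nbhd G M ⊆ (T.Vset t')ᶜ ∪ T.bag p) (h' : RemoveFromSubtree G S k T p t' M T₁) :
    SubtreeUnchanged T T₁ q := by
  have hpq : ¬ T.InSubtree p q := fun h => htq ((hp.inSubtree hT.rooted).trans h)
  have hpn := hp.parent_mem hT.rooted
  obtain ⟨T₂, h1, h2⟩ := h'
  refine (Agree.normalizeAndMerge hN hT hk (Agree.attachAt hT.rooted
    (ne_root_of_not_inSubtree hT ht' htq) (fun x hx => ?_) hpn hpq h1) h2).elim fun B hB =>
    hB.subtreeUnchanged hT.rooted hq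
  ext y
  refine ⟨fun hy => hy.1, fun hy => ⟨hy, fun hyM hxt => ?_⟩⟩
  have hqt : T.InSubtree q t' := (hx.total hT.rooted hxt).resolve_right htq
  refine h.disjoint hT hM ?_ hyM ⟨x, hx, hy⟩
  rintro w ⟨hw, hwq⟩
  rcases hNM hw with hw' | hw'
  · exact absurd (Vset_mono hqt hwq) hw'
  · exact mem_bag_of_mem_Vset hT hpn hpq hwq hw'

end

end RTD
-- Existence of a minimal decomposition and the conclusion
namespace RTD

variable {V : Type*} {T : RTD V} {S : Set V} {G : SimpleGraph V} {k : ℕ}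

theorem exists_isMinimal {T₀ : RTD V} {σ : Set V × Set V × Set V} (h : Admissible G S k T₀ σ T) :
    ∃ T₁, IsMinimal G S k T₀ σ T₁ := by
  have hs := Nat.sInf_mem (s := {n | ∃ T₁, Admissible G S k T₀ σ T₁ ∧ weight S T₁ = n})
    ⟨_, T, h, rfl⟩
  obtain ⟨T₁, h1, h2⟩ := hs
  exact ⟨T₁, h1, fun T₂ h3 => h2.trans_le (Nat.sInf_le ⟨T₂, h3, rfl⟩)⟩

/-- The naming of the subdivided tree is free, so the marked bottom node and its parent can receive
the prescribed names. -/
theorem exists_equiv_apply_eq {a b : ℕ × ℕ} {s t : ℕ} (hab : b ≠ a) (hst : s ≠ t) :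
    ∃ e : ℕ × ℕ ≃ ℕ, e a = s ∧ e b = t := by
  set e₁ := Nat.pairEquiv.trans (Equiv.swap (Nat.pairEquiv a) s) with he
  have h1 : e₁ a = s := by simp [he]
  refine ⟨e₁.trans (Equiv.swap (e₁ b) t), ?_, by simp⟩
  rw [Equiv.trans_apply, h1]
  exact Equiv.swap_apply_of_ne_of_ne (fun h => hab (e₁.injective (h.symm.trans h1.symm))) hst

theorem sibling_of_directPred {T₁ : RTD V} (h : ∀ τ σ, T₁.DirectPred S τ σ ↔ T.DirectPred S τ σ) :
    Sibling S T T₁ := fun τ σ =>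
  ⟨Relation.TransGen.mono (fun a b => (h a b).2) τ σ,
    Relation.TransGen.mono (fun a b => (h a b).1) τ σ⟩

end RTD

theorem mainTheorem6 {V : Type*} [Finite V] (G : SimpleGraph V) (S : Set V) (k : ℕ)
    (T : RTD V) (hnice : RTD.IsSNice G S T) (hwidth : T.width = (k : ℤ))
    (hslim : RTD.IsSlim G S k T)
    (t s : ℕ) (hparent : T.IsParent t s) (hbottom : T.IsSBottom S s)
    (hnonfull : (T.bag t).ncard ≤ k) :
    ∃ T' : RTD V, RTD.IsSNice G S T' ∧ T'.width ≤ (k : ℤ) ∧ RTD.IsSlim G S k T' ∧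
      RTD.Sibling S T T' ∧
      T'.IsParent t s ∧ T'.IsSBottom S s ∧ T'.trace S s = T.trace S s ∧
      RTD.IsTopHeavy G S k T' t := by
  have hT := hnice.weaklySlim hwidth.le hslim
  have hA : RTD.Admissible G S k T (T.trace S s) T := { hT with
    pred := fun _ _ => Iff.rfl
    -- The given decomposition is itself admissible: a full bag shared by `s` and `t` would
    -- contradict that `t` is non-full.
    mark := ⟨t, s, hparent, hbottom, rfl, fun ⟨h1, h2⟩ => by
      rw [RTD.IsFull, h1] at h2
      omega⟩ }
  obtain ⟨T₁, hmin⟩ := RTD.exists_isMinimal hA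
  obtain ⟨p, b, hpb, hb, htr, hf⟩ := hmin.1.mark
  have hT₁ := hmin.1.toWeaklySlim
  obtain ⟨m, β, H⟩ := RTD.exists_isCompletion hT₁
  obtain ⟨x, hx, hx'⟩ := H.exists_parent hT₁ hpb hb hf
  obtain ⟨e, he, he'⟩ := RTD.exists_equiv_apply_eq hx (hparent.ne hT.rooted)
  obtain ⟨hpar, hk⟩ := hx' e
  have hsk := H.isChains.skel (e := e) hT₁.rooted
  have hA' := H.isChains.admissible (e := e) hmin.1
  have hbot := hsk.isSBottom_image hT₁.rooted hA'.rooted hb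
  have htr' := hsk.trace b hb.1
  rw [he, he'] at hpar
  rw [he'] at hk
  rw [he] at hbot htr'
  have hN := H.isSNice (e := e) hT₁
  -- Tightness holds at every non-full parent of a bottom node, whether or not it lies below `t`.
  have htight : ∀ q, (T₁.chains e m β).IsNonfullParentOfBottom S k q → q ∈ (T₁.chains e m β).nodes ∧
      RTD.Tight G S ((T₁.chains e m β).Vset q) ((T₁.chains e m β).bag q) :=
    fun q ⟨⟨s', hs, hs'⟩, hq⟩ => ⟨hs.parent_mem hA'.rooted, H.tight hmin hs hs' hq⟩
  refine ⟨T₁.chains e m β, hN, H.width_le hT₁, H.isSlim hT₁,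
    RTD.sibling_of_directPred hA'.pred, hpar, hbot, htr'.trans htr,
    ⟨⟨s, hpar, hbot⟩, hk⟩, fun b' hb' _ C hC c hc => H.disjoint_sChild hmin hb' hC hc, ?_, ?_, ?_, ?_⟩
  · intro q _ hq t' ht' htq M hM hNM T' h'
    exact (htight q hq).2.moveIntoSubtree hN hA'.toWeaklySlim ht' htq (htight q hq).1 hq.2 hM hNM h'
  · intro q _ hq t' ht' htq p' hp' M hM hNM T' h'
    exact (htight q hq).2.removeFromSubtree hN hA'.toWeaklySlim ht' htq (htight q hq).1 hq.2 hp' hM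
      hNM h'
  · intro q _ hq t' ht' htq _ v hv u hu hNv T' h'
    exact (htight q hq).2.bringNeighborUp hN hA'.toWeaklySlim ht' htq (htight q hq).1 hv hu hNv h'
  · intro q _ hq t' ht' htq _ v hv u hu hNv T' h'
    exact (htight q hq).2.bringNeighborDown hN hA'.toWeaklySlim ht' htq (htight q hq).1 hv hu hNv h'
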